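/- Let $k$ be a field and let $H=(H,\Delta,\varepsilon,\phi,S,\alpha,\beta)$ be a finite-dimensional quasi-Hopf algebra over $k$ (in the convention $(\mathrm{id}\otimes\Delta)\Delta(h)=\phi\,(\Delta\otimes\mathrm{id})\Delta(h)\,\phi^{-1}$, $S(h_{(1)})\alpha h_{(2)}=\varepsilon(h)\alpha$, $h_{(1)}\beta S(h_{(2)})=\varepsilon(h)\beta$, $\phi_1\beta S(\phi_2)\alpha\phi_3=1=S(\bar\phi_1)\alpha\bar\phi_2\beta S(\bar\phi_3)$, where $S$ is an anti-algebra map and $\phi^{-1}=\bar\phi_1\otimes\bar\phi_2\otimes\bar\phi_3$), normalized so that $\varepsilon(\alpha)=\varepsilon(\beta)=1$. Then $S$ is bijective; write $\overline{S}$ for its inverse. Notation. Put $p^R=\bar\phi_1\otimes\bar\phi_2\beta S(\bar\phi_3)$, $q^R=\phi_1\otimes\overline S(\alpha\phi_3)\phi_2$, $p^L=\phi_2\overline S(\phi_1\beta)\otimes\phi_3$, $q^L=S(\bar\phi_1)\alpha\bar\phi_2\otimes\bar\phi_3$, let $\mathbf f=\mathbf f_1\otimes\mathbf f_2$ be Drinfeld's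 gauge transformation, with inverse $\bar{\mathbf f}_1\otimes\bar{\mathbf f}_2$, so that $\mathbf f\,\Delta(S(h))\,\mathbf f^{-1}=S(h_{(2)})\otimes S(h_{(1)})$, explicitly $$\mathbf f=(S\otimes S)\Delta^{\mathrm{cop}}(p^R_1)\cdot\mathbf a\cdot\Delta(p^R_2),\qquad \mathbf f^{-1}=\Delta(q^L_1)\cdot\mathbf b\cdot(S\otimes S)\Delta^{\mathrm{cop}}(q^L_2),$$ $$\mathbf a=S(\bar\phi_1\phi_2)\alpha\bar\phi_2\phi_{3(1)}\otimes S(\phi_1)\alpha\bar\phi_3\phi_{3(2)},\qquad \mathbf b=\phi_{1(1)}\bar\phi_1\beta S(\phi_3)\otimes\phi_{1(2)}\bar\phi_2\beta S(\phi_2\bar\phi_3),$$ and put $$U^L=\bar{\mathbf f}_1S(q^R_2)\otimes\bar{\mathbf f}_2S(q^R_1),\quad V^R=S(p^L_2)\mathbf f_1\otimes S(p^L_1)\mathbf f_2,\quad U^R=\overline S(q^L_2\bar{\mathbf f}_2)\otimes\overline S(q^L_1\bar{\mathbf f}_1),\quad V^L=\overline S(\mathbf f_2p^R_2)\otimes\overline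 S(\mathbf f_1p^R_1).$$ Let $\{h_i\}$ be a basis of $H$ with dual basis $\{h^i\}$ of $H^*$. Cointegrals (Hausser–Nill). The left dual $H^\vee$ of $H$ is $H^*$ with $\langle h\cdot\xi\cdot h',x\rangle=\langle\xi,S(h)\,x\,\overline S(h')\rangle$ and the left coaction $\xi\mapsto\xi_{(-1)}\otimes\xi_{(0)}=\sum_i\langle\xi,V^R_1h_{i(1)}U^R_1\rangle\,V^R_2h_{i(2)}U^R_2\otimes h^i$. The space of right cointegrals on $H$ is the image of the map $\xi\mapsto q^L_2\cdot\xi_{(0)}\cdot\overline S(\beta)\overline S(q^L_1\xi_{(-1)})$ on $H^\vee$. The right dual ${}^\vee H$ is $H^*$ with $\langle h\cdot\xi\cdot h',x\rangle=\langle\xi,\overline S(h)\,x\,S(h')\rangle$ and the right coaction $\xi\mapsto\xi_{(0)}\otimes\xi_{(1)}=\sum_ih^i\otimes V^L_1h_{i(1)}U^L_1\langle\xi,V^L_2h_{i(2)}U^L_2\rangle$. The space of left cointegrals on $H$ is the image of the map $E(\xi)=q^R_1\cdot\xi_{(0)}\cdot\beta S(q^R_2\xi_{(1)})$ on ${}^\vee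 H$. There is a unique algebra map $\mu:H\to k$, the modular function, such that $E(h\cdot\xi)=\mu(h)\xi$ for all $h\in H$ and all left cointegrals $\xi$. Categorical cointegrals. Morphisms of Yetter–Drinfeld $H$-modules are the $k$-linear maps that preserve the $H$-action and the $H$-coaction of the second kind. The Yetter–Drinfeld module $\mathbf A_\mu$ is the space $H$ with $$h\triangleright a=h_{(1,1)}\,a\,S(h_{(2)})\,\mu(h_{(1,2)}),\qquad \delta(a)=\omega_1a_{(1)}\omega_5\otimes\omega_2a_{(2)}\omega_4\,\mu(\omega_3),$$ where $\omega=(1\otimes1\otimes1\otimes\bar{\mathbf f}_2\otimes\bar{\mathbf f}_1)\cdot(\mathrm{id}\otimes\Delta\otimes S\otimes S)(\chi)\cdot(\phi\otimes1\otimes1)$ and $\chi=(\phi\otimes1)\cdot(\Delta\otimes\mathrm{id}\otimes\mathrm{id})(\phi^{-1})$. The unit object is $\mathbb 1=k$, with action through $\varepsilon$ and coaction $1\mapsto\beta\otimes1$. Theorem. Let $\lambda$ be a non-zero right cointegral on $H$. Then the space $\mathrm{Hom}_{\mathcal{YD}}(\mathbf A_\mu,\mathbb 1)$ of categorical cointegrals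 is one-dimensional, and it is spanned by the map $\lambda^{\mathrm{cat}}:\mathbf A_\mu\to\mathbb 1$, $\lambda^{\mathrm{cat}}(a)=\langle\lambda,\alpha\,\overline S(a)\rangle$. -/

import Mathlib

open scoped TensorProduct

/-- A quasi-Hopf algebra over a field `k` with underlying algebra `H`. Triple and higher tensor
powers are bracketed to the right. The normalisation `ε(α) = ε(β) = 1` is part of the structure. The
antipode is an anti-algebra map, and its bijectivity is not assumed. -/
structure QuasiHopfAlgebra (k H : Type*) [Field k] [Ring H] [Algebra k H] where
  /-- comultiplication -/
  Δ : H →ₐ[k] H ⊗[k] H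
  /-- counit -/
  ε : H →ₐ[k] k
  /-- associator -/
  φ : (H ⊗[k] (H ⊗[k] H))ˣ
  /-- antipode -/
  S : H →ₗ[k] H
  α : H
  β : H
  S_one : S 1 = 1
  S_mul : ∀ x y : H, S (x * y) = S y * S x
  /-- `h₁ ⊗ Δ(h₂) = φ (Δ(h₁) ⊗ h₂) φ⁻¹` -/
  coassoc : ∀ h : H,
    Algebra.TensorProduct.map (AlgHom.id k H) Δ (Δ h) =
      (φ : H ⊗[k] (H ⊗[k] H)) *
        Algebra.TensorProduct.assoc k k k H H H
          (Algebra.TensorProduct.map Δ (AlgHom.id k H) (Δ h)) *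
        ((φ⁻¹ : (H ⊗[k] (H ⊗[k] H))ˣ) : H ⊗[k] (H ⊗[k] H))
  /-- `ε(h₁) h₂ = h` -/
  counit_left : ∀ h : H, TensorProduct.lid k H (ε.toLinearMap.rTensor H (Δ h)) = h
  /-- `h₁ ε(h₂) = h` -/
  counit_right : ∀ h : H, TensorProduct.rid k H (ε.toLinearMap.lTensor H (Δ h)) = h
  /-- `(id ⊗ id ⊗ Δ)(φ) (Δ ⊗ id ⊗ id)(φ) = (1 ⊗ φ) (id ⊗ Δ ⊗ id)(φ) (φ ⊗ 1)` -/
  pentagon :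
    Algebra.TensorProduct.map (AlgHom.id k H)
        (Algebra.TensorProduct.map (AlgHom.id k H) Δ) (φ : H ⊗[k] (H ⊗[k] H)) *
      Algebra.TensorProduct.assoc k k k H H (H ⊗[k] H)
        (Algebra.TensorProduct.map Δ (AlgHom.id k (H ⊗[k] H)) (φ : H ⊗[k] (H ⊗[k] H))) =
    ((1 : H) ⊗ₜ[k] (φ : H ⊗[k] (H ⊗[k] H))) *
      Algebra.TensorProduct.map (AlgHom.id k H)
        ((Algebra.TensorProduct.assoc k k k H H H).toAlgHom.comp
          (Algebra.TensorProduct.map Δ (AlgHom.id k H))) (φ : H ⊗[k] (H ⊗[k] H)) *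
      Algebra.TensorProduct.map (AlgHom.id k H)
        (Algebra.TensorProduct.map (AlgHom.id k H) Algebra.TensorProduct.includeLeft)
        (φ : H ⊗[k] (H ⊗[k] H))
  /-- `(id ⊗ ε ⊗ id)(φ) = 1 ⊗ 1` -/
  counit_φ :
    ((TensorProduct.lid k H).toLinearMap ∘ₗ ε.toLinearMap.rTensor H).lTensor H
      (φ : H ⊗[k] (H ⊗[k] H)) = 1
  /-- `S(h₁) α h₂ = ε(h) α` -/
  antipode_α : ∀ h : H,
    LinearMap.mul' k H (TensorProduct.map S (LinearMap.mulLeft k α) (Δ h)) = ε h • α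
  /-- `h₁ β S(h₂) = ε(h) β` -/
  antipode_β : ∀ h : H,
    LinearMap.mul' k H (TensorProduct.map (LinearMap.mulRight k β) S (Δ h)) = ε h • β
  /-- `φ₁ β S(φ₂) α φ₃ = 1` -/
  antipode_φ :
    LinearMap.mul' k H
      (TensorProduct.map (LinearMap.mulRight k β)
        (LinearMap.mul' k H ∘ₗ TensorProduct.map S (LinearMap.mulLeft k α))
        (φ : H ⊗[k] (H ⊗[k] H))) = 1
  /-- `S(φ̄₁) α φ̄₂ β S(φ̄₃) = 1`, where `φ⁻¹ = φ̄₁ ⊗ φ̄₂ ⊗ φ̄₃` -/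
  antipode_φ_inv :
    LinearMap.mul' k H
      (TensorProduct.map S
        (LinearMap.mul' k H ∘ₗ
          TensorProduct.map (LinearMap.mulLeft k α) (LinearMap.mulLeft k β ∘ₗ S))
        ((φ⁻¹ : (H ⊗[k] (H ⊗[k] H))ˣ) : H ⊗[k] (H ⊗[k] H))) = 1
  ε_α : ε α = 1
  ε_β : ε β = 1

namespace QuasiHopfAlgebra

noncomputable section

variable {k H : Type*} [Field k] [Ring H] [Algebra k H] (Q : QuasiHopfAlgebra k H)

/-- The associator as an element of `H ⊗ H ⊗ H`. -/
def phi : H ⊗[k] (H ⊗[k] H) := (Q.φ : H ⊗[k] (H ⊗[k] H))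

/-- The inverse `φ⁻¹ = φ̄₁ ⊗ φ̄₂ ⊗ φ̄₃` of the associator. -/
def phiInv : H ⊗[k] (H ⊗[k] H) :=
  ((Q.φ⁻¹ : (H ⊗[k] (H ⊗[k] H))ˣ) : H ⊗[k] (H ⊗[k] H))

/-- The inverse `S̄` of the antipode, taken in the algebra of linear endomorphisms of `H` (it is
the zero map if the antipode is not bijective). -/
def Sinv : H →ₗ[k] H := Ring.inverse (Q.S : Module.End k H)

/-- `(id ⊗ id ⊗ Δ) : H^{⊗3} → H^{⊗4}` -/
def Δ₃ : H ⊗[k] (H ⊗[k] H) →ₐ[k] H ⊗[k] (H ⊗[k] (H ⊗[k] H)) :=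
  Algebra.TensorProduct.map (AlgHom.id k H) (Algebra.TensorProduct.map (AlgHom.id k H) Q.Δ)

/-- `(Δ ⊗ id ⊗ id) : H^{⊗3} → H^{⊗4}` -/
def Δ₁ : H ⊗[k] (H ⊗[k] H) →ₐ[k] H ⊗[k] (H ⊗[k] (H ⊗[k] H)) :=
  (Algebra.TensorProduct.assoc k k k H H (H ⊗[k] H)).toAlgHom.comp
    (Algebra.TensorProduct.map Q.Δ (AlgHom.id k (H ⊗[k] H)))

/-- `x ⊗ y ⊗ z ↦ x ⊗ y ⊗ z ⊗ 1` -/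
def tensorOne : H ⊗[k] (H ⊗[k] H) →ₐ[k] H ⊗[k] (H ⊗[k] (H ⊗[k] H)) :=
  Algebra.TensorProduct.map (AlgHom.id k H)
    (Algebra.TensorProduct.map (AlgHom.id k H) Algebra.TensorProduct.includeLeft)

/-- The flip `x ⊗ y ↦ y ⊗ x` of `H ⊗ H`. -/
def flip : H ⊗[k] H →ₗ[k] H ⊗[k] H := (TensorProduct.comm k H H).toLinearMap

/-- `(S ⊗ S)(t₂₁)`, that is `x ⊗ y ↦ S(y) ⊗ S(x)`. -/
def SSflip : H ⊗[k] H →ₗ[k] H ⊗[k] H := TensorProduct.map Q.S Q.S ∘ₗ flip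

/-- `(S̄ ⊗ S̄)(t₂₁)`, that is `x ⊗ y ↦ S̄(y) ⊗ S̄(x)`. -/
def SinvSinvflip : H ⊗[k] H →ₗ[k] H ⊗[k] H := TensorProduct.map Q.Sinv Q.Sinv ∘ₗ flip

/-! ### The elements `pᴿ, qᴿ, pᴸ, qᴸ` -/

/-- `x ⊗ y ↦ x β S(y)` -/
def mulβS : H ⊗[k] H →ₗ[k] H :=
  LinearMap.mul' k H ∘ₗ TensorProduct.map (LinearMap.mulRight k Q.β) Q.S

/-- `x ⊗ y ↦ S(x) α y` -/
def mulSα : H ⊗[k] H →ₗ[k] H :=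
  LinearMap.mul' k H ∘ₗ TensorProduct.map Q.S (LinearMap.mulLeft k Q.α)

/-- `pᴿ = φ̄₁ ⊗ φ̄₂ β S(φ̄₃)` -/
def pR : H ⊗[k] H := Q.mulβS.lTensor H Q.phiInv

/-- `qᴿ = φ₁ ⊗ S̄(α φ₃) φ₂` -/
def qR : H ⊗[k] H :=
  (LinearMap.mul' k H ∘ₗ flip ∘ₗ
    (Q.Sinv ∘ₗ LinearMap.mulLeft k Q.α).lTensor H).lTensor H Q.phi

/-- `pᴸ = φ₂ S̄(φ₁ β) ⊗ φ₃` -/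
def pL : H ⊗[k] H :=
  (LinearMap.mul' k H ∘ₗ flip ∘ₗ
    (Q.Sinv ∘ₗ LinearMap.mulRight k Q.β).rTensor H).rTensor H
    ((TensorProduct.assoc k H H H).symm Q.phi)

/-- `qᴸ = S(φ̄₁) α φ̄₂ ⊗ φ̄₃` -/
def qL : H ⊗[k] H :=
  Q.mulSα.rTensor H ((TensorProduct.assoc k H H H).symm Q.phiInv)

/-! ### Drinfeld's gauge transformation -/

/-- `x₁ ⊗ x₂ ⊗ x₃ ⊗ x₄ ↦ (x₂ ⊗ x₃) ⊗ (x₁ ⊗ x₄)` -/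
def perm2314 : H ⊗[k] (H ⊗[k] (H ⊗[k] H)) →ₗ[k] (H ⊗[k] H) ⊗[k] (H ⊗[k] H) :=
  (TensorProduct.assoc k H H (H ⊗[k] H)).symm.toLinearMap ∘ₗ
    (TensorProduct.leftComm k H H H).toLinearMap.lTensor H ∘ₗ
    (TensorProduct.leftComm k H H (H ⊗[k] H)).toLinearMap

/-- `x₁ ⊗ x₂ ⊗ x₃ ⊗ x₄ ↦ (x₁ ⊗ x₄) ⊗ (x₂ ⊗ x₃)` -/
def perm1423 : H ⊗[k] (H ⊗[k] (H ⊗[k] H)) →ₗ[k] (H ⊗[k] H) ⊗[k] (H ⊗[k] H) :=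
  (TensorProduct.assoc k H H (H ⊗[k] H)).symm.toLinearMap ∘ₗ
    ((TensorProduct.comm k (H ⊗[k] H) H).toLinearMap ∘ₗ
      (TensorProduct.assoc k H H H).symm.toLinearMap).lTensor H

/-- `a = S(φ̄₁ φ₂) α φ̄₂ φ₃₍₁₎ ⊗ S(φ₁) α φ̄₃ φ₃₍₂₎` -/
def aElt : H ⊗[k] H :=
  TensorProduct.map Q.mulSα Q.mulSα
    (perm2314 (((1 : H) ⊗ₜ[k] Q.phiInv) * Q.Δ₃ Q.phi))

/-- `b = φ₁₍₁₎ φ̄₁ β S(φ₃) ⊗ φ₁₍₂₎ φ̄₂ β S(φ₂ φ̄₃)` -/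
def bElt : H ⊗[k] H :=
  TensorProduct.map Q.mulβS Q.mulβS (perm1423 (Q.Δ₁ Q.phi * tensorOne Q.phiInv))

/-- `f = (S ⊗ S)(Δᶜᵒᵖ(pᴿ₁)) a Δ(pᴿ₂)` -/
def f : H ⊗[k] H :=
  LinearMap.mul' k (H ⊗[k] H)
    (TensorProduct.map
      (LinearMap.mulRight k Q.aElt ∘ₗ Q.SSflip ∘ₗ Q.Δ.toLinearMap) Q.Δ.toLinearMap Q.pR)

/-- `f⁻¹ = Δ(qᴸ₁) b (S ⊗ S)(Δᶜᵒᵖ(qᴸ₂))` -/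
def fInv : H ⊗[k] H :=
  LinearMap.mul' k (H ⊗[k] H)
    (TensorProduct.map
      (LinearMap.mulRight k Q.bElt ∘ₗ Q.Δ.toLinearMap) (Q.SSflip ∘ₗ Q.Δ.toLinearMap) Q.qL)

/-- `Uᴸ = f̄₁ S(qᴿ₂) ⊗ f̄₂ S(qᴿ₁)`, where `f⁻¹ = f̄₁ ⊗ f̄₂` -/
def UL : H ⊗[k] H := Q.fInv * Q.SSflip Q.qR

/-- `Vᴿ = S(pᴸ₂) f₁ ⊗ S(pᴸ₁) f₂` -/
def VR : H ⊗[k] H := Q.SSflip Q.pL * Q.f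

/-- `Uᴿ = S̄(qᴸ₂ f̄₂) ⊗ S̄(qᴸ₁ f̄₁)` -/
def UR : H ⊗[k] H := Q.SinvSinvflip (Q.qL * Q.fInv)

/-- `Vᴸ = S̄(f₂ pᴿ₂) ⊗ S̄(f₁ pᴿ₁)` -/
def VL : H ⊗[k] H := Q.SinvSinvflip (Q.f * Q.pR)

/-! ### Coinvariants of quasi-Hopf bimodules

For a bimodule, `actL h m` is `h · m` and `actR h m` is `m · h`. -/

section Coinvariants

variable {M : Type*} [AddCommGroup M] [Module k M]

/-- The map `E(m) = qᴿ₁ · m₍₀₎ · β S(qᴿ₂ m₍₁₎)` of a right quasi-Hopf bimodule `M` with right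
coaction `ρ(m) = m₍₀₎ ⊗ m₍₁₎`. -/
def coinvMap (actL actR : H →ₗ[k] Module.End k M) (ρ : M →ₗ[k] M ⊗[k] H) : M →ₗ[k] M :=
  TensorProduct.lift actR.flip ∘ₗ
    TensorProduct.map (TensorProduct.lift actL)
      (LinearMap.mulLeft k Q.β ∘ₗ Q.S ∘ₗ LinearMap.mul' k H) ∘ₗ
    (TensorProduct.tensorTensorTensorComm k H H M H).toLinearMap ∘ₗ
    TensorProduct.mk k (H ⊗[k] H) (M ⊗[k] H) Q.qR ∘ₗ ρ

/-- The map `Eᶜᵒᵖ(m) = qᴸ₂ · m₍₀₎ · S̄(β) S̄(qᴸ₁ m₍₋₁₎)` of a left quasi-Hopf bimodule `M` with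
left coaction `δ(m) = m₍₋₁₎ ⊗ m₍₀₎`. -/
def coinvMapCop (actL actR : H →ₗ[k] Module.End k M) (δ : M →ₗ[k] H ⊗[k] M) : M →ₗ[k] M :=
  TensorProduct.lift actR ∘ₗ
    TensorProduct.map (LinearMap.mulLeft k (Q.Sinv Q.β) ∘ₗ Q.Sinv ∘ₗ LinearMap.mul' k H)
      (TensorProduct.lift actL) ∘ₗ
    (TensorProduct.tensorTensorTensorComm k H H H M).toLinearMap ∘ₗ
    TensorProduct.mk k (H ⊗[k] H) (H ⊗[k] M) Q.qL ∘ₗ δ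

end Coinvariants

/-! ### The dual quasi-Hopf bimodules of `H`

An element `∑ ξᵢ ⊗ aᵢ` of `H* ⊗ H` corresponds to the linear map `x ↦ ∑ ξᵢ(x) aᵢ` on `H`; for a
basis `hᵢ` of `H` with dual basis `hⁱ`, the map `T` corresponds to `∑ hⁱ ⊗ T(hᵢ)`. -/

/-- The left action of `H` on the right dual `ᵛH`: `⟨h · ξ, x⟩ = ⟨ξ, S̄(h) x⟩`. -/
def rdualActL : H →ₗ[k] Module.End k (Module.Dual k H) :=
  Module.Dual.transpose ∘ₗ LinearMap.mul k H ∘ₗ Q.Sinv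

/-- The right action of `H` on the right dual `ᵛH`: `⟨ξ · h, x⟩ = ⟨ξ, x S(h)⟩`. -/
def rdualActR : H →ₗ[k] Module.End k (Module.Dual k H) :=
  Module.Dual.transpose ∘ₗ (LinearMap.mul k H).flip ∘ₗ Q.S

/-- The left action of `H` on the left dual `Hᵛ`: `⟨h · ξ, x⟩ = ⟨ξ, S(h) x⟩`. -/
def ldualActL : H →ₗ[k] Module.End k (Module.Dual k H) :=
  Module.Dual.transpose ∘ₗ LinearMap.mul k H ∘ₗ Q.S

/-- The right action of `H` on the left dual `Hᵛ`: `⟨ξ · h, x⟩ = ⟨ξ, x S̄(h)⟩`. -/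
def ldualActR : H →ₗ[k] Module.End k (Module.Dual k H) :=
  Module.Dual.transpose ∘ₗ (LinearMap.mul k H).flip ∘ₗ Q.Sinv

/-- `x ↦ Vᴸ₁ x₍₁₎ Uᴸ₁ ⟨ξ, Vᴸ₂ x₍₂₎ Uᴸ₂⟩`, linear in `ξ`. -/
def rdualCoactMap : Module.Dual k H →ₗ[k] (H →ₗ[k] H) where
  toFun ξ := (TensorProduct.rid k H).toLinearMap ∘ₗ ξ.lTensor H ∘ₗ
    LinearMap.mulLeft k Q.VL ∘ₗ LinearMap.mulRight k Q.UL ∘ₗ Q.Δ.toLinearMap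
  map_add' ξ η := by
    ext x; simp [LinearMap.lTensor_add]
  map_smul' c ξ := by
    ext x; simp [LinearMap.lTensor_smul]

/-- `x ↦ ⟨ξ, Vᴿ₁ x₍₁₎ Uᴿ₁⟩ Vᴿ₂ x₍₂₎ Uᴿ₂`, linear in `ξ`. -/
def ldualCoactMap : Module.Dual k H →ₗ[k] (H →ₗ[k] H) where
  toFun ξ := (TensorProduct.lid k H).toLinearMap ∘ₗ ξ.rTensor H ∘ₗ
    LinearMap.mulLeft k Q.VR ∘ₗ LinearMap.mulRight k Q.UR ∘ₗ Q.Δ.toLinearMap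
  map_add' ξ η := by
    ext x; simp [LinearMap.rTensor_add]
  map_smul' c ξ := by
    ext x; simp [LinearMap.rTensor_smul]

section FiniteDimensional

variable [FiniteDimensional k H]

/-- The right coaction `ξ ↦ ∑ hⁱ ⊗ Vᴸ₁ hᵢ₍₁₎ Uᴸ₁ ⟨ξ, Vᴸ₂ hᵢ₍₂₎ Uᴸ₂⟩` of `H` on `ᵛH`. -/
def rdualCoact : Module.Dual k H →ₗ[k] Module.Dual k H ⊗[k] H :=
  (dualTensorHomEquiv k H H).symm.toLinearMap ∘ₗ Q.rdualCoactMap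

/-- The left coaction `ξ ↦ ∑ ⟨ξ, Vᴿ₁ hᵢ₍₁₎ Uᴿ₁⟩ Vᴿ₂ hᵢ₍₂₎ Uᴿ₂ ⊗ hⁱ` of `H` on `Hᵛ`. -/
def ldualCoact : Module.Dual k H →ₗ[k] H ⊗[k] Module.Dual k H :=
  (TensorProduct.comm k (Module.Dual k H) H).toLinearMap ∘ₗ
    (dualTensorHomEquiv k H H).symm.toLinearMap ∘ₗ Q.ldualCoactMap

/-! ### Cointegrals and the modular function -/

/-- The map `E` for the right quasi-Hopf bimodule `ᵛH`. -/
def leftCoinv : Module.Dual k H →ₗ[k] Module.Dual k H :=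
  Q.coinvMap Q.rdualActL Q.rdualActR Q.rdualCoact

/-- The map `Eᶜᵒᵖ` for the left quasi-Hopf bimodule `Hᵛ`. -/
def rightCoinv : Module.Dual k H →ₗ[k] Module.Dual k H :=
  Q.coinvMapCop Q.ldualActL Q.ldualActR Q.ldualCoact

/-- The space of left cointegrals on `H`: the coinvariants of `ᵛH`. -/
def leftCointegrals : Submodule k (Module.Dual k H) := LinearMap.range Q.leftCoinv

/-- The space of right cointegrals on `H`: the coinvariants of `Hᵛ`. -/
def rightCointegrals : Submodule k (Module.Dual k H) := LinearMap.range Q.rightCoinv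

/-- `μ` is the modular function: the algebra map through which `H` acts on the space of left
cointegrals by `h ▷ l = E(h · l)`. -/
def IsModularFunction (μ : H →ₐ[k] k) : Prop :=
  ∀ h : H, ∀ l ∈ Q.leftCointegrals, Q.leftCoinv (Q.rdualActL h l) = μ h • l

end FiniteDimensional

/-! ### Yetter-Drinfeld modules and categorical cointegrals -/

/-- Morphisms of Yetter-Drinfeld modules: the linear maps that preserve the action of `H` and the
coaction (of the second kind) of `H`. -/
def ydHom {V W : Type*} [AddCommGroup V] [Module k V] [AddCommGroup W] [Module k W]
    (actV : H →ₗ[k] Module.End k V) (coactV : V →ₗ[k] H ⊗[k] V)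
    (actW : H →ₗ[k] Module.End k W) (coactW : W →ₗ[k] H ⊗[k] W) : Submodule k (V →ₗ[k] W) where
  carrier := {g | (∀ h v, g (actV h v) = actW h (g v)) ∧
    ∀ v, coactW (g v) = g.lTensor H (coactV v)}
  zero_mem' := by simp
  add_mem' := by
    rintro g g' ⟨h1, h2⟩ ⟨h1', h2'⟩
    exact ⟨fun h v => by simp [h1, h1'], fun v => by simp [h2, h2', LinearMap.lTensor_add]⟩
  smul_mem' := by
    rintro c g ⟨h1, h2⟩
    exact ⟨fun h v => by simp [h1], fun v => by simp [h2, LinearMap.lTensor_smul]⟩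

/-- `χ = (φ ⊗ 1) (Δ ⊗ id ⊗ id)(φ⁻¹)` -/
def chi : H ⊗[k] (H ⊗[k] (H ⊗[k] H)) := tensorOne Q.phi * Q.Δ₁ Q.phiInv

/-- `ω = (1 ⊗ 1 ⊗ 1 ⊗ f̄₂ ⊗ f̄₁) (id ⊗ Δ ⊗ S ⊗ S)(χ) (φ ⊗ 1 ⊗ 1)`, an element of `H^{⊗5}`
bracketed as `H^{⊗3} ⊗ H^{⊗2}`. -/
def omega : (H ⊗[k] (H ⊗[k] H)) ⊗[k] (H ⊗[k] H) :=
  TensorProduct.map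
    (LinearMap.mulRight k Q.phi ∘ₗ Q.Δ.toLinearMap.lTensor H)
    (LinearMap.mulLeft k (flip Q.fInv) ∘ₗ TensorProduct.map Q.S Q.S)
    ((TensorProduct.assoc k H H (H ⊗[k] H)).symm Q.chi)

/-- `x ⊗ y ↦ (b ↦ x b y)` for a `k`-algebra `B`. -/
def sandwich (k B : Type*) [Field k] [Ring B] [Algebra k B] : B ⊗[k] B →ₗ[k] Module.End k B :=
  TensorProduct.lift
    ((LinearMap.mul k (Module.End k B)).compl₁₂ (LinearMap.mul k B) (LinearMap.mul k B).flip)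

/-- The action `h ▷ a = h₍₁,₁₎ a S(h₍₂₎) γ(h₍₁,₂₎)` of `H` on `A_γ = H`. -/
def adjAct (γ : H →ₐ[k] k) : H →ₗ[k] Module.End k H :=
  sandwich k H ∘ₗ
    TensorProduct.map
      ((TensorProduct.rid k H).toLinearMap ∘ₗ γ.toLinearMap.lTensor H ∘ₗ Q.Δ.toLinearMap) Q.S ∘ₗ
    Q.Δ.toLinearMap

/-- `(x₁ ⊗ x₂ ⊗ x₃) ⊗ (x₄ ⊗ x₅) ↦ γ(x₃) (x₁ ⊗ x₂) ⊗ (x₅ ⊗ x₄)` -/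
def contractMiddle (γ : H →ₐ[k] k) :
    (H ⊗[k] (H ⊗[k] H)) ⊗[k] (H ⊗[k] H) →ₗ[k] (H ⊗[k] H) ⊗[k] (H ⊗[k] H) :=
  TensorProduct.map
    (((TensorProduct.rid k H).toLinearMap ∘ₗ γ.toLinearMap.lTensor H).lTensor H) flip

/-- The second kind coaction `a ↦ ω₁ a₍₁₎ ω₅ ⊗ ω₂ a₍₂₎ ω₄ γ(ω₃)` of `H` on `A_γ = H`. -/
def adjCoact (γ : H →ₐ[k] k) : H →ₗ[k] H ⊗[k] H :=
  sandwich k (H ⊗[k] H) (contractMiddle γ Q.omega) ∘ₗ Q.Δ.toLinearMap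

/-- The action of `H` on the unit object `𝟙 = k`, through the counit. -/
def unitAct : H →ₗ[k] Module.End k k := LinearMap.mul k k ∘ₗ Q.ε.toLinearMap

/-- The second kind coaction on the unit object `𝟙 = k`, determined by `1 ↦ β ⊗ 1`. -/
def unitCoact : k →ₗ[k] H ⊗[k] k := TensorProduct.mk k H k Q.β

/-- The space `Hom(A_μ, 𝟙)` of morphisms of Yetter-Drinfeld modules. For the modular function `μ`
this is the space of categorical cointegrals. -/
def catCointegrals (μ : H →ₐ[k] k) : Submodule k (H →ₗ[k] k) :=
  ydHom (Q.adjAct μ) (Q.adjCoact μ) Q.unitAct Q.unitCoact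

/-- `a ↦ ⟨l, α S̄(a)⟩` -/
def lamCat (l : Module.Dual k H) : H →ₗ[k] k := l ∘ₗ LinearMap.mulLeft k Q.α ∘ₗ Q.Sinv

end

end QuasiHopfAlgebra

/-!
The usual graphical calculus for quasi-Hopf algebras is replaced by a calculus of words. A linear
map `H → R` into an algebra is regarded as one strand; pairwise commuting representations `f`, `g`,
`h` have a tensor product `conv f g`, and the associator acts through them as an element `ph f g h`
of `R`, with inverse `phb f g h`. The axioms of a quasi-Hopf algebra then become rules for words in
these elements: the pentagon (`pentagon'`), naturality (`ph_nat`), and contraction. Contraction is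
expressed by the relations `LEq` and `REq`, which say that two strands cannot be distinguished at
the left end or at the right end of a word once a linear map `K` is applied to it. Two strands that
meet in `α` at the left end can be replaced by the trivial strand, and so can two strands that start
from `β` at the right end; an associator with a trivial strand is `1`. Applied with `R = End(H ⊗ ⋯ ⊗ H)` and with representations
by left multiplication and by right multiplication through `S`, every identity between elements
built from `φ`, `α`, `β`, `S` that is needed below is a comparison of two words.

*Integrals and the antipode.* An element `s` of `H ⊗ U` with `(1 ⊗ h) s = (S(h) ⊗ 1) s` comes from
left integrals. For `U = H*` and the canonical element this gives a left integral `ℓ` and a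
functional `η` such that `c = qᴸ Δ(ℓ) pᴿ` (`cElt`) satisfies `x = c₁ η(S(c₂) x)` and
`η(c₁) c₂ = 1` (`exists_leftIntegral`), and left integrals are unique up to a scalar. Since
`(1 ⊗ h) c = (S(h) ⊗ 1) c`, the second identity makes `S` injective, hence bijective
(`S_bijective`).

*The gauge transformation.* Both `h ↦ Δ(S(h))` and `h ↦ S(h₍₂₎) ⊗ S(h₍₁₎)` are antipodes along the
algebra map `Δ`, and two such antipodes are conjugate through an explicit unit (`Antipode.gauge`),
which is the element `f`.

*Cointegrals.* The projection onto the left cointegrals and the one onto the right cointegrals are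
both invariant under the right action of `H` on `H*`, so both factor through evaluation at a right
integral `Λ`: a right cointegral is always of the form `ξ(Λ) λ₀` (`exists_rightCointegral`). The
modular function is the character through which `H` acts on `Λ` on the other side, twisted by the
inverse antipode (`existsUnique_modularFunction`), and `ℓ h = μ(h) ℓ` (`leftIntegral_mul`).

*Uniqueness.* An invariant functional `θ` is a categorical cointegral if and only if it satisfies
one identity between words (`mem_catCointegrals_iff`). Such a `θ` determines a functional
`l = preCointegral θ μ` with `l(S(h) α S̄(a)) = θ(h₍₁₎ a) μ(h₍₂₎)`. Projecting `l` to a right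
cointegral and applying `λ ↦ λ(α S̄(·))` gives back `θ` (`lamCat_rightCoinv_preCointegral`). Hence
every categorical cointegral is a multiple of `λ₀(α S̄(·))`.

*Existence.* It remains to find one non-zero categorical cointegral, since this forces
`λ₀(α S̄(·))` to be a non-zero categorical cointegral too. One is obtained from `a ↦ η(S(a) α)` by
a modification with the associator and `μ` (`IntegralPair.cointegral`). Linear maps on `H` are
determined by their values on the second leg of `c`, so the required identity has to be checked only
there. The integral can then be moved through the word (`integral_word`) and removed with
`c₁ η(S(c₂) α) = α` (`contr22_integral`); what is left is again an identity between words
(`lTensor_coactWord`).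
-/

namespace QuasiHopfAlgebra

/-! ### Commuting representations -/

noncomputable section

section Calculus

variable {k H : Type*} [Field k] [Ring H] [Algebra k H] (Q : QuasiHopfAlgebra k H)
  {R : Type*} [Ring R] [Algebra k R] {N : Type*} [AddCommGroup N] [Module k N]

/-- `x ⊗ y ↦ f(x) g(y)` -/
def ev2 (f g : H →ₗ[k] R) : H ⊗[k] H →ₗ[k] R := LinearMap.mul' k R ∘ₗ TensorProduct.map f g

/-- `x ⊗ y ⊗ z ↦ f(x) g(y) h(z)` -/
def ev3 (f g h : H →ₗ[k] R) : H ⊗[k] (H ⊗[k] H) →ₗ[k] R :=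
  LinearMap.mul' k R ∘ₗ TensorProduct.map f (ev2 g h)

/-- `x ⊗ y ⊗ z ⊗ w ↦ f(x) g(y) h(z) l(w)` -/
def ev4 (f g h l : H →ₗ[k] R) : H ⊗[k] (H ⊗[k] (H ⊗[k] H)) →ₗ[k] R :=
  LinearMap.mul' k R ∘ₗ TensorProduct.map f (ev3 g h l)

@[simp] lemma ev2_tmul (f g : H →ₗ[k] R) (x y : H) : ev2 f g (x ⊗ₜ y) = f x * g y := rfl

@[simp] lemma ev3_tmul (f g h : H →ₗ[k] R) (x : H) (t : H ⊗[k] H) :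
    ev3 f g h (x ⊗ₜ t) = f x * ev2 g h t := rfl

@[simp] lemma ev4_tmul (f g h l : H →ₗ[k] R) (x : H) (t : H ⊗[k] (H ⊗[k] H)) :
    ev4 f g h l (x ⊗ₜ t) = f x * ev3 g h l t := rfl

/-- The tensor product representation `x ↦ f(x₍₁₎) g(x₍₂₎)`. -/
def conv (f g : H →ₗ[k] R) : H →ₗ[k] R := ev2 f g ∘ₗ Q.Δ.toLinearMap

lemma conv_apply (f g : H →ₗ[k] R) (x : H) : Q.conv f g x = ev2 f g (Q.Δ x) := rfl

/-- The associator acting through three representations. -/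
def ph (f g h : H →ₗ[k] R) : R := ev3 f g h Q.phi

/-- The inverse associator acting through three representations. -/
def phb (f g h : H →ₗ[k] R) : R := ev3 f g h Q.phiInv

/-- The trivial representation `x ↦ ε(x) 1`. -/
def triv (R : Type*) [Ring R] [Algebra k R] : H →ₗ[k] R :=
  (Algebra.linearMap k R) ∘ₗ Q.ε.toLinearMap

lemma triv_apply (x : H) : Q.triv R x = Q.ε x • (1 : R) := by
  simp [triv, Algebra.algebraMap_eq_smul_one]

/-- A linear map which is a homomorphism of algebras. -/
class IsRep (f : H →ₗ[k] R) : Prop where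
  one : f 1 = 1
  mul : ∀ x y, f (x * y) = f x * f y

/-- The images of two linear maps commute elementwise. -/
class Comm (f g : H →ₗ[k] R) : Prop where
  comm : ∀ x y, Commute (f x) (g y)

variable {Q}

instance (priority := 50) Comm.symm {f g : H →ₗ[k] R} [h : Comm f g] : Comm g f :=
  ⟨fun x y => (h.comm y x).symm⟩

lemma Comm.eq (f g : H →ₗ[k] R) [h : Comm f g] (x y : H) : f x * g y = g y * f x := h.comm x y

lemma commute_ev2 {f g : H →ₗ[k] R} {r : R} (hf : ∀ x, Commute (f x) r)
    (hg : ∀ x, Commute (g x) r) (t : H ⊗[k] H) : Commute (ev2 f g t) r := by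
  induction t with
  | zero => simp
  | tmul x y => exact (hf x).mul_left (hg y)
  | add s t hs ht => rw [map_add]; exact hs.add_left ht

lemma commute_ev3 {f g h : H →ₗ[k] R} {r : R} (hf : ∀ x, Commute (f x) r)
    (hg : ∀ x, Commute (g x) r) (hh : ∀ x, Commute (h x) r) (t : H ⊗[k] (H ⊗[k] H)) :
    Commute (ev3 f g h t) r := by
  induction t with
  | zero => simp
  | tmul x y => exact (hf x).mul_left (commute_ev2 hg hh y)
  | add s t hs ht => rw [map_add]; exact hs.add_left ht

instance Comm.conv_left {f g h : H →ₗ[k] R} [h1 : Comm f h] [h2 : Comm g h] :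
    Comm (Q.conv f g) h :=
  ⟨fun _ y => commute_ev2 (fun x => h1.comm x y) (fun x => h2.comm x y) _⟩

instance Comm.conv_right {f g h : H →ₗ[k] R} [Comm h f] [Comm h g] :
    Comm h (Q.conv f g) := Comm.symm

instance Comm.triv_left {f : H →ₗ[k] R} : Comm (Q.triv R) f := ⟨fun x y => by
  rw [triv_apply]; exact (Commute.one_left _).smul_left _⟩

instance Comm.triv_right {f : H →ₗ[k] R} : Comm f (Q.triv R) := Comm.symm

instance IsRep.triv : IsRep (Q.triv R) :=
  ⟨by simp [triv_apply], fun x y => by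
    simp only [triv_apply, map_mul, mul_smul_comm, mul_one, smul_smul, mul_comm]⟩

lemma ev2_one (f g : H →ₗ[k] R) [IsRep f] [IsRep g] : ev2 f g 1 = 1 := by
  rw [Algebra.TensorProduct.one_def]; simp [IsRep.one]

lemma ev3_one (f g h : H →ₗ[k] R) [IsRep f] [IsRep g] [IsRep h] : ev3 f g h 1 = 1 := by
  rw [Algebra.TensorProduct.one_def]; simp [IsRep.one, ev2_one]

lemma mul'_map_mul {A B : Type*} [Ring A] [Algebra k A] [Ring B] [Algebra k B]
    {f : A →ₗ[k] R} {g : B →ₗ[k] R} (hf : ∀ x y, f (x * y) = f x * f y)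
    (hg : ∀ x y, g (x * y) = g x * g y) (hc : ∀ x y, Commute (f x) (g y)) (s t : A ⊗[k] B) :
    (LinearMap.mul' k R ∘ₗ TensorProduct.map f g) (s * t) =
      (LinearMap.mul' k R ∘ₗ TensorProduct.map f g) s *
        (LinearMap.mul' k R ∘ₗ TensorProduct.map f g) t := by
  induction s with
  | zero => simp
  | add s s' hs hs' => simp only [add_mul, map_add, hs, hs']
  | tmul x y =>
    induction t with
    | zero => simp
    | add s s' hs hs' => simp only [mul_add, map_add, hs, hs']
    | tmul z w =>
      simp only [Algebra.TensorProduct.tmul_mul_tmul, LinearMap.comp_apply,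
        TensorProduct.map_tmul, LinearMap.mul'_apply, hf, hg, mul_assoc]
      rw [← mul_assoc (f z), (hc z y).eq, mul_assoc]

lemma ev2_mul (f g : H →ₗ[k] R) [IsRep f] [IsRep g] [hc : Comm f g]
    (s t : H ⊗[k] H) : ev2 f g (s * t) = ev2 f g s * ev2 f g t :=
  mul'_map_mul IsRep.mul IsRep.mul hc.comm s t

lemma ev3_mul (f g h : H →ₗ[k] R) [IsRep f] [IsRep g] [IsRep h] [hfg : Comm f g]
    [hfh : Comm f h] [Comm g h] (s t : H ⊗[k] (H ⊗[k] H)) :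
    ev3 f g h (s * t) = ev3 f g h s * ev3 f g h t :=
  mul'_map_mul IsRep.mul (ev2_mul g h) (fun x y => (commute_ev2 (fun z => (hfg.comm x z).symm)
    (fun z => (hfh.comm x z).symm) y).symm) s t

lemma ev4_mul (f g h l : H →ₗ[k] R) [IsRep f] [IsRep g] [IsRep h] [IsRep l]
    [hfg : Comm f g] [hfh : Comm f h] [hfl : Comm f l] [Comm g h] [Comm g l]
    [Comm h l] (s t : H ⊗[k] (H ⊗[k] (H ⊗[k] H))) :
    ev4 f g h l (s * t) = ev4 f g h l s * ev4 f g h l t :=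
  mul'_map_mul IsRep.mul (ev3_mul g h l) (fun x y => (commute_ev3
    (fun z => (hfg.comm x z).symm) (fun z => (hfh.comm x z).symm)
    (fun z => (hfl.comm x z).symm) y).symm) s t

instance IsRep.conv {f g : H →ₗ[k] R} [IsRep f] [IsRep g] [Comm f g] :
    IsRep (Q.conv f g) :=
  ⟨by rw [conv_apply, map_one, ev2_one f g], fun x y => by
    rw [conv_apply, map_mul, ev2_mul f g]; rfl⟩

lemma phi_mul_phiInv : Q.phi * Q.phiInv = 1 := Q.φ.mul_inv
lemma phiInv_mul_phi : Q.phiInv * Q.phi = 1 := Q.φ.inv_mul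

section Legs

variable {f g h l : H →ₗ[k] R}

lemma ph_mul_phb (f g h : H →ₗ[k] R) [IsRep f] [IsRep g] [IsRep h] [Comm f g]
    [Comm f h] [Comm g h] : Q.ph f g h * Q.phb f g h = 1 := by
  rw [ph, phb, ← ev3_mul f g h, phi_mul_phiInv, ev3_one f g h]

lemma phb_mul_ph (f g h : H →ₗ[k] R) [IsRep f] [IsRep g] [IsRep h] [Comm f g]
    [Comm f h] [Comm g h] : Q.phb f g h * Q.ph f g h = 1 := by
  rw [ph, phb, ← ev3_mul f g h, phiInv_mul_phi, ev3_one f g h]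

lemma ev2_map (t : H ⊗[k] H) : ev3 f g h (Algebra.TensorProduct.map (AlgHom.id k H) Q.Δ t) =
    ev2 f (Q.conv g h) t := by
  induction t with
  | zero => simp
  | add s s' hs hs' => simp only [map_add, hs, hs']
  | tmul x y => simp [conv_apply]

lemma ev3_assoc_tmul (d : H ⊗[k] H) (y : H) :
    ev3 f g h (Algebra.TensorProduct.assoc k k k H H H (d ⊗ₜ y)) = ev2 f g d * h y := by
  induction d with
  | zero => simp
  | add s s' hs hs' => simp only [TensorProduct.add_tmul, map_add, hs, hs', add_mul]
  | tmul x z => simp [mul_assoc]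

lemma ev2_assoc_map (t : H ⊗[k] H) :
    ev3 f g h (Algebra.TensorProduct.assoc k k k H H H
      (Algebra.TensorProduct.map Q.Δ (AlgHom.id k H) t)) = ev2 (Q.conv f g) h t := by
  induction t with
  | zero => simp
  | add s s' hs hs' => simp only [map_add, hs, hs']
  | tmul x y =>
    rw [Algebra.TensorProduct.map_tmul, ev3_assoc_tmul]; simp [conv_apply]

/-- Quasi-coassociativity: the associator intertwines the two bracketings. -/
lemma conv_assoc (f g h : H →ₗ[k] R) [IsRep f] [IsRep g] [IsRep h] [Comm f g]
    [Comm f h] [Comm g h] (x : H) :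
    Q.conv f (Q.conv g h) x * Q.ph f g h = Q.ph f g h * Q.conv (Q.conv f g) h x := by
  have := congrArg (ev3 f g h) (Q.coassoc x)
  rw [ev2_map, ev3_mul f g h, ev3_mul f g h, ev2_assoc_map] at this
  rw [conv_apply, this, mul_assoc]
  change _ * (Q.phb f g h * Q.ph f g h) = _
  rw [phb_mul_ph f g h, mul_one]; rfl

lemma conv_assoc' (f g h : H →ₗ[k] R) [IsRep f] [IsRep g] [IsRep h] [Comm f g]
    [Comm f h] [Comm g h] (x : H) :
    Q.phb f g h * Q.conv f (Q.conv g h) x = Q.conv (Q.conv f g) h x * Q.phb f g h := by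
  have := conv_assoc (Q := Q) f g h x
  calc _ = Q.phb f g h * (Q.conv f (Q.conv g h) x * Q.ph f g h) * Q.phb f g h := by
        simp only [mul_assoc]; rw [ph_mul_phb f g h, mul_one]
    _ = _ := by
        rw [this]; simp only [← mul_assoc]; rw [phb_mul_ph f g h, one_mul]

lemma ev4_Δ₃ (t : H ⊗[k] (H ⊗[k] H)) : ev4 f g h l (Q.Δ₃ t) = ev3 f g (Q.conv h l) t := by
  induction t with
  | zero => simp
  | add s s' hs hs' => simp only [map_add, hs, hs']
  | tmul x y =>
    simp only [Δ₃, Algebra.TensorProduct.map_tmul, ev4_tmul, ev3_tmul, AlgHom.id_apply, ev2_map]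

lemma ev4_assoc_tmul (d e : H ⊗[k] H) :
    ev4 f g h l (Algebra.TensorProduct.assoc k k k H H (H ⊗[k] H) (d ⊗ₜ e)) =
      ev2 f g d * ev2 h l e := by
  induction d with
  | zero => simp
  | add s s' hs hs' => simp only [TensorProduct.add_tmul, map_add, hs, hs', add_mul]
  | tmul x z => simp [mul_assoc]

lemma ev4_Δ₁ (t : H ⊗[k] (H ⊗[k] H)) : ev4 f g h l (Q.Δ₁ t) = ev3 (Q.conv f g) h l t := by
  induction t with
  | zero => simp
  | add s s' hs hs' => simp only [map_add, hs, hs']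
  | tmul x y =>
    change ev4 f g h l (Algebra.TensorProduct.assoc k k k H H (H ⊗[k] H)
      (Algebra.TensorProduct.map Q.Δ (AlgHom.id k (H ⊗[k] H)) (x ⊗ₜ y))) = _
    rw [Algebra.TensorProduct.map_tmul, ev4_assoc_tmul]; simp [conv_apply]

lemma ev4_Δ₂ (t : H ⊗[k] (H ⊗[k] H)) : ev4 f g h l (Algebra.TensorProduct.map (AlgHom.id k H)
        ((Algebra.TensorProduct.assoc k k k H H H).toAlgHom.comp
          (Algebra.TensorProduct.map Q.Δ (AlgHom.id k H))) t) = ev3 f (Q.conv g h) l t := by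
  induction t with
  | zero => simp
  | add s s' hs hs' => simp only [map_add, hs, hs']
  | tmul x y =>
    rw [Algebra.TensorProduct.map_tmul, ev4_tmul, ev3_tmul]
    exact congrArg _ (ev2_assoc_map y)

lemma ev4_one_tmul [IsRep f] (t : H ⊗[k] (H ⊗[k] H)) :
    ev4 f g h l ((1 : H) ⊗ₜ t) = ev3 g h l t := by simp [IsRep.one]

lemma ev4_tensorOne [IsRep l] (t : H ⊗[k] (H ⊗[k] H)) :
    ev4 f g h l (tensorOne t) = ev3 f g h t := by
  induction t with
  | zero => simp
  | add s s' hs hs' => simp only [map_add, hs, hs']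
  | tmul x y =>
    induction y with
    | zero => simp
    | add s s' hs hs' => simp only [map_add, TensorProduct.tmul_add, hs, hs']
    | tmul y z => simp [tensorOne, IsRep.one]

lemma pentagon' (f g h l : H →ₗ[k] R) [IsRep f] [IsRep g] [IsRep h] [IsRep l]
    [Comm f g] [Comm f h] [Comm f l] [Comm g h] [Comm g l] [Comm h l] :
    Q.ph f g (Q.conv h l) * Q.ph (Q.conv f g) h l =
      Q.ph g h l * Q.ph f (Q.conv g h) l * Q.ph f g h := by
  have hm := ev4_mul f g h l
  have := congrArg (ev4 f g h l) Q.pentagon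
  rw [hm, hm, hm, ev4_one_tmul, ev4_Δ₂] at this
  have h1 := ev4_Δ₃ (Q := Q) (f := f) (g := g) (h := h) (l := l) Q.phi
  have h2 := ev4_Δ₁ (Q := Q) (f := f) (g := g) (h := h) (l := l) Q.phi
  have h3 := ev4_tensorOne (f := f) (g := g) (h := h) (l := l) Q.phi
  exact (congrArg₂ (· * ·) h1 h2).symm.trans (this.trans (congrArg _ h3))

lemma conv_triv_left (g : H →ₗ[k] R) : Q.conv (Q.triv R) g = g := by
  ext x
  have : ∀ t : H ⊗[k] H, ev2 (Q.triv R) g t =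
      g (TensorProduct.lid k H (Q.ε.toLinearMap.rTensor H t)) := fun t => by
    induction t with
    | zero => simp
    | add s s' hs hs' => simp only [map_add, hs, hs']
    | tmul x y => simp [triv_apply]
  rw [conv_apply, this, Q.counit_left]

lemma conv_triv_right (g : H →ₗ[k] R) : Q.conv g (Q.triv R) = g := by
  ext x
  have : ∀ t : H ⊗[k] H, ev2 g (Q.triv R) t =
      g (TensorProduct.rid k H (Q.ε.toLinearMap.lTensor H t)) := fun t => by
    induction t with
    | zero => simp
    | add s s' hs hs' => simp only [map_add, hs, hs']
    | tmul x y => simp [triv_apply]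
  rw [conv_apply, this, Q.counit_right]

lemma ph_triv_mid (f h : H →ₗ[k] R) [IsRep f] [IsRep h] : Q.ph f (Q.triv R) h = 1 := by
  have h2 : ∀ t : H ⊗[k] H, ev2 (Q.triv R) h t = h (((TensorProduct.lid k H).toLinearMap ∘ₗ
      Q.ε.toLinearMap.rTensor H) t) := fun t => by
    induction t with
    | zero => simp
    | add s s' hs hs' => simp only [map_add, hs, hs']
    | tmul x y => simp [triv_apply]
  have : ∀ t : H ⊗[k] (H ⊗[k] H), ev3 f (Q.triv R) h t =
      ev2 f h (((TensorProduct.lid k H).toLinearMap ∘ₗ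
      Q.ε.toLinearMap.rTensor H).lTensor H t) := fun t => by
    induction t with
    | zero => simp
    | add s s' hs hs' => simp only [map_add, hs, hs']
    | tmul x y => simp [h2]
  rw [ph, this]
  have h3 := Q.counit_φ
  change _ = 1 at h3
  rw [phi, h3, ev2_one f h]

lemma ph_triv_left (g h : H →ₗ[k] R) [IsRep g] [IsRep h] [Comm g h] :
    Q.ph (Q.triv R) g h = 1 := by
  have := pentagon' (Q := Q) (Q.triv R) (Q.triv R) g h
  rw [conv_triv_left, conv_triv_left, ph_triv_mid _ g, ph_triv_mid _ (Q.conv g h),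
    mul_one, one_mul] at this
  have h2 := ph_mul_phb (Q := Q) (Q.triv R) g h
  calc _ = Q.ph (Q.triv R) g h * (Q.ph (Q.triv R) g h * Q.phb (Q.triv R) g h) := by
        rw [h2, mul_one]
    _ = 1 := by rw [← mul_assoc, ← this, h2]

lemma ph_triv_right (f g : H →ₗ[k] R) [IsRep f] [IsRep g] [Comm f g] :
    Q.ph f g (Q.triv R) = 1 := by
  have := pentagon' (Q := Q) f g (Q.triv R) (Q.triv R)
  rw [conv_triv_left, conv_triv_right, ph_triv_mid (Q.conv f g) _, ph_triv_mid g _,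
    mul_one, one_mul] at this
  have h2 := ph_mul_phb (Q := Q) f g (Q.triv R)
  calc _ = Q.ph f g (Q.triv R) * (Q.ph f g (Q.triv R) * Q.phb f g (Q.triv R)) := by
        rw [h2, mul_one]
    _ = 1 := by rw [← mul_assoc, ← this, h2]

lemma phb_eq_one {f g h : H →ₗ[k] R} [IsRep f] [IsRep g] [IsRep h] [Comm f g]
    [Comm f h] [Comm g h] (h1 : Q.ph f g h = 1) : Q.phb f g h = 1 := by
  have := ph_mul_phb (Q := Q) f g h
  rwa [h1, one_mul] at this

lemma phb_triv_left (g h : H →ₗ[k] R) [IsRep g] [IsRep h] [Comm g h] :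
    Q.phb (Q.triv R) g h = 1 := phb_eq_one (ph_triv_left g h)

lemma phb_triv_mid (f h : H →ₗ[k] R) [IsRep f] [IsRep h] [Comm f h] :
    Q.phb f (Q.triv R) h = 1 := phb_eq_one (ph_triv_mid f h)

lemma phb_triv_right (f g : H →ₗ[k] R) [IsRep f] [IsRep g] [Comm f g] :
    Q.phb f g (Q.triv R) = 1 := phb_eq_one (ph_triv_right f g)

end Legs

end Calculus
end
end QuasiHopfAlgebra

namespace QuasiHopfAlgebra

noncomputable section

section Words

variable {k H : Type*} [Field k] [Ring H] [Algebra k H] {Q : QuasiHopfAlgebra k H}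
  {R : Type*} [Ring R] [Algebra k R] {N : Type*} [AddCommGroup N] [Module k N]

section Pentagon

variable (f g h l : H →ₗ[k] R) [IsRep f] [IsRep g] [IsRep h] [IsRep l]
    [Comm f g] [Comm f h] [Comm f l] [Comm g h] [Comm g l] [Comm h l]

variable (Q) in
/-- The associator acting through three commuting representations, as a unit. -/
def phUnit : Rˣ := ⟨Q.ph f g h, Q.phb f g h, ph_mul_phb f g h, phb_mul_ph f g h⟩

lemma pentagon_unit :
    Q.phUnit f g (Q.conv h l) * Q.phUnit (Q.conv f g) h l =
      Q.phUnit g h l * Q.phUnit f (Q.conv g h) l * Q.phUnit f g h :=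
  Units.ext (pentagon' f g h l)

lemma pentagon₁ : Q.ph f g h * Q.phb (Q.conv f g) h l =
    Q.phb f (Q.conv g h) l * Q.phb g h l * Q.ph f g (Q.conv h l) := by
  have := pentagon_unit (Q := Q) f g h l
  have h2 : Q.phUnit f g h * (Q.phUnit (Q.conv f g) h l)⁻¹ =
      (Q.phUnit f (Q.conv g h) l)⁻¹ * (Q.phUnit g h l)⁻¹ * Q.phUnit f g (Q.conv h l) := by
    rw [mul_inv_eq_iff_eq_mul, mul_assoc, this]; group
  exact congrArg Units.val h2

lemma pentagon₂ : Q.phb g h l * Q.ph f g (Q.conv h l) =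
    Q.ph f (Q.conv g h) l * Q.ph f g h * Q.phb (Q.conv f g) h l := by
  have := pentagon_unit (Q := Q) f g h l
  have h2 : (Q.phUnit g h l)⁻¹ * Q.phUnit f g (Q.conv h l) =
      Q.phUnit f (Q.conv g h) l * Q.phUnit f g h * (Q.phUnit (Q.conv f g) h l)⁻¹ := by
    rw [eq_mul_inv_iff_mul_eq, mul_assoc, this]; group
  exact congrArg Units.val h2

lemma pentagon₃ : Q.phb f g h * Q.phb f (Q.conv g h) l * Q.phb g h l =
    Q.phb (Q.conv f g) h l * Q.phb f g (Q.conv h l) := by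
  have := congrArg (·⁻¹) (pentagon_unit (Q := Q) f g h l)
  simp only [mul_inv_rev] at this
  rw [← mul_assoc] at this
  exact (congrArg Units.val this).symm

lemma pentagon₄ : Q.phb f g (Q.conv h l) * Q.ph g h l =
    Q.ph (Q.conv f g) h l * Q.phb f g h * Q.phb f (Q.conv g h) l := by
  have := pentagon_unit (Q := Q) f g h l
  have h2 : (Q.phUnit f g (Q.conv h l))⁻¹ * Q.phUnit g h l =
      Q.phUnit (Q.conv f g) h l * (Q.phUnit f g h)⁻¹ * (Q.phUnit f (Q.conv g h) l)⁻¹ := by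
    rw [inv_mul_eq_iff_eq_mul, ← mul_assoc, ← mul_assoc, this]; group
  exact congrArg Units.val h2

lemma pentagon₅ : Q.ph (Q.conv f g) h l * Q.phb f g h =
    Q.phb f g (Q.conv h l) * Q.ph g h l * Q.ph f (Q.conv g h) l := by
  have := pentagon_unit (Q := Q) f g h l
  have h2 : Q.phUnit (Q.conv f g) h l * (Q.phUnit f g h)⁻¹ =
      (Q.phUnit f g (Q.conv h l))⁻¹ * Q.phUnit g h l * Q.phUnit f (Q.conv g h) l := by
    rw [mul_inv_eq_iff_eq_mul, mul_assoc, mul_assoc, ← mul_assoc (Q.phUnit g h l), ← this]; group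
  exact congrArg Units.val h2

end Pentagon

/-- The element `r` commutes with the image of `f`. -/
class Cent (f : H →ₗ[k] R) (r : R) : Prop where
  comm : ∀ x, Commute (f x) r

/-- The element `r` intertwines `f` with `f'`. -/
class Inter (r : R) (f f' : H →ₗ[k] R) : Prop where
  eq : ∀ x, r * f x = f' x * r

section

variable {f g h a b c f' g' h' : H →ₗ[k] R} {r s : R}

instance Cent.ph [ha : Comm f a] [hb : Comm f b] [hc : Comm f c] : Cent f (Q.ph a b c) :=
  ⟨fun x => (commute_ev3 (fun y => (ha.comm x y).symm) (fun y => (hb.comm x y).symm)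
    (fun y => (hc.comm x y).symm) _).symm⟩

instance Cent.phb [ha : Comm f a] [hb : Comm f b] [hc : Comm f c] : Cent f (Q.phb a b c) :=
  ⟨fun x => (commute_ev3 (fun y => (ha.comm x y).symm) (fun y => (hb.comm x y).symm)
    (fun y => (hc.comm x y).symm) _).symm⟩

instance Cent.mul [h1 : Cent f r] [h2 : Cent f s] : Cent f (r * s) :=
  ⟨fun x => (h1.comm x).mul_right (h2.comm x)⟩

instance Cent.one : Cent f (1 : R) := ⟨fun _ => Commute.one_right _⟩

instance Cent.apply [ha : Comm f a] (x : H) : Cent f (a x) := ⟨fun y => ha.comm y x⟩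

instance Cent.conv [h1 : Cent f r] [h2 : Cent g r] : Cent (Q.conv f g) r :=
  ⟨fun _ => commute_ev2 h1.comm h2.comm _⟩

instance Cent.triv : Cent (Q.triv R) r :=
  ⟨fun x => by rw [triv_apply]; exact (Commute.one_left _).smul_left _⟩

instance (priority := 900) Inter.cent [h1 : Cent f r] : Inter r f f :=
  ⟨fun x => (h1.comm x).symm.eq⟩

lemma Inter.ev2 [h1 : Inter r f f'] [h2 : Inter r g g'] (t : H ⊗[k] H) :
    r * ev2 f g t = QuasiHopfAlgebra.ev2 f' g' t * r := by
  induction t with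
  | zero => simp
  | add s s' hs hs' => simp only [map_add, mul_add, add_mul, hs, hs']
  | tmul x y => simp only [ev2_tmul]; rw [← mul_assoc, h1.eq, mul_assoc, h2.eq, mul_assoc]

lemma Inter.ev3 [h1 : Inter r f f'] [h2 : Inter r g g'] [h3 : Inter r h h']
    (t : H ⊗[k] (H ⊗[k] H)) :
    r * ev3 f g h t = QuasiHopfAlgebra.ev3 f' g' h' t * r := by
  induction t with
  | zero => simp
  | add s s' hs hs' => simp only [map_add, mul_add, add_mul, hs, hs']
  | tmul x y =>
    simp only [ev3_tmul]
    rw [← mul_assoc, h1.eq, mul_assoc, Inter.ev2 (f' := g') (g' := h'), mul_assoc]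

instance (priority := 800) Inter.conv [Inter r f f'] [Inter r g g'] :
    Inter r (Q.conv f g) (Q.conv f' g') :=
  ⟨fun _ => Inter.ev2 _⟩

instance Inter.ph [IsRep a] [IsRep b] [IsRep c] [Comm a b] [Comm a c] [Comm b c] :
    Inter (Q.ph a b c) (Q.conv (Q.conv a b) c) (Q.conv a (Q.conv b c)) :=
  ⟨fun x => (conv_assoc a b c x).symm⟩

instance Inter.phb [IsRep a] [IsRep b] [IsRep c] [Comm a b] [Comm a c] [Comm b c] :
    Inter (Q.phb a b c) (Q.conv a (Q.conv b c)) (Q.conv (Q.conv a b) c) :=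
  ⟨fun x => conv_assoc' a b c x⟩

/-- Naturality of the associator. -/
lemma ph_nat (r : R) [Inter r f f'] [Inter r g g'] [Inter r h h'] :
    r * Q.ph f g h = Q.ph f' g' h' * r := Inter.ev3 _

lemma phb_nat (r : R) [Inter r f f'] [Inter r g g'] [Inter r h h'] :
    r * Q.phb f g h = Q.phb f' g' h' * r := Inter.ev3 _

end

/-! ### Contraction -/

/-- The representations `f` and `f'` agree on the left of the argument of `K`. -/
def LEq (K : R →ₗ[k] N) (f f' : H →ₗ[k] R) : Prop := ∀ x X, K (f x * X) = K (f' x * X)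

/-- The representations `f` and `f'` agree on the right of the argument of `K`. -/
def REq (K : R →ₗ[k] N) (f f' : H →ₗ[k] R) : Prop := ∀ x X, K (X * f x) = K (X * f' x)

section

variable {K : R →ₗ[k] N} {f g h f' g' h' : H →ₗ[k] R} {Z : R}

lemma LEq.refl (K : R →ₗ[k] N) (f : H →ₗ[k] R) : LEq K f f := fun _ _ => rfl

lemma REq.refl (K : R →ₗ[k] N) (f : H →ₗ[k] R) : REq K f f := fun _ _ => rfl

lemma LEq.trans (h1 : LEq K f g) (h2 : LEq K g h) : LEq K f h :=
  fun x X => (h1 x X).trans (h2 x X)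

lemma REq.trans (h1 : REq K f g) (h2 : REq K g h) : REq K f h :=
  fun x X => (h1 x X).trans (h2 x X)

lemma LEq.ev2 (h1 : LEq K f f') (h2 : LEq K g g') [Comm f' g] [Comm f' g'] (t : H ⊗[k] H) (X : R) :
    K (ev2 f g t * X) = K (QuasiHopfAlgebra.ev2 f' g' t * X) := by
  induction t with
  | zero => simp
  | add s s' hs hs' => simp only [map_add, add_mul, hs, hs']
  | tmul x y =>
    simp only [ev2_tmul]
    rw [mul_assoc, h1, ← mul_assoc, Comm.eq f' g, mul_assoc, h2, ← mul_assoc, ← Comm.eq f' g']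

lemma LEq.ev3 (h1 : LEq K f f') (h2 : LEq K g g') (h3 : LEq K h h') [Comm f' g] [Comm f' g']
    [Comm f' h] [Comm f' h'] [Comm g' h] [Comm g' h'] (t : H ⊗[k] (H ⊗[k] H)) (X : R) :
    K (ev3 f g h t * X) = K (QuasiHopfAlgebra.ev3 f' g' h' t * X) := by
  induction t with
  | zero => simp
  | add s s' hs hs' => simp only [map_add, add_mul, hs, hs']
  | tmul x t =>
    have hc : ∀ (g h : H →ₗ[k] R) [Comm f' g] [Comm f' h] t, Commute (f' x)
      (QuasiHopfAlgebra.ev2 g h t) := fun g h i1 i2 t =>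
        (commute_ev2 (fun y => (i1.comm x y).symm) (fun y => (i2.comm x y).symm) t).symm
    simp only [ev3_tmul]
    rw [mul_assoc, h1, ← mul_assoc, hc g h, mul_assoc, LEq.ev2 h2 h3, ← mul_assoc, ← hc g' h']

lemma LEq.comp (h1 : LEq K f f') (Z : R) [hf : Cent f Z] [hf' : Cent f' Z] :
    LEq (K ∘ₗ LinearMap.mulLeft k Z) f f' := fun x X => by
  simp only [LinearMap.comp_apply, LinearMap.mulLeft_apply]
  rw [← mul_assoc, ← (hf.comm x).eq, mul_assoc, h1, ← mul_assoc, (hf'.comm x).eq, mul_assoc]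

lemma LEq.conv (h1 : LEq K f f') (h2 : LEq K g g') [Comm f' g] [Comm f' g'] :
    LEq K (Q.conv f g) (Q.conv f' g') := fun _ X => h1.ev2 h2 _ X

lemma LEq.ph (h1 : LEq K f f') (h2 : LEq K g g') (h3 : LEq K h h') [Comm f' g] [Comm f' g']
    [Comm f' h] [Comm f' h'] [Comm g' h] [Comm g' h'] (X : R) :
    K (Q.ph f g h * X) = K (Q.ph f' g' h' * X) := h1.ev3 h2 h3 _ X

lemma LEq.phb (h1 : LEq K f f') (h2 : LEq K g g') (h3 : LEq K h h') [Comm f' g] [Comm f' g']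
    [Comm f' h] [Comm f' h'] [Comm g' h] [Comm g' h'] (X : R) :
    K (Q.phb f g h * X) = K (Q.phb f' g' h' * X) := h1.ev3 h2 h3 _ X

lemma LEq.conv_triv_left (h1 : LEq K f (Q.triv R)) (g : H →ₗ[k] R) : LEq K (Q.conv f g) g := by
  have := LEq.conv (Q := Q) h1 (LEq.refl K g)
  rwa [QuasiHopfAlgebra.conv_triv_left] at this

lemma LEq.conv_triv_right (h1 : LEq K g (Q.triv R)) (f : H →ₗ[k] R) [Comm f g] :
    LEq K (Q.conv f g) f := by
  have := LEq.conv (Q := Q) (LEq.refl K f) h1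
  rwa [QuasiHopfAlgebra.conv_triv_right] at this

lemma LEq.ph_left (h1 : LEq K f (Q.triv R)) (Z X : R) [Cent f Z] [IsRep g] [IsRep h] [Comm g h] :
    K (Z * Q.ph f g h * X) = K (Z * X) := by
  have := (h1.comp Z).ph (Q := Q) (LEq.refl _ g) (LEq.refl _ h) X
  rw [ph_triv_left] at this
  simpa [mul_assoc] using this

lemma LEq.ph_mid (h1 : LEq K g (Q.triv R)) (Z X : R) [Cent g Z] [IsRep f] [IsRep h] [Comm f g]
    [Comm f h] : K (Z * Q.ph f g h * X) = K (Z * X) := by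
  have := (LEq.refl _ f).ph (Q := Q) (h1.comp Z) (LEq.refl _ h) X
  rw [ph_triv_mid] at this
  simpa [mul_assoc] using this

lemma LEq.ph_right (h1 : LEq K h (Q.triv R)) (Z X : R) [Cent h Z] [IsRep f] [IsRep g] [Comm f h]
    [Comm g h] [Comm f g] : K (Z * Q.ph f g h * X) = K (Z * X) := by
  have := (LEq.refl _ f).ph (Q := Q) (LEq.refl _ g) (h1.comp Z) X
  rw [ph_triv_right] at this
  simpa [mul_assoc] using this

lemma LEq.phb_left (h1 : LEq K f (Q.triv R)) (Z X : R) [Cent f Z] [IsRep g] [IsRep h] [Comm g h] :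
    K (Z * Q.phb f g h * X) = K (Z * X) := by
  have := (h1.comp Z).phb (Q := Q) (LEq.refl _ g) (LEq.refl _ h) X
  rw [phb_triv_left] at this
  simpa [mul_assoc] using this

lemma LEq.phb_mid (h1 : LEq K g (Q.triv R)) (Z X : R) [Cent g Z] [IsRep f] [IsRep h] [Comm f g]
    [Comm f h] : K (Z * Q.phb f g h * X) = K (Z * X) := by
  have := (LEq.refl _ f).phb (Q := Q) (h1.comp Z) (LEq.refl _ h) X
  rw [phb_triv_mid] at this
  simpa [mul_assoc] using this

lemma LEq.phb_right (h1 : LEq K h (Q.triv R)) (Z X : R) [Cent h Z] [IsRep f] [IsRep g] [Comm f h]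
    [Comm g h] [Comm f g] : K (Z * Q.phb f g h * X) = K (Z * X) := by
  have := (LEq.refl _ f).phb (Q := Q) (LEq.refl _ g) (h1.comp Z) X
  rw [phb_triv_right] at this
  simpa [mul_assoc] using this

lemma REq.ev2 (h1 : REq K f f') (h2 : REq K g g') [Comm f g'] [Comm f' g'] (t : H ⊗[k] H) (X : R) :
    K (X * ev2 f g t) = K (X * QuasiHopfAlgebra.ev2 f' g' t) := by
  induction t with
  | zero => simp
  | add s s' hs hs' => simp only [map_add, mul_add, hs, hs']
  | tmul x y =>
    simp only [ev2_tmul]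
    rw [← mul_assoc, h2, mul_assoc, Comm.eq f g', ← mul_assoc, h1, mul_assoc, ← Comm.eq f' g']

lemma REq.ev3 (h1 : REq K f f') (h2 : REq K g g') (h3 : REq K h h') [Comm f g'] [Comm f h']
    [Comm f' g'] [Comm f' h'] [Comm g h'] [Comm g' h'] (t : H ⊗[k] (H ⊗[k] H)) (X : R) :
    K (X * ev3 f g h t) = K (X * QuasiHopfAlgebra.ev3 f' g' h' t) := by
  induction t with
  | zero => simp
  | add s s' hs hs' => simp only [map_add, mul_add, hs, hs']
  | tmul x t =>
    have hc : ∀ (f g h : H →ₗ[k] R) [Comm f g] [Comm f h] t, Commute (f x)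
      (QuasiHopfAlgebra.ev2 g h t) := fun f g h i1 i2 t =>
        (commute_ev2 (fun y => (i1.comm x y).symm) (fun y => (i2.comm x y).symm) t).symm
    simp only [ev3_tmul]
    rw [← mul_assoc, REq.ev2 h2 h3, mul_assoc, hc f g' h', ← mul_assoc, h1, mul_assoc,
      ← hc f' g' h']

lemma REq.comp (h1 : REq K f f') (Z : R) [hf : Cent f Z] [hf' : Cent f' Z] :
    REq (K ∘ₗ LinearMap.mulRight k Z) f f' := fun x X => by
  simp only [LinearMap.comp_apply, LinearMap.mulRight_apply]
  rw [mul_assoc, (hf.comm x).eq, ← mul_assoc, h1, mul_assoc, ← (hf'.comm x).eq, ← mul_assoc]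

lemma REq.conv (h1 : REq K f f') (h2 : REq K g g') [Comm f g'] [Comm f' g'] :
    REq K (Q.conv f g) (Q.conv f' g') := fun _ X => h1.ev2 h2 _ X

lemma REq.ph (h1 : REq K f f') (h2 : REq K g g') (h3 : REq K h h') [Comm f g'] [Comm f h']
    [Comm f' g'] [Comm f' h'] [Comm g h'] [Comm g' h'] (X : R) :
    K (X * Q.ph f g h) = K (X * Q.ph f' g' h') := h1.ev3 h2 h3 _ X

lemma REq.phb (h1 : REq K f f') (h2 : REq K g g') (h3 : REq K h h') [Comm f g'] [Comm f h']
    [Comm f' g'] [Comm f' h'] [Comm g h'] [Comm g' h'] (X : R) :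
    K (X * Q.phb f g h) = K (X * Q.phb f' g' h') := h1.ev3 h2 h3 _ X

lemma REq.conv_triv_right (h1 : REq K g (Q.triv R)) (f : H →ₗ[k] R) :
    REq K (Q.conv f g) f := by
  have := REq.conv (Q := Q) (REq.refl K f) h1
  rwa [QuasiHopfAlgebra.conv_triv_right] at this

lemma REq.ph_mid (h1 : REq K g (Q.triv R)) (X Z : R) [Cent g Z] [IsRep f] [IsRep h] [Comm g h]
    [Comm f h] : K (X * Q.ph f g h * Z) = K (X * Z) := by
  have := (REq.refl _ f).ph (Q := Q) (h1.comp Z) (REq.refl _ h) X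
  rw [ph_triv_mid] at this
  simpa using this

lemma REq.ph_right (h1 : REq K h (Q.triv R)) (X Z : R) [Cent h Z] [IsRep f] [IsRep g]
    [Comm f g] : K (X * Q.ph f g h * Z) = K (X * Z) := by
  have := (REq.refl _ f).ph (Q := Q) (REq.refl _ g) (h1.comp Z) X
  rw [ph_triv_right] at this
  simpa using this

lemma REq.phb_left (h1 : REq K f (Q.triv R)) (X Z : R) [Cent f Z] [IsRep g] [IsRep h] [Comm g h]
    [Comm f g] [Comm f h] : K (X * Q.phb f g h * Z) = K (X * Z) := by
  have := (h1.comp Z).phb (Q := Q) (REq.refl _ g) (REq.refl _ h) X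
  rw [phb_triv_left] at this
  simpa using this

lemma REq.phb_mid (h1 : REq K g (Q.triv R)) (X Z : R) [Cent g Z] [IsRep f] [IsRep h] [Comm g h]
    [Comm f h] : K (X * Q.phb f g h * Z) = K (X * Z) := by
  have := (REq.refl _ f).phb (Q := Q) (h1.comp Z) (REq.refl _ h) X
  rw [phb_triv_mid] at this
  simpa using this

lemma REq.phb_right (h1 : REq K h (Q.triv R)) (X Z : R) [Cent h Z] [IsRep f] [IsRep g]
    [Comm f g] : K (X * Q.phb f g h * Z) = K (X * Z) := by
  have := (REq.refl _ f).phb (Q := Q) (REq.refl _ g) (h1.comp Z) X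
  rw [phb_triv_right] at this
  simpa using this

end

/-! ### Zigzag identities -/

section Zigzag

variable {K : R →ₗ[k] N} (p d r s : H →ₗ[k] R) [IsRep p] [IsRep d] [IsRep r] [IsRep s]
  [Comm p d] [Comm p r] [Comm p s] [Comm d r] [Comm d s] [Comm r s]

/-- Cancelling a zigzag `p d r` inside `p (d (r s))`. -/
lemma zigzag_word (hpd : REq K (Q.conv p d) (Q.triv R)) (hdr : LEq K (Q.conv d r) (Q.triv R))
    (X : R) [Cent (Q.conv d r) X] :
    K (X * (Q.phb d r s * Q.ph p d (Q.conv r s))) = K (X * Q.ph p d r) := by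
  calc _ = K (X * Q.ph p (Q.conv d r) s * Q.ph p d r * Q.phb (Q.conv p d) r s * 1) := by
        rw [pentagon₂]; simp only [mul_assoc, mul_one]
    _ = K (X * Q.ph p (Q.conv d r) s * Q.ph p d r * 1) := hpd.phb_left _ _
    _ = K (X * Q.ph p d r) := by
        rw [mul_one, hdr.ph_mid]

/-- Cancelling the zigzag `d r s` inside `(p d) (r s)`. -/
lemma zigzag_word' (hcd : REq K (Q.conv r s) (Q.triv R)) (hbc : LEq K (Q.conv d r) (Q.triv R)) :
    K (Q.ph p d r * Q.phb (Q.conv p d) r s) = K (Q.phb d r s) := by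
  calc _ = K (1 * Q.phb p (Q.conv d r) s * (Q.phb d r s * Q.ph p d (Q.conv r s))) := by
        rw [pentagon₁]; simp only [mul_assoc, one_mul]
    _ = K (Q.phb d r s * Q.ph p d (Q.conv r s) * 1) := by
        rw [hbc.phb_mid, one_mul, mul_one]
    _ = K (Q.phb d r s) := by rw [hcd.ph_right, mul_one]

end Zigzag

end Words
end
end QuasiHopfAlgebra

namespace QuasiHopfAlgebra

noncomputable section

section Slots

variable {k H : Type*} [Field k] [Ring H] [Algebra k H] {Q : QuasiHopfAlgebra k H}
  {M N : Type*} [AddCommGroup M] [Module k M] [AddCommGroup N] [Module k N]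

/-! ### Representations on tensor products of copies of `H` -/

/-- Linear maps from `H` to an algebra, the setting for representations. -/
abbrev Rep (k H R : Type*) [Field k] [Ring H] [Algebra k H] [Ring R] [Algebra k R] :=
  H →ₗ[k] R

/-- A representation on `M`, acting on the first factor of `M ⊗ N`. -/
def lft (N : Type*) [AddCommGroup N] [Module k N] (f : Rep k H (Module.End k M)) :
    Rep k H (Module.End k (M ⊗[k] N)) := LinearMap.rTensorHom N ∘ₗ f

/-- A representation on `N`, acting on the second factor of `M ⊗ N`. -/
def rgt (M : Type*) [AddCommGroup M] [Module k M] (f : Rep k H (Module.End k N)) :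
    Rep k H (Module.End k (M ⊗[k] N)) := LinearMap.lTensorHom M ∘ₗ f

lemma lft_apply (f : Rep k H (Module.End k M)) (x : H) : lft N f x = (f x).rTensor N := rfl

lemma rgt_apply (f : Rep k H (Module.End k N)) (x : H) : rgt M f x = (f x).lTensor M := rfl

@[simp] lemma lft_tmul (f : Rep k H (Module.End k M)) (x : H) (m : M) (n : N) :
    lft N f x (m ⊗ₜ n) = f x m ⊗ₜ n := rfl

@[simp] lemma rgt_tmul (f : Rep k H (Module.End k N)) (x : H) (m : M) (n : N) :
    rgt M f x (m ⊗ₜ n) = m ⊗ₜ f x n := rfl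

instance {f : Rep k H (Module.End k M)} [h : IsRep f] : IsRep (lft N f) :=
  ⟨by rw [lft_apply, h.one]; exact LinearMap.rTensor_id _ _, fun x y => by
    rw [lft_apply, h.mul]; exact LinearMap.rTensor_mul _ _ _⟩

instance {f : Rep k H (Module.End k N)} [h : IsRep f] : IsRep (rgt M f) :=
  ⟨by rw [rgt_apply, h.one]; exact LinearMap.lTensor_id _ _, fun x y => by
    rw [rgt_apply, h.mul]; exact LinearMap.lTensor_mul _ _ _⟩

instance {f g : Rep k H (Module.End k M)} [h : Comm f g] : Comm (lft N f) (lft N g) :=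
  ⟨fun x y => by
    rw [commute_iff_eq, lft_apply, lft_apply, ← LinearMap.rTensor_mul, (h.comm x y).eq,
      LinearMap.rTensor_mul]⟩

instance {f g : Rep k H (Module.End k N)} [h : Comm f g] : Comm (rgt M f) (rgt M g) :=
  ⟨fun x y => by
    rw [commute_iff_eq, rgt_apply, rgt_apply, ← LinearMap.lTensor_mul, (h.comm x y).eq,
      LinearMap.lTensor_mul]⟩

instance {f : Rep k H (Module.End k M)} {g : Rep k H (Module.End k N)} : Comm (lft N f) (rgt M g) :=
  ⟨fun x y => by
    rw [commute_iff_eq]; ext m n; simp⟩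

variable (k H) in
/-- The left regular representation. -/
def Lm : Rep k H (Module.End k H) := LinearMap.mul k H

variable (Q) in
/-- The representation of `H` on itself by `x ↦ (y ↦ y S(x))`. -/
def RS : Rep k H (Module.End k H) := (LinearMap.mul k H).flip ∘ₗ Q.S

@[simp] lemma Lm_apply (x y : H) : Lm k H x y = x * y := rfl

@[simp] lemma RS_apply (x y : H) : Q.RS x y = y * Q.S x := rfl

instance : IsRep (Lm k H) := ⟨by ext; simp, fun x y => by ext; simp [mul_assoc]⟩

instance : IsRep Q.RS := ⟨by ext; simp [Q.S_one], fun x y => by ext; simp [mul_assoc, Q.S_mul]⟩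

instance : Comm (Lm k H) Q.RS := ⟨fun x y => by
  rw [commute_iff_eq]; ext; simp [mul_assoc]⟩

/-- A character, as a representation by scalars. -/
def chr (M : Type*) [AddCommGroup M] [Module k M] (μ : H →ₐ[k] k) : Rep k H (Module.End k M) :=
  Algebra.linearMap k (Module.End k M) ∘ₗ μ.toLinearMap

@[simp] lemma chr_apply (μ : H →ₐ[k] k) (x : H) (m : M) : chr M μ x m = μ x • m := rfl

instance {μ : H →ₐ[k] k} : IsRep (chr M μ) := ⟨by ext; simp, fun x y => by
  ext m; simpa [mul_smul] using smul_comm _ _ _⟩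

instance {μ : H →ₐ[k] k} {f : Rep k H (Module.End k M)} : Comm (chr M μ) f := ⟨fun x y => by
  rw [commute_iff_eq]; ext; simp⟩

instance {μ : H →ₐ[k] k} {r : Module.End k M} : Cent (chr M μ) r := ⟨fun x => by
  rw [commute_iff_eq]; ext; simp⟩

@[simp] lemma triv_End_apply (x : H) (m : M) : Q.triv (Module.End k M) x m = Q.ε x • m := by
  rw [triv_apply]; simp

/-- The functional `X ↦ κ(X v)` on operators. -/
def vecK (κ : M →ₗ[k] N) (v : M) : Module.End k M →ₗ[k] N := κ ∘ₗ LinearMap.applyₗ v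

@[simp] lemma vecK_apply (κ : M →ₗ[k] N) (v : M) (X : Module.End k M) :
    vecK κ v X = κ (X v) := rfl

/-- To show `LEq` for a functional `X ↦ κ(X v)`, show that `κ` does not distinguish `f` and `f'`. -/
lemma LEq.of_vec {κ : M →ₗ[k] N} {v : M} {f f' : Rep k H (Module.End k M)}
    (h : ∀ x, κ ∘ₗ f x = κ ∘ₗ f' x) : LEq (vecK κ v) f f' := fun x X =>
  LinearMap.congr_fun (h x) (X v)

lemma REq.of_vec {κ : M →ₗ[k] N} {v : M} {f f' : Rep k H (Module.End k M)}
    (h : ∀ x, f x v = f' x v) : REq (vecK κ v) f f' := fun x X => by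
  simp [h x]

variable (Q) in
lemma S_α (h : H) : ev2 (R := H) Q.S (LinearMap.mulLeft k Q.α) (Q.Δ h) = Q.ε h • Q.α :=
  Q.antipode_α h

variable (Q) in
lemma S_β (h : H) : ev2 (R := H) (LinearMap.mulRight k Q.β) Q.S (Q.Δ h) = Q.ε h • Q.β :=
  Q.antipode_β h

lemma map_ev2 {R : Type*} [Ring R] [Algebra k R] {f g : H →ₗ[k] R} {F : R →ₗ[k] N}
    {G : H ⊗[k] H →ₗ[k] N} (h : ∀ x y, F (f x * g y) = G (x ⊗ₜ y)) (t : H ⊗[k] H) :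
    F (ev2 f g t) = G t := by
  have : F ∘ₗ ev2 f g = G := by ext x y; simp [h]
  exact LinearMap.congr_fun this t

lemma map_ev3 {R : Type*} [Ring R] [Algebra k R] {f g l : H →ₗ[k] R} {F : R →ₗ[k] N}
    {G : H ⊗[k] (H ⊗[k] H) →ₗ[k] N} (h : ∀ x y z, F (f x * (g y * l z)) = G (x ⊗ₜ (y ⊗ₜ z)))
    (t : H ⊗[k] (H ⊗[k] H)) : F (ev3 f g l t) = G t := by
  have : F ∘ₗ ev3 f g l = G := by ext x y z; simp [h]
  exact LinearMap.congr_fun this t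

lemma vec_ev2 {f g : Rep k H (Module.End k M)} {κ : M →ₗ[k] N} {v : M} {G : H ⊗[k] H →ₗ[k] N}
    (h : ∀ x y, κ (f x (g y v)) = G (x ⊗ₜ y)) (t : H ⊗[k] H) : κ (ev2 f g t v) = G t :=
  map_ev2 (R := Module.End k M) (F := vecK κ v) h t

lemma vec_ev3 {f g l : Rep k H (Module.End k M)} {κ : M →ₗ[k] N} {v : M}
    {G : H ⊗[k] (H ⊗[k] H) →ₗ[k] N}
    (h : ∀ x y z, κ (f x (g y (l z v))) = G (x ⊗ₜ (y ⊗ₜ z))) (t : H ⊗[k] (H ⊗[k] H)) :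
    κ (ev3 f g l t v) = G t :=
  map_ev3 (R := Module.End k M) (F := vecK κ v) h t

/-- A sufficient condition for the antipode axiom for `α` to apply to a pair of representations
`d`, `r` under a contraction `κ`: on the vector `m`, they enter only through `S(x) α y`. -/
def IsCap (Q : QuasiHopfAlgebra k H) (κ : M →ₗ[k] N) (d r : Rep k H (Module.End k M)) (m : M) :
    Prop :=
  ∃ B : H →ₗ[k] N, ∀ x y, κ (d x (r y m)) = B (Q.S x * Q.α * y)

section Cap

variable {κ : M →ₗ[k] N} {d r : Rep k H (Module.End k M)}

lemma IsCap.zero : IsCap Q κ d r 0 := ⟨0, by simp⟩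

lemma IsCap.add {m m' : M} : IsCap Q κ d r m → IsCap Q κ d r m' → IsCap Q κ d r (m + m') :=
  fun ⟨B, hB⟩ ⟨B', hB'⟩ => ⟨B + B', by simp [hB, hB']⟩

lemma IsCap.apply {m : M} [IsRep d] [IsRep r] (h : IsCap Q κ d r m) (x : H) :
    κ (Q.conv d r x m) = Q.ε x • κ m := by
  obtain ⟨B, hB⟩ := h
  have h1 : κ m = B Q.α := by
    have := hB 1 1
    simpa [IsRep.one (f := d), IsRep.one (f := r), Q.S_one] using this
  have := map_ev2 (f := d) (g := r) (F := vecK κ m)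
    (G := B ∘ₗ ev2 (R := H) Q.S (LinearMap.mulLeft k Q.α))
    (fun x y => by simp [hB, mul_assoc]) (Q.Δ x)
  rw [conv_apply, h1, ← map_smul, ← Q.S_α]
  exact this

lemma LEq.of_isCap [IsRep d] [IsRep r] (h : ∀ m, IsCap Q κ d r m) (v : M) :
    LEq (vecK κ v) (Q.conv d r) (Q.triv _) :=
  LEq.of_vec fun x => by ext m; simpa using (h m).apply x

end Cap

section Cap

variable {A B C : Type*} [AddCommGroup A] [Module k A] [AddCommGroup B] [Module k B]
  [AddCommGroup C] [Module k C]

lemma IsCap.of₂ {κ : A ⊗[k] B →ₗ[k] N} {d r : Rep k H (Module.End k (A ⊗[k] B))}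
    (h : ∀ a b, IsCap Q κ d r (a ⊗ₜ b)) (m : A ⊗[k] B) : IsCap Q κ d r m := by
  induction m with
  | zero => exact IsCap.zero
  | tmul a b => exact h a b
  | add x y hx hy => exact hx.add hy

lemma IsCap.of₃ {κ : A ⊗[k] (B ⊗[k] C) →ₗ[k] N} {d r : Rep k H (Module.End k (A ⊗[k] (B ⊗[k] C)))}
    (h : ∀ a b c, IsCap Q κ d r (a ⊗ₜ (b ⊗ₜ c))) : ∀ m, IsCap Q κ d r m := by
  refine IsCap.of₂ fun a m => ?_
  induction m with
  | zero => rw [TensorProduct.tmul_zero]; exact IsCap.zero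
  | tmul b c => exact h a b c
  | add x y hx hy => rw [TensorProduct.tmul_add]; exact hx.add hy

end Cap

/-- The vector `v` carries `β` in a place where `p` acts on the left and `d` on the right. -/
lemma REq.of_cup {κ : M →ₗ[k] N} {p d : Rep k H (Module.End k M)} [IsRep p] [IsRep d] {v : M}
    (B : H →ₗ[k] M) (hB : ∀ x y, p x (d y v) = B (x * Q.β * Q.S y)) :
    REq (vecK κ v) (Q.conv p d) (Q.triv _) := REq.of_vec fun x => by
  have h1 : v = B Q.β := by
    have := hB 1 1
    simpa [IsRep.one (f := d), IsRep.one (f := p), Q.S_one] using this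
  have := map_ev2 (f := p) (g := d) (F := LinearMap.applyₗ v)
    (G := B ∘ₗ QuasiHopfAlgebra.ev2 (R := H) (LinearMap.mulRight k Q.β) Q.S)
    (fun x y => by simp [hB]) (Q.Δ x)
  rw [conv_apply, triv_End_apply]
  conv_rhs => rw [h1, ← map_smul, ← Q.S_β]
  exact this

/-- The linear map `j` intertwines `f` with `f'`. -/
class Intw (j : M →ₗ[k] N) (f : Rep k H (Module.End k M)) (f' : Rep k H (Module.End k N)) :
    Prop where
  eq : ∀ x m, j (f x m) = f' x (j m)

section Intw

variable (j : M →ₗ[k] N) {f g l : Rep k H (Module.End k M)} {f' g' l' : Rep k H (Module.End k N)}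

lemma Intw.ev2 [h1 : Intw j f f'] [h2 : Intw j g g'] (t : H ⊗[k] H) (m : M) :
    j (ev2 f g t m) = QuasiHopfAlgebra.ev2 f' g' t (j m) := by
  induction t with
  | zero => simp
  | add s s' hs hs' => simp only [map_add, LinearMap.add_apply, hs, hs']
  | tmul x y => simp only [ev2_tmul, Module.End.mul_apply, h1.eq, h2.eq]

lemma Intw.ev3 [h1 : Intw j f f'] [h2 : Intw j g g'] [h3 : Intw j l l']
    (t : H ⊗[k] (H ⊗[k] H)) (m : M) :
    j (ev3 f g l t m) = QuasiHopfAlgebra.ev3 f' g' l' t (j m) := by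
  induction t with
  | zero => simp
  | add s s' hs hs' => simp only [map_add, LinearMap.add_apply, hs, hs']
  | tmul x y =>
    simp only [ev3_tmul, Module.End.mul_apply, h1.eq]
    rw [Intw.ev2 j (f := g) (g := l) (f' := g') (g' := l')]

instance Intw.conv [Intw j f f'] [Intw j g g'] : Intw j (Q.conv f g) (Q.conv f' g') :=
  ⟨fun _ _ => Intw.ev2 j _ _⟩

lemma ph_intw [Intw j f f'] [Intw j g g'] [Intw j l l'] (m : M) :
    j (Q.ph f g l m) = Q.ph f' g' l' (j m) := Intw.ev3 j _ _

lemma phb_intw [Intw j f f'] [Intw j g g'] [Intw j l l'] (m : M) :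
    j (Q.phb f g l m) = Q.phb f' g' l' (j m) := Intw.ev3 j _ _

end Intw

end Slots
end
end QuasiHopfAlgebra

namespace QuasiHopfAlgebra

noncomputable section

section Invariants

variable {k H : Type*} [Field k] [Ring H] [Algebra k H] (Q : QuasiHopfAlgebra k H)
  {U : Type*} [AddCommGroup U] [Module k U] (ρ : Rep k H (Module.End k U))

/-! ### Invariants of `H ⊗ U` -/

/-- The action of `H ⊗ H` on `H ⊗ U` for a representation `ρ` on `U`. -/
def act2 : Rep k (H ⊗[k] H) (Module.End k (H ⊗[k] U)) := ev2 (lft U (Lm k H)) (rgt H ρ)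

@[simp] lemma act2_tmul (x y a : H) (u : U) : act2 ρ (x ⊗ₜ y) (a ⊗ₜ u) = (x * a) ⊗ₜ ρ y u := rfl

lemma act2_mul [IsRep ρ] (s t : H ⊗[k] H) : act2 ρ (s * t) = act2 ρ s * act2 ρ t :=
  ev2_mul _ _ s t

/-- `x ⊗ y ⊗ u ↦ x α y ⊗ u` -/
def contrα (U : Type*) [AddCommGroup U] [Module k U] : H ⊗[k] (H ⊗[k] U) →ₗ[k] H ⊗[k] U :=
  (LinearMap.mul' k H ∘ₗ (LinearMap.mulLeft k Q.α).lTensor H).rTensor U ∘ₗ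
    (TensorProduct.assoc k H H U).symm.toLinearMap

@[simp] lemma contrα_tmul (x y : H) (u : U) :
    Q.contrα U (x ⊗ₜ (y ⊗ₜ u)) = (x * (Q.α * y)) ⊗ₜ u := rfl

lemma contrα_isCap (m : H ⊗[k] (H ⊗[k] U)) :
    IsCap Q (Q.contrα U) (lft (H ⊗[k] U) Q.RS) (rgt H (lft U (Lm k H))) m :=
  IsCap.of₃ (fun a b u => ⟨(TensorProduct.mk k H U).flip u ∘ₗ LinearMap.mulLeft k a ∘ₗ
    LinearMap.mulRight k b, fun x y => by simp [mul_assoc]⟩) m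

variable {ρ} in
lemma conv_tmul {A : Type*} [AddCommGroup A] [Module k A] (h : H) (a : A) (t : H ⊗[k] U) :
    Q.conv (rgt A (lft U (Lm k H))) (rgt A (rgt H ρ)) h (a ⊗ₜ t) =
      a ⊗ₜ act2 ρ (Q.Δ h) t :=
  vec_ev2 (κ := LinearMap.id) (v := a ⊗ₜ t)
    (G := TensorProduct.mk k A (H ⊗[k] U) a ∘ₗ LinearMap.applyₗ t ∘ₗ act2 ρ) (fun _ _ => rfl) (Q.Δ h)

lemma contrα_phb (t : H ⊗[k] U) (a : H) (T : H ⊗[k] (H ⊗[k] H)) :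
    Q.contrα U (ev3 (lft (H ⊗[k] U) Q.RS) (rgt H (lft U (Lm k H))) (rgt H (rgt H ρ)) T (a ⊗ₜ t)) =
    lft U (Lm k H) a
      (act2 ρ (Q.mulSα.rTensor H ((TensorProduct.assoc k H H H).symm T)) t) := by
  induction t with
  | zero => simp
  | add t t' ht ht' => simp only [map_add, TensorProduct.tmul_add, ht, ht']
  | tmul b u =>
    exact vec_ev3 (κ := Q.contrα U) (v := a ⊗ₜ (b ⊗ₜ u))
      (G := lft U (Lm k H) a ∘ₗ LinearMap.applyₗ (b ⊗ₜ u) ∘ₗ act2 ρ ∘ₗ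
        Q.mulSα.rTensor H ∘ₗ (TensorProduct.assoc k H H H).symm.toLinearMap)
      (fun x y z => by simp [mulSα, mul_assoc]) T

variable [IsRep ρ]

/-- `β qᴸ` acts on invariants as the identity. -/
lemma qL_of_invariant (t : H ⊗[k] U)
    (ht : ∀ h, act2 ρ (Q.Δ h) t = Q.ε h • t) :
    lft U (Lm k H) Q.β (act2 ρ Q.qL t) = t := by
  set p := lft (H ⊗[k] U) (Lm k H) with hp
  set d := lft (H ⊗[k] U) Q.RS with hd
  set r := rgt H (lft U (Lm k H)) with hr
  set s := rgt H (rgt H ρ) with hs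
  have hβ : REq (vecK (Q.contrα U) (Q.β ⊗ₜ t)) (Q.conv p d) (Q.triv _) :=
    REq.of_cup ((TensorProduct.mk k H _).flip t) (by intro x y; simp [hp, hd, mul_assoc])
  have h0 := zigzag_word p d r s hβ (LEq.of_isCap (Q.contrα_isCap) _) 1
  have h1 := (REq.of_vec (κ := Q.contrα U) (v := Q.β ⊗ₜ t) (f := Q.conv r s) (f' := Q.triv _)
    (fun h => by simp [hr, hs, conv_tmul, ht])).ph_right (f := p) (g := d) (Q.phb d r s) 1
  rw [mul_one, mul_one] at h1
  rw [one_mul, one_mul, h1] at h0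
  have h3 : Q.contrα U (Q.ph p d r (Q.β ⊗ₜ t)) = t := by
    have : ∀ T, Q.contrα U (ev3 p d r T (Q.β ⊗ₜ t)) =
      lft U (Lm k H) (LinearMap.mul' k H
      (TensorProduct.map (LinearMap.mulRight k Q.β)
        (LinearMap.mul' k H ∘ₗ TensorProduct.map Q.S (LinearMap.mulLeft k Q.α)) T)) t := by
      intro T
      clear * - T
      induction t with
      | zero => simp
      | add t t' ht ht' => simp only [map_add, TensorProduct.tmul_add, ht, ht']
      | tmul b u =>
        exact vec_ev3 (κ := Q.contrα U) (v := Q.β ⊗ₜ (b ⊗ₜ u))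
          (G := (TensorProduct.mk k H U).flip u ∘ₗ LinearMap.mulRight k b ∘ₗ LinearMap.mul' k H ∘ₗ
            (TensorProduct.map (LinearMap.mulRight k Q.β)
        (LinearMap.mul' k H ∘ₗ TensorProduct.map Q.S (LinearMap.mulLeft k Q.α))))
          (fun x y z => by simp [p, d, r, mul_assoc]) T
    rw [ph, this, phi, Q.antipode_φ, IsRep.one]
    rfl
  have h2 := contrα_phb Q ρ t Q.β Q.phiInv
  exact h2.symm.trans (h0.trans h3)

/-- `(1 ⊗ h) qᴸ = (S(h₍₁₎) ⊗ 1) qᴸ Δ(h₍₂₎)`, acting on `H ⊗ U`. -/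
lemma qL_comm (h : H) (t : H ⊗[k] U) : (ρ h).lTensor H (act2 ρ Q.qL t) =
    Q.conv (lft U (Lm k H) ∘ₗ Q.S)
      ((LinearMap.mulLeft k (act2 ρ Q.qL)) ∘ₗ act2 ρ ∘ₗ Q.Δ.toLinearMap) h t := by
  set d := lft (H ⊗[k] U) Q.RS with hd
  set r := rgt H (lft U (Lm k H)) with hr
  set s := rgt H (rgt H ρ) with hs
  have h0 := congrArg (fun X => Q.contrα U (X (1 ⊗ₜ t))) (conv_assoc' (Q := Q) d r s h)
  have h1 := (LEq.of_isCap (Q.contrα_isCap (U := U)) (1 ⊗ₜ t)).conv_triv_left s h (Q.phb d r s)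
  simp only [vecK_apply] at h1
  rw [h1, Module.End.mul_apply, Module.End.mul_apply] at h0
  have h2 : ∀ m, Q.contrα U (s h m) = (ρ h).lTensor H (Q.contrα U m) := by
    intro m
    have : Q.contrα U ∘ₗ s h = (ρ h).lTensor H ∘ₗ Q.contrα U := by ext; simp [hs]
    exact LinearMap.congr_fun this m
  rw [h2, phb, contrα_phb Q ρ t 1] at h0
  have h3 : lft U (Lm k H) (1 : H) = LinearMap.id := by ext; simp
  rw [h3, LinearMap.id_apply] at h0
  refine h0.symm.trans ?_
  refine vec_ev2 (f := d) (g := Q.conv r s) (κ := Q.contrα U ∘ₗ Q.phb d r s) (v := 1 ⊗ₜ t)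
    (G := LinearMap.applyₗ t ∘ₗ ev2 (R := Module.End k (H ⊗[k] U)) _ _) (fun x y => ?_) (Q.Δ h)
  have h4 : ∀ m, d x (1 ⊗ₜ m) = Q.S x ⊗ₜ m := by simp [hd]
  simp only [LinearMap.comp_apply, hr, hs, conv_tmul, h4]
  rw [phb, contrα_phb]
  rfl

/-! ### Invariants and left integrals -/

/-- `x ⊗ y ⊗ u ↦ x ⊗ S(y) α u` -/
def contrSα (ρ : Rep k H (Module.End k U)) : H ⊗[k] (H ⊗[k] U) →ₗ[k] H ⊗[k] U :=
  (TensorProduct.lift (ρ ∘ₗ LinearMap.mulRight k Q.α ∘ₗ Q.S)).lTensor H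

omit [IsRep ρ] in
@[simp] lemma contrSα_tmul (x y : H) (u : U) :
    Q.contrSα ρ (x ⊗ₜ (y ⊗ₜ u)) = x ⊗ₜ ρ (Q.S y * Q.α) u := rfl

lemma contrSα_isCap (m : H ⊗[k] (H ⊗[k] U)) :
    IsCap Q (Q.contrSα ρ) (rgt H (lft U (Lm k H))) (rgt H (rgt H ρ)) m :=
  IsCap.of₃ (fun a b u => ⟨TensorProduct.mk k H U a ∘ₗ LinearMap.applyₗ u ∘ₗ ρ ∘ₗ
    LinearMap.mulLeft k (Q.S b), fun x y => by
      simp [mul_assoc, Q.S_mul, IsRep.mul (f := ρ)]⟩) m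

/-- `x ⊗ u ↦ x₍₁₎ ⊗ x₍₂₎ ⊗ u` -/
def Δl (U : Type*) [AddCommGroup U] [Module k U] : H ⊗[k] U →ₗ[k] H ⊗[k] (H ⊗[k] U) :=
  (TensorProduct.assoc k H H U).toLinearMap ∘ₗ Q.Δ.toLinearMap.rTensor U

omit [IsRep ρ] in
lemma Δl_tmul (x : H) (u : U) : Q.Δl U (x ⊗ₜ u) =
    Q.conv (lft (H ⊗[k] U) (Lm k H)) (rgt H (lft U (Lm k H))) x (1 ⊗ₜ (1 ⊗ₜ u)) := by
  refine (vec_ev2 (κ := LinearMap.id) (G := (TensorProduct.assoc k H H U).toLinearMap ∘ₗ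
    (TensorProduct.mk k (H ⊗[k] H) U).flip u) (fun x y => ?_) (Q.Δ x)).symm
  simp

instance : Intw (Q.Δl U) (lft U (Lm k H))
    (Q.conv (lft (H ⊗[k] U) (Lm k H)) (rgt H (lft U (Lm k H)))) :=
  ⟨fun x m => by
    induction m with
    | zero => simp
    | add s s' hs hs' => simp only [map_add, hs, hs']
    | tmul y u =>
      rw [lft_tmul, Δl_tmul, Δl_tmul, ← Module.End.mul_apply, ← IsRep.mul]; rfl⟩

omit [IsRep ρ] in
variable {ρ} in
lemma Δl_rgt : Intw (Q.Δl U) (rgt H ρ) (rgt H (rgt H ρ)) :=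
  ⟨fun x m => by
    induction m with
    | zero => simp
    | add s s' hs hs' => simp only [map_add, hs, hs']
    | tmul y u =>
      have : ∀ t : H ⊗[k] H, TensorProduct.assoc k H H U (t ⊗ₜ ρ x u) =
          rgt H (rgt H ρ) x (TensorProduct.assoc k H H U (t ⊗ₜ u)) := fun t => by
        induction t with
        | zero => simp
        | add s s' hs hs' => simp only [map_add, TensorProduct.add_tmul, hs, hs']
        | tmul a b => simp
      exact this _⟩

/-- The map `x ⊗ u ↦ φ₁ x₍₁₎ ⊗ S(φ₂ x₍₂₎) α φ₃ u`, turning the diagonal action of `H` into the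
action on the first factor. -/
def untwist : H ⊗[k] U →ₗ[k] H ⊗[k] U :=
  Q.contrSα ρ ∘ₗ Q.ph (lft (H ⊗[k] U) (Lm k H)) (rgt H (lft U (Lm k H))) (rgt H (rgt H ρ)) ∘ₗ
    Q.Δl U

/-- The map `x ⊗ u ↦ Δ(x) pᴿ (1 ⊗ u)`, the inverse of `untwist`. -/
def twist : H ⊗[k] U →ₗ[k] H ⊗[k] U :=
  TensorProduct.lift (LinearMap.compl₂ (act2 ρ ∘ₗ Q.Δ.toLinearMap)
    (act2 ρ Q.pR ∘ₗ TensorProduct.mk k H U 1))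

omit [IsRep ρ] in
lemma twist_tmul (x : H) (u : U) : Q.twist ρ (x ⊗ₜ u) =
    act2 ρ (Q.Δ x) (act2 ρ Q.pR (1 ⊗ₜ u)) := rfl

lemma untwist_diag (h : H) (t : H ⊗[k] U) : Q.untwist ρ (act2 ρ (Q.Δ h) t) =
    lft U (Lm k H) h (Q.untwist ρ t) := by
  set a := lft (H ⊗[k] U) (Lm k H) with ha
  set b := rgt H (lft U (Lm k H)) with hb
  set c := rgt H (rgt H ρ) with hc
  have i1 := Q.Δl_rgt (ρ := ρ)
  have h1 : Q.Δl U (act2 ρ (Q.Δ h) t) = Q.conv (Q.conv a b) c h (Q.Δl U t) :=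
    Intw.ev2 _ _ _
  have h2 := congrArg (fun X => Q.contrSα ρ (X (Q.Δl U t))) (conv_assoc (Q := Q) a b c h)
  have h3 := (LEq.of_isCap (Q.contrSα_isCap ρ) (Q.Δl U t)).conv_triv_right a h (Q.ph a b c)
  have h4 : ∀ m, Q.contrSα ρ (a h m) = lft U (Lm k H) h (Q.contrSα ρ m) := by
    intro m
    have : Q.contrSα ρ ∘ₗ a h = lft U (Lm k H) h ∘ₗ Q.contrSα ρ := by
      ext; simp [ha]
    exact LinearMap.congr_fun this m
  simp only [untwist, LinearMap.comp_apply, h1]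
  refine h2.symm.trans (h3.trans (h4 _))

lemma untwist_twist : Q.untwist ρ ∘ₗ Q.twist ρ = LinearMap.id := by
  refine TensorProduct.ext' fun x u => ?_
  have i1 := Q.Δl_rgt (ρ := ρ)
  -- operators on `H ⊗ H ⊗ H`, mapped to `H ⊗ H ⊗ U` by acting on `u`
  set j : H ⊗[k] (H ⊗[k] H) →ₗ[k] H ⊗[k] (H ⊗[k] U) :=
    ((LinearMap.applyₗ u ∘ₗ ρ).lTensor H).lTensor H with hj
  set a := lft (H ⊗[k] H) (Lm k H) with ha
  set b := rgt H (lft H (Lm k H)) with hb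
  set c := rgt H (rgt H (Lm k H)) with hc
  set d := rgt H (rgt H Q.RS) with hd
  set a' := lft (H ⊗[k] U) (Lm k H) with ha'
  set b' := rgt H (lft U (Lm k H)) with hb'
  set c' := rgt H (rgt H ρ) with hc'
  have ja : Intw j a a' := ⟨fun x m => LinearMap.congr_fun (show j ∘ₗ a x = a' x ∘ₗ j by
    ext; simp [ha, ha', hj]) m⟩
  have jb : Intw j b b' := ⟨fun x m => LinearMap.congr_fun (show j ∘ₗ b x = b' x ∘ₗ j by
    ext; simp [hb, hb', hj]) m⟩
  have jc : Intw j c c' := ⟨fun x m => LinearMap.congr_fun (show j ∘ₗ c x = c' x ∘ₗ j by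
    ext; simp [hc, hc', hj, IsRep.mul (f := ρ)]) m⟩
  set v : H ⊗[k] (H ⊗[k] H) := 1 ⊗ₜ (1 ⊗ₜ Q.β) with hv
  have h1 : Q.Δl U (act2 ρ (Q.Δ x) (act2 ρ Q.pR (1 ⊗ₜ u))) =
      Q.conv (Q.conv a' b') c' x (Q.Δl U (act2 ρ Q.pR (1 ⊗ₜ u))) := Intw.ev2 _ _ _
  have h2 : Q.Δl U (act2 ρ Q.pR (1 ⊗ₜ u)) = j (Q.phb (Q.conv a b) c d v) := by
    refine (vec_ev3 (G := Q.Δl U ∘ₗ LinearMap.applyₗ ((1 : H) ⊗ₜ[k] u) ∘ₗ act2 ρ ∘ₗ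
      Q.mulβS.lTensor H) (fun x y z => ?_) Q.phiInv).symm
    have hz : c y (d z v) = 1 ⊗ₜ (1 ⊗ₜ (y * (Q.β * Q.S z))) := by simp [hc, hd, hv]
    have hΔ : Q.Δl U (x ⊗ₜ[k] ρ (y * (Q.β * Q.S z)) u) =
      Q.conv a' b' x (1 ⊗ₜ (1 ⊗ₜ ρ (y * (Q.β * Q.S z)) u)) := Q.Δl_tmul _ _
    rw [(Intw.conv j : Intw j (Q.conv a b) (Q.conv a' b')).eq, hz]
    simp [mulβS, hΔ, hj, mul_assoc]
  have hcap := LEq.of_isCap (Q := Q) (κ := Q.contrSα ρ ∘ₗ j) (d := b) (r := c) (fun m =>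
    IsCap.of₃ (fun a0 b0 c0 => ⟨TensorProduct.mk k H U a0 ∘ₗ LinearMap.applyₗ u ∘ₗ ρ ∘ₗ
      LinearMap.mulLeft k (Q.S b0) ∘ₗ LinearMap.mulRight k c0, fun x y => by
      simp [hb, hc, hj, mul_assoc, Q.S_mul, IsRep.mul (f := ρ)]⟩) m) v
  have hcup : REq (vecK (Q.contrSα ρ ∘ₗ j) v) (Q.conv c d) (Q.triv _) :=
    REq.of_cup (TensorProduct.mk k H _ 1 ∘ₗ TensorProduct.mk k H _ 1)
      (by intro x y; simp [hc, hd, hv, mul_assoc])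
  have h3 := hcap.conv_triv_right a x (Q.ph a b c * Q.phb (Q.conv a b) c d)
  have h4 := zigzag_word' (Q := Q) (K := vecK (Q.contrSα ρ ∘ₗ j) v ∘ₗ LinearMap.mulLeft k (a x)) a b c d
    (fun y X => by simpa [mul_assoc] using hcup y (a x * X))
    (hcap.comp (a x))
  have h5 : Q.contrSα ρ (j (a x (Q.phb b c d v))) = x ⊗ₜ u := by
    refine (vec_ev3 (κ := Q.contrSα ρ ∘ₗ j ∘ₗ a x) (G := TensorProduct.mk k H U x ∘ₗ
      LinearMap.applyₗ u ∘ₗ ρ ∘ₗ LinearMap.mul' k H ∘ₗ (TensorProduct.map Q.S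
        (LinearMap.mul' k H ∘ₗ
          TensorProduct.map (LinearMap.mulLeft k Q.α) (LinearMap.mulLeft k Q.β ∘ₗ Q.S))))
        (fun x y z => ?_) Q.phiInv).trans ?_
    · simp [ha, hb, hc, hd, hv, hj, mul_assoc, IsRep.mul (f := ρ)]
    · have := Q.antipode_φ_inv
      simp only [LinearMap.comp_apply, phiInv, this]
      simp [IsRep.one (f := ρ)]
  rw [LinearMap.comp_apply, twist_tmul, untwist, LinearMap.comp_apply, LinearMap.comp_apply, h1, h2,
    ← (Intw.conv j : Intw j (Q.conv (Q.conv a b) c) (Q.conv (Q.conv a' b') c')).eq,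
    ← ph_intw j (f := a) (g := b) (l := c)]
  rw [← Module.End.mul_apply, ← Module.End.mul_apply, ← conv_assoc, mul_assoc]
  exact h3.trans (h4.trans h5)

end Invariants
end
end QuasiHopfAlgebra

namespace QuasiHopfAlgebra

noncomputable section

section Integrals

variable {k H : Type*} [Field k] [Ring H] [Algebra k H] (Q : QuasiHopfAlgebra k H)

/-! ### Integrals and the bijectivity of the antipode -/

lemma ε_S (h : H) : Q.ε (Q.S h) = Q.ε h := by
  have h1 := congrArg Q.ε (Q.S_α h)
  have h2 : ∀ t : H ⊗[k] H, Q.ε (ev2 (R := H) Q.S (LinearMap.mulLeft k Q.α) t) =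
      Q.ε (Q.S (TensorProduct.rid k H (Q.ε.toLinearMap.lTensor H t))) := fun t => by
    induction t with
    | zero => simp
    | add s s' hs hs' => simp only [map_add, hs, hs']
    | tmul x y => simp [Q.ε_α, mul_comm]
  rw [h2, Q.counit_right] at h1
  simpa [Q.ε_α] using h1

/-- The space of left integrals in `H`. -/
def leftInt : Submodule k H where
  carrier := {x | ∀ h, h * x = Q.ε h • x}
  zero_mem' := by simp
  add_mem' := by
    intro a b ha hb h
    rw [mul_add, ha h, hb h, smul_add]
  smul_mem' := by
    intro c x hx h
    rw [mul_smul_comm, hx h, smul_comm]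

/-- `x ⊗ y ↦ x m(S(y) z)` -/
def expand (m : Module.Dual k H) (z : H) : H ⊗[k] H →ₗ[k] H :=
  (TensorProduct.rid k H).toLinearMap ∘ₗ (m ∘ₗ LinearMap.mulRight k z ∘ₗ Q.S).lTensor H

@[simp] lemma expand_tmul (m : Module.Dual k H) (z x y : H) :
    Q.expand m z (x ⊗ₜ y) = m (Q.S y * z) • x := by simp [expand]

/-- `x ⊗ y ↦ m(x) y` -/
def evalL (m : Module.Dual k H) : H ⊗[k] H →ₗ[k] H :=
  (TensorProduct.lid k H).toLinearMap ∘ₗ m.rTensor H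

@[simp] lemma evalL_tmul (m : Module.Dual k H) (x y : H) :
    evalL m (x ⊗ₜ y) = m x • y := by simp [evalL]

lemma evalL_mul (m : Module.Dual k H) (t : H ⊗[k] H) (h : H) :
    evalL m (((1 : H) ⊗ₜ h) * t) = h * evalL m t := by
  induction t with
  | zero => simp
  | add s s' hs hs' => simp only [mul_add, map_add, hs, hs']
  | tmul x y => simp

/-- The element `qᴸ Δ(x) pᴿ`. -/
def cElt (x : H) : H ⊗[k] H := Q.qL * Q.Δ x * Q.pR

lemma act2_Lm (s t : H ⊗[k] H) : act2 (Lm k H) s t = s * t := by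
  induction s with
  | zero => simp
  | add s s' hs hs' => simp only [add_mul, map_add, LinearMap.add_apply, hs, hs']
  | tmul x y =>
    induction t with
    | zero => simp
    | add s s' hs hs' => simp only [mul_add, map_add, hs, hs']
    | tmul z w => simp

section Rho

variable {U : Type*} [AddCommGroup U] [Module k U] (ρ : Rep k H (Module.End k U)) [IsRep ρ]

/-- The action of `qᴸ` on an invariant produces a vector `s` with `(1 ⊗ h) s = (S(h) ⊗ 1) s`. -/
lemma qL_comm_of_invariant (t : H ⊗[k] U) (ht : ∀ h, act2 ρ (Q.Δ h) t = Q.ε h • t) (h : H) :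
    (ρ h).lTensor H (act2 ρ Q.qL t) = lft U (Lm k H) (Q.S h) (act2 ρ Q.qL t) := by
  rw [qL_comm]
  have : ∀ X : H ⊗[k] H, ev2 (R := Module.End k (H ⊗[k] U)) (lft U (Lm k H) ∘ₗ Q.S)
      ((LinearMap.mulLeft k (act2 ρ Q.qL)) ∘ₗ act2 ρ ∘ₗ Q.Δ.toLinearMap) X t =
      lft U (Lm k H) (Q.S (TensorProduct.rid k H (Q.ε.toLinearMap.lTensor H X)))
        (act2 ρ Q.qL t) := fun X => by
    induction X with
    | zero => simp
    | add s s' hs hs' => simp only [map_add, LinearMap.add_apply, hs, hs']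
    | tmul x y => simp [ht]
  rw [conv_apply, this, Q.counit_right]

omit [IsRep ρ] in
/-- Conversely, `β` turns such vectors into invariants. -/
lemma invariant_of_comm (s : H ⊗[k] U) (hs : ∀ h, (ρ h).lTensor H s =
    lft U (Lm k H) (Q.S h) s) (h : H) :
    act2 ρ (Q.Δ h) (lft U (Lm k H) Q.β s) =
      Q.ε h • lft U (Lm k H) Q.β s := by
  have : ∀ X : H ⊗[k] H, act2 ρ X (lft U (Lm k H) Q.β s) =
      lft U (Lm k H) (ev2 (R := H) (LinearMap.mulRight k Q.β) Q.S X) s := fun X => by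
    induction X with
    | zero => simp
    | add s s' hs hs' => simp only [map_add, LinearMap.add_apply, hs, hs']
    | tmul x y =>
      have h1 : act2 ρ (x ⊗ₜ[k] y) (lft U (Lm k H) Q.β s) =
          lft U (Lm k H) (x * Q.β) ((ρ y).lTensor H s) := by
        clear hs
        induction s with
        | zero => simp
        | add s s' hs hs' => simp only [map_add, hs, hs']
        | tmul z w => simp [mul_assoc]
      rw [h1, hs]
      clear hs h1
      induction s with
      | zero => simp
      | add s s' hs hs' => simp only [map_add, hs, hs']
      | tmul z w => simp [mul_assoc]
  rw [this, Q.S_β, map_smul]; rfl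

omit [IsRep ρ] in
lemma qL_β (s : H ⊗[k] U) (hs : ∀ h, (ρ h).lTensor H s =
    lft U (Lm k H) (Q.S h) s) :
    act2 ρ Q.qL (lft U (Lm k H) Q.β s) = s := by
  have : ∀ X : H ⊗[k] (H ⊗[k] H), act2 ρ (Q.mulSα.rTensor H ((TensorProduct.assoc k H H H).symm X))
      (lft U (Lm k H) Q.β s) = lft U (Lm k H) (LinearMap.mul' k H
      (TensorProduct.map Q.S
        (LinearMap.mul' k H ∘ₗ
          TensorProduct.map (LinearMap.mulLeft k Q.α) (LinearMap.mulLeft k Q.β ∘ₗ Q.S)) X)) s := by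
    intro X
    induction X with
    | zero => simp
    | add s s' hs hs' => simp only [map_add, LinearMap.add_apply, hs, hs']
    | tmul x y =>
    induction y with
    | zero => simp
    | add s s' hs hs' => simp only [map_add, TensorProduct.tmul_add, LinearMap.add_apply, hs, hs']
    | tmul y z =>
      have h1 : act2 ρ (Q.mulSα.rTensor H ((TensorProduct.assoc k H H H).symm (x ⊗ₜ (y ⊗ₜ z))))
          (lft U (Lm k H) Q.β s) =
          lft U (Lm k H) (Q.S x * Q.α * y * Q.β) ((ρ z).lTensor H s) := by
        clear hs
        induction s with
        | zero => simp
        | add s s' hs hs' => simp only [map_add, hs, hs']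
        | tmul z w => simp [mul_assoc, mulSα]
      rw [h1, hs]
      clear hs h1
      induction s with
      | zero => simp
      | add s s' hs hs' => simp only [map_add, hs, hs']
      | tmul z w => simp [mul_assoc]
  refine (this Q.phiInv).trans ?_
  have h2 := Q.antipode_φ_inv
  rw [phiInv, h2, IsRep.one]
  rfl

/-- An invariant of `H ⊗ U` comes from `I ⊗ U`, where `I` is the space of left integrals. -/
lemma invariant_eq_sum [FiniteDimensional k H] [FiniteDimensional k U] {n : ℕ}
    (Λ : Module.Basis (Fin n) k Q.leftInt) (t : H ⊗[k] U)
    (ht : ∀ h, act2 ρ (Q.Δ h) t = Q.ε h • t) :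
    ∃ u : Fin n → U, t = ∑ j, Q.twist ρ ((Λ j : H) ⊗ₜ u j) := by
  have h0 : Q.twist ρ ∘ₗ Q.untwist ρ = LinearMap.id :=
by
    have h : (Q.untwist ρ : Module.End k (H ⊗[k] U)) * Q.twist ρ = 1 := Q.untwist_twist ρ
    exact mul_eq_one_comm.1 h
  set Y := Q.untwist ρ t with hY
  have hYh : ∀ h, lft U (Lm k H) h Y = Q.ε h • Y := fun h => by
    rw [hY, ← untwist_diag, ht, map_smul]
  let P : Module.Dual k U → H ⊗[k] U →ₗ[k] H := fun ξ =>
    (TensorProduct.rid k H).toLinearMap ∘ₗ ξ.lTensor H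
  have hP : ∀ ξ, P ξ Y ∈ Q.leftInt := fun ξ h => by
    have : ∀ Z, P ξ (lft U (Lm k H) h Z) = h * P ξ Z := fun Z => by
      induction Z with
      | zero => simp
      | add s s' hs hs' => simp only [map_add, mul_add, hs, hs']
      | tmul x y => simp [P]
    rw [← this, hYh, map_smul]
  let b := Module.finBasis k U
  have hb : ∀ Z, Z = ∑ i, P (b.coord i) Z ⊗ₜ b i := fun Z => by
    induction Z with
    | zero => simp
    | add s s' hs hs' =>
      conv_lhs => rw [hs, hs']
      simp only [map_add, TensorProduct.add_tmul, Finset.sum_add_distrib]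
    | tmul x y =>
      conv_lhs => rw [← b.sum_repr y, TensorProduct.tmul_sum]
      refine Finset.sum_congr rfl fun i _ => ?_
      simp [P, TensorProduct.smul_tmul]
  refine ⟨fun j => ∑ i, Λ.repr ⟨P (b.coord i) Y, hP _⟩ j • b i, ?_⟩
  have h1 : Y = ∑ j, (Λ j : H) ⊗ₜ[k] (∑ i, Λ.repr ⟨P (b.coord i) Y, hP _⟩ j • b i) := by
    have h2 : ∀ i, P (b.coord i) Y = ∑ j, Λ.repr ⟨P (b.coord i) Y, hP _⟩ j • (Λ j : H) := fun i => by
      have := congrArg Subtype.val (Λ.sum_repr ⟨P (b.coord i) Y, hP _⟩)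
      exact this.symm.trans (by simp only [AddSubmonoidClass.coe_finsetSum, Submodule.coe_smul])
    conv_lhs => rw [hb Y]
    simp only [TensorProduct.tmul_sum]
    rw [Finset.sum_comm]
    refine Finset.sum_congr rfl fun i _ => ?_
    conv_lhs => rw [h2 i, TensorProduct.sum_tmul]
    simp [TensorProduct.smul_tmul]
  rw [← map_sum, ← h1, hY, ← LinearMap.comp_apply, h0]; rfl

lemma twist_invariant {x : H} (hx : x ∈ Q.leftInt) (u : U) (h : H) :
    act2 ρ (Q.Δ h) (Q.twist ρ (x ⊗ₜ u)) = Q.ε h • Q.twist ρ (x ⊗ₜ u) := by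
  rw [twist_tmul, ← Module.End.mul_apply, ← act2_mul, ← map_mul, hx h, map_smul, map_smul]; rfl

lemma qL_twist (x : H) (u : U) :
    act2 ρ Q.qL (Q.twist ρ (x ⊗ₜ u)) = act2 ρ (Q.cElt x) (1 ⊗ₜ u) := by
  rw [twist_tmul, cElt, act2_mul, act2_mul]; rfl

end Rho

instance : IsRep (R := Module.End k (Module.Dual k H)) Q.ldualActL :=
  ⟨by ext; simp [ldualActL, Q.S_one, Module.Dual.transpose_apply], fun x y => by
    ext; simp [ldualActL, Q.S_mul, mul_assoc, Module.Dual.transpose_apply]⟩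

variable [FiniteDimensional k H]

/-- Every element of `H` is expanded through left integrals. -/
lemma exists_expand {n : ℕ} (Λ : Module.Basis (Fin n) k Q.leftInt) :
    ∃ m : Fin n → Module.Dual k H, ∀ z, z = ∑ j, Q.expand (m j) z (Q.cElt (Λ j)) := by
  let e : H ⊗[k] Module.Dual k H ≃ₗ[k] (H →ₗ[k] H) :=
    TensorProduct.comm k _ _ ≪≫ₗ dualTensorHomEquiv k H H
  have he : ∀ x ξ z, e (x ⊗ₜ ξ) z = ξ z • x := fun x ξ z => by simp [e]
  let ρ : Rep k H (Module.End k (Module.Dual k H)) := Q.ldualActL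
  let s := e.symm LinearMap.id
  have h1 : ∀ h t z, e ((ρ h).lTensor H t) z = e t (Q.S h * z) := fun h t z => by
    induction t with
    | zero => simp
    | add s s' hs hs' => simp only [map_add, LinearMap.add_apply, hs, hs']
    | tmul x y => simp [he, ρ, ldualActL, Module.Dual.transpose_apply]
  have h2 : ∀ h t z, e (lft _ (Lm k H) h t) z = h * e t z := fun h t z => by
    induction t with
    | zero => simp
    | add s s' hs hs' => simp only [map_add, LinearMap.add_apply, mul_add, hs, hs']
    | tmul x y => simp [he]
  have hs : ∀ h, (ρ h).lTensor H s = lft _ (Lm k H) (Q.S h) s := fun h => by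
    apply e.injective
    ext z
    rw [h1, h2]
    simp [s]
  obtain ⟨m, hm⟩ := Q.invariant_eq_sum ρ Λ _ (Q.invariant_of_comm ρ s hs)
  refine ⟨m, fun z => ?_⟩
  have h3 := Q.qL_β ρ s hs
  rw [hm, map_sum] at h3
  have h4 := congrArg (fun t => e t z) h3
  simp only [map_sum, LinearMap.sum_apply, s, LinearEquiv.apply_symm_apply, LinearMap.id_apply,
    qL_twist] at h4
  refine h4.symm.trans ?_
  refine Finset.sum_congr rfl fun j _ => ?_
  have h5 : ∀ c, e (act2 ρ c (1 ⊗ₜ m j)) z = Q.expand (m j) z c := fun c => by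
    induction c with
    | zero => simp
    | add s s' hs hs' => simp only [map_add, LinearMap.add_apply, hs, hs']
    | tmul x y => simp [he, ρ, ldualActL, Module.Dual.transpose_apply]
  exact h5 _

omit [FiniteDimensional k H] in
lemma cElt_comm {x : H} (hx : x ∈ Q.leftInt) (h : H) :
    ((1 : H) ⊗ₜ h) * Q.cElt x = (Q.S h ⊗ₜ 1) * Q.cElt x := by
  have := Q.qL_comm_of_invariant (Lm k H) _ (Q.twist_invariant (Lm k H) hx 1) h
  rw [qL_twist, act2_Lm, ← Algebra.TensorProduct.one_def, mul_one] at this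
  have h1 : ∀ t : H ⊗[k] H, (Lm k H h).lTensor H t = ((1 : H) ⊗ₜ h) * t := fun t => by
    induction t with
    | zero => simp
    | add s s' hs hs' => simp only [map_add, mul_add, hs, hs']
    | tmul x y => simp
  have h2 : ∀ t : H ⊗[k] H, lft H (Lm k H) (Q.S h) t = (Q.S h ⊗ₜ 1) * t :=
    fun t => by
      induction t with
      | zero => simp
      | add s s' hs hs' => simp only [map_add, mul_add, hs, hs']
      | tmul x y => simp
  rwa [h1, h2] at this

omit [FiniteDimensional k H] in
/-- If a sum `∑ qᴸ Δ(Λⱼ) pᴿ (1 ⊗ xⱼ)` vanishes, so does every `xⱼ`. -/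
lemma cElt_injective {n : ℕ} (Λ : Module.Basis (Fin n) k Q.leftInt) (x : Fin n → H)
    (hx : ∑ j, Q.cElt (Λ j) * ((1 : H) ⊗ₜ[k] x j) = 0) : x = 0 := by
  have h1 : act2 (Lm k H) Q.qL (∑ j, Q.twist (Lm k H) ((Λ j : H) ⊗ₜ x j)) = 0 := by
    rw [map_sum, ← hx]
    exact Finset.sum_congr rfl fun j _ => by rw [qL_twist, act2_Lm]
  have h2 := Q.qL_of_invariant (Lm k H) (∑ j, Q.twist (Lm k H) ((Λ j : H) ⊗ₜ x j)) fun h => by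
    rw [map_sum, Finset.smul_sum]
    exact Finset.sum_congr rfl fun j _ => Q.twist_invariant _ (Λ j).2 _ _
  rw [h1, map_zero, ← map_sum] at h2
  have h3 := LinearMap.congr_fun (Q.untwist_twist (Lm k H)) (∑ j, (Λ j : H) ⊗ₜ x j)
  rw [LinearMap.comp_apply, ← h2, map_zero, LinearMap.id_apply] at h3
  obtain ⟨π, hπ⟩ := LinearMap.exists_leftInverse_of_injective Q.leftInt.subtype
    (Submodule.ker_subtype _)
  have hπ' : ∀ y : Q.leftInt, π y = y := fun y => LinearMap.congr_fun hπ y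
  ext i
  have h4 := congrArg (evalL (Λ.coord i ∘ₗ π)) h3
  simpa [hπ', Finsupp.single_apply] using h4.symm

include Q in
omit [FiniteDimensional k H] in
lemma nontrivial_of_counit : Nontrivial H :=
  ⟨⟨1, 0, fun h => one_ne_zero (α := k) (by rw [← map_one Q.ε, h, map_zero])⟩⟩

/-- The space of left integrals is spanned by an element `ℓ`, and for some functional `m` the
element `c = qᴸ Δ(ℓ) pᴿ` satisfies `x = c₁ m(S(c₂) x)` and `m(c₁) c₂ = 1`. -/
theorem exists_leftIntegral : ∃ (ℓ : H) (m : Module.Dual k H), (∀ h, h * ℓ = Q.ε h • ℓ) ∧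
    (∀ x, (∀ h, h * x = Q.ε h • x) → ∃ r : k, x = r • ℓ) ∧
    (∀ z, Q.expand m z (Q.cElt ℓ) = z) ∧ evalL m (Q.cElt ℓ) = 1 := by
  have hnt := Q.nontrivial_of_counit
  obtain ⟨n, hn⟩ : ∃ n, n = Module.finrank k Q.leftInt := ⟨_, rfl⟩
  let Λ : Module.Basis (Fin n) k Q.leftInt := Module.finBasisOfFinrankEq k _ hn.symm
  obtain ⟨m, hm⟩ := Q.exists_expand Λ
  have hδ : ∀ i j, evalL (m i) (Q.cElt (Λ j)) = Pi.single (M := fun _ => H) j 1 i := by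
    intro i j
    set s := Q.cElt (Λ j) with hs
    have h1 : s = ∑ i, Q.cElt (Λ i) * ((1 : H) ⊗ₜ[k] evalL (m i) s) := by
      -- compute `c₁ ⊗ m(S(c₂) s₁) s₂` in two ways
      have h2 : ∀ (μ : Module.Dual k H) (T : H ⊗[k] H), T * ((1 : H) ⊗ₜ[k] evalL μ s) =
          (evalL μ ∘ₗ LinearMap.applyₗ s ∘ₗ LinearMap.mul k (H ⊗[k] H) ∘ₗ
            (TensorProduct.mk k H H).flip 1 ∘ₗ Q.S).lTensor H T := fun μ T => by
        induction T with
        | zero => simp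
        | add s s' hs hs' => simp only [add_mul, map_add, hs, hs']
        | tmul x y =>
          simp only [Algebra.TensorProduct.tmul_mul_tmul, mul_one, LinearMap.lTensor_tmul,
            LinearMap.comp_apply, LinearMap.applyₗ_apply_apply, LinearMap.flip_apply,
            TensorProduct.mk_apply, LinearMap.mul_apply']
          rw [hs, ← Q.cElt_comm (Λ j).2, evalL_mul]
      have h4 : ∀ σ : H ⊗[k] H, ∑ i, (evalL (m i) ∘ₗ LinearMap.applyₗ σ ∘ₗ
          LinearMap.mul k (H ⊗[k] H) ∘ₗ (TensorProduct.mk k H H).flip 1 ∘ₗ Q.S).lTensor H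
            (Q.cElt (Λ i)) = σ := fun σ => by
        have h5 : ∀ i (T σ : H ⊗[k] H), (evalL (m i) ∘ₗ LinearMap.applyₗ σ ∘ₗ
          LinearMap.mul k (H ⊗[k] H) ∘ₗ (TensorProduct.mk k H H).flip 1 ∘ₗ Q.S).lTensor H T =
          TensorProduct.lift (LinearMap.mk₂ k (fun x y => Q.expand (m i) x T ⊗ₜ[k] y)
            (fun x x' y => by
              have : Q.expand (m i) (x + x') T = Q.expand (m i) x T + Q.expand (m i) x' T := by
                induction T with
                | zero => simp
                | add s s' hs hs' => simp only [map_add, hs, hs']; abel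
                | tmul x y => simp [mul_add, add_smul]
              rw [this, TensorProduct.add_tmul])
            (fun r x y => by
              have : Q.expand (m i) (r • x) T = r • Q.expand (m i) x T := by
                induction T with
                | zero => simp
                | add s s' hs hs' => simp only [map_add, hs, hs', smul_add]
                | tmul x y => simp [smul_smul]
              rw [this, TensorProduct.smul_tmul'])
            (fun x y y' => by rw [TensorProduct.tmul_add])
            (fun r x y => by rw [TensorProduct.tmul_smul])) σ := fun i T σ => by
          induction σ with
          | zero => simp
          | add s s' hs hs' =>
            refine Eq.trans ?_ (map_add _ _ _).symm
            rw [← hs, ← hs']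
            rw [← LinearMap.add_apply, ← LinearMap.lTensor_add]
            refine congrArg (fun A => LinearMap.lTensor H A T) ?_
            ext y
            simp
          | tmul x y =>
            simp only [TensorProduct.lift.tmul, LinearMap.mk₂_apply]
            induction T with
            | zero => simp
            | add s s' hs hs' => simp only [map_add, hs, hs', TensorProduct.add_tmul]
            | tmul z w => simp [TensorProduct.smul_tmul]
        simp only [h5]
        induction σ with
        | zero => simp
        | add s s' hs hs' => simp only [map_add, Finset.sum_add_distrib, hs, hs']
        | tmul x y =>
          simp only [TensorProduct.lift.tmul, LinearMap.mk₂_apply]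
          rw [← TensorProduct.sum_tmul, ← hm]
      simp only [h2]
      exact (h4 s).symm
    have h5 := Q.cElt_injective Λ (fun i => evalL (m i) s - Pi.single (M := fun _ => H) j 1 i) (by
      simp only [TensorProduct.tmul_sub, mul_sub, Finset.sum_sub_distrib]
      rw [← h1, Finset.sum_eq_single j, Pi.single_eq_same, ← Algebra.TensorProduct.one_def,
        mul_one, sub_self]
      · intro b _ hb
        simp [Pi.single_eq_of_ne hb]
      · simp)
    exact sub_eq_zero.1 (congrFun h5 i)
  -- the map `(xⱼ) ↦ ∑ mⱼ(S(xⱼ) -)` is injective, which bounds the number of integrals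
  let K : (Fin n → H) →ₗ[k] Module.Dual k H :=
    ∑ j, (Module.Dual.transpose (R := k)).flip (m j) ∘ₗ LinearMap.mul k H ∘ₗ Q.S ∘ₗ
      LinearMap.proj j
  have hK : ∀ x y, K x y = ∑ j, m j (Q.S (x j) * y) := fun x y => by
    simp [K, LinearMap.sum_apply, Module.Dual.transpose_apply]
  have hKinj : Function.Injective K := by
    rw [← LinearMap.ker_eq_bot, LinearMap.ker_eq_bot']
    intro x hx
    ext i
    have h1 : ∀ t : H ⊗[k] H, evalL (K x) t = ∑ j, evalL (m j) ((Q.S (x j) ⊗ₜ[k] 1) * t) :=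
      fun t => by
        induction t with
        | zero => simp
        | add s s' hs hs' => simp only [mul_add, map_add, hs, hs', Finset.sum_add_distrib]
        | tmul y z => simp [hK, Finset.sum_smul]
    have h2 := h1 (Q.cElt (Λ i))
    rw [hx] at h2
    simp only [← Q.cElt_comm (Λ i).2, evalL_mul, hδ] at h2
    rw [Finset.sum_eq_single i, Pi.single_eq_same, mul_one] at h2
    · simpa [evalL] using h2.symm
    · intro b _ hb
      simp [Pi.single_eq_of_ne hb]
    · simp
  have hle := LinearMap.finrank_le_finrank_of_injective hKinj
  rw [Subspace.dual_finrank_eq, Module.finrank_pi_fintype] at hle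
  simp only [Finset.sum_const, Finset.card_univ, Fintype.card_fin, smul_eq_mul] at hle
  have hpos : 0 < Module.finrank k H := Module.finrank_pos
  have hn1 : n = 1 := by
    have h1 : n ≤ 1 := by
      by_contra h
      nlinarith
    have h2 : n ≠ 0 := by
      rintro rfl
      have := hm 1
      simp at this
    omega
  subst hn1
  refine ⟨Λ 0, m 0, (Λ 0).2, fun x hx => ?_, fun z => ?_, ?_⟩
  · refine ⟨Λ.repr ⟨x, hx⟩ 0, ?_⟩
    have := congrArg Subtype.val (Λ.sum_repr ⟨x, hx⟩)
    simpa using this.symm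
  · simpa using (hm z).symm
  · simpa using hδ 0 0

/-- The antipode of a finite-dimensional quasi-Hopf algebra is bijective. -/
theorem S_bijective : Function.Bijective Q.S := by
  obtain ⟨ℓ, m, hℓ, -, -, hm⟩ := Q.exists_leftIntegral
  have : Function.Injective Q.S := by
    rw [← LinearMap.ker_eq_bot, LinearMap.ker_eq_bot']
    intro h hh
    have h1 := congrArg (evalL m) (Q.cElt_comm hℓ h)
    rw [evalL_mul, hm, hh, TensorProduct.zero_tmul, zero_mul, map_zero, mul_one] at h1
    exact h1
  exact ⟨this, LinearMap.injective_iff_surjective.1 this⟩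

end Integrals
end
end QuasiHopfAlgebra

namespace QuasiHopfAlgebra

noncomputable section

section Antipodes

variable {k H B : Type*} [Field k] [Ring H] [Algebra k H] [Ring B] [Algebra k B]
  (Q : QuasiHopfAlgebra k H)

/-! ### Antipodes along an algebra map -/

/-- An antipode `(S, α, β)` along an algebra map `π : H → B`; the identities for the associator are
not part of the structure. -/
structure Antipode (π : Rep k H B) where
  /-- the anti-algebra map `H → B` -/
  S : Rep k H B
  /-- the element `α` -/
  α : B
  /-- the element `β` -/
  β : B
  S_one : S 1 = 1
  S_mul : ∀ x y, S (x * y) = S y * S x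
  cap : ∀ h, ev2 S (LinearMap.mulLeft k α ∘ₗ π) (Q.Δ h) = Q.ε h • α
  cup : ∀ h, ev2 (LinearMap.mulRight k β ∘ₗ π) S (Q.Δ h) = Q.ε h • β

namespace Antipode

variable {Q} {π : Rep k H B} [IsRep π]

/-- The element `S'(φ̄₁) α' π(φ̄₂) β S(φ̄₃)` comparing two antipodes along `π`. -/
def gauge (T' T : Q.Antipode π) : B :=
  ev3 T'.S (LinearMap.mulLeft k T'.α ∘ₗ π) (LinearMap.mulLeft k T.β ∘ₗ T.S) Q.phiInv

/-- The element `φ₁ β S(φ₂) α φ₃`. -/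
def zigzag (T : Q.Antipode π) : B :=
  ev3 (LinearMap.mulRight k T.β ∘ₗ π) T.S (LinearMap.mulLeft k T.α ∘ₗ π) Q.phi

/-- Left multiplication through `π`. -/
def lmul (π : Rep k H B) : Rep k H (Module.End k B) := LinearMap.mul k B ∘ₗ π

/-- Right multiplication through `S`. -/
def rmul (T : Q.Antipode π) : Rep k H (Module.End k B) := (LinearMap.mul k B).flip ∘ₗ T.S

omit [IsRep π] in
@[simp] lemma lmul_apply (x : H) (b : B) : lmul π x b = π x * b := rfl

omit [IsRep π] in
@[simp] lemma rmul_apply (T : Q.Antipode π) (x : H) (b : B) : T.rmul x b = b * T.S x := rfl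

instance : IsRep (lmul π) :=
  ⟨by ext; simp [IsRep.one (f := π)], fun x y => by ext; simp [IsRep.mul (f := π), mul_assoc]⟩

omit [IsRep π] in
instance (T : Q.Antipode π) : IsRep T.rmul :=
  ⟨by ext; simp [T.S_one], fun x y => by ext; simp [T.S_mul, mul_assoc]⟩

omit [IsRep π] in
instance (T : Q.Antipode π) : Comm (lmul π) T.rmul := ⟨fun x y => by
  rw [commute_iff_eq]; ext; simp [mul_assoc]⟩

/-- `a ⊗ b ↦ a α b` -/
def contr (α : B) : B ⊗[k] B →ₗ[k] B := LinearMap.mul' k B ∘ₗ (LinearMap.mulLeft k α).lTensor B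

omit [IsRep π] in
@[simp] lemma contr_tmul (α a b : B) : contr (k := k) α (a ⊗ₜ b) = a * (α * b) := rfl

omit [IsRep π] in
lemma contr_LEq (T : Q.Antipode π) (v : B ⊗[k] B) :
    LEq (vecK (contr T.α) v) (Q.conv (lft B T.rmul) (rgt B (lmul π))) (Q.triv _) :=
  LEq.of_vec fun h => by
    refine TensorProduct.ext' fun a b => ?_
    have := vec_ev2 (f := lft B T.rmul) (g := rgt B (lmul π)) (κ := contr T.α) (v := a ⊗ₜ b)
      (G := LinearMap.mulLeft k a ∘ₗ LinearMap.mulRight k b ∘ₗ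
        ev2 T.S (LinearMap.mulLeft k T.α ∘ₗ π)) (fun x y => by simp [mul_assoc]) (Q.Δ h)
    refine this.trans ?_
    simp [T.cap]

omit [IsRep π] in
lemma cup_REq {N M : Type*} [AddCommGroup N] [Module k N] [AddCommGroup M] [Module k M]
    (T : Q.Antipode π) {p d : Rep k H (Module.End k M)}
    {κ : M →ₗ[k] N} {v : M} (A : B →ₗ[k] M) (hA : A T.β = v)
    (h : ∀ x y, p x (d y v) = A (π x * T.β * T.S y)) :
    REq (vecK κ v) (Q.conv p d) (Q.triv _) :=
  REq.of_vec fun h' => by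
    have := vec_ev2 (f := p) (g := d) (κ := LinearMap.id) (v := v)
      (G := A ∘ₗ QuasiHopfAlgebra.ev2 (LinearMap.mulRight k T.β ∘ₗ π) T.S)
      (fun x y => by simp [h]) (Q.Δ h')
    refine this.trans ?_
    simp [T.cup, hA]

lemma gauge_S (T' T : Q.Antipode π) (h : H) : gauge T' T * T.S h = T'.S h * gauge T' T := by
  set e := lft B T'.rmul with he
  set r := rgt B (lmul π) with hr
  set s := rgt B T.rmul with hs
  have h1 := congrArg (vecK (contr T'.α) (1 ⊗ₜ T.β)) (conv_assoc' (Q := Q) e r s h)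
  have h2 : REq (vecK (contr T'.α) (1 ⊗ₜ[k] T.β)) (Q.conv r s) (Q.triv _) :=
    T.cup_REq (TensorProduct.mk k B B 1) rfl (fun x y => by simp [hr, hs, mul_assoc])
  rw [h2.conv_triv_right e h, (T'.contr_LEq _).conv_triv_left s h] at h1
  have h3 : ∀ x : B, contr (k := k) T'.α (Q.phb e r s (x ⊗ₜ T.β)) = x * gauge T' T := fun x =>
    (vec_ev3 (G := LinearMap.mulLeft k x ∘ₗ ev3 T'.S (LinearMap.mulLeft k T'.α ∘ₗ π)
      (LinearMap.mulLeft k T.β ∘ₗ T.S)) (fun x y z => by simp [he, hr, hs, mul_assoc]) Q.phiInv)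
  have h4 : ∀ m, contr (k := k) T'.α (s h m) = contr T'.α m * T.S h := fun m => by
    have : contr (k := k) T'.α ∘ₗ s h = LinearMap.mulRight k (T.S h) ∘ₗ contr T'.α := by
      ext; simp [hs, mul_assoc]
    exact LinearMap.congr_fun this m
  have h5 : e h (1 ⊗ₜ T.β) = T'.S h ⊗ₜ T.β := by simp [he]
  simp only [vecK_apply, Module.End.mul_apply, h4, h5, h3, one_mul] at h1
  exact h1.symm

lemma gauge_α (T' T : Q.Antipode π) (hT : T.zigzag = 1) : gauge T' T * T.α = T'.α := by
  set e := lft (B ⊗[k] B) T'.rmul with he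
  set r := rgt B (lft B (lmul π)) with hr
  set s := rgt B (lft B T.rmul) with hs
  set t := rgt B (rgt B (lmul π)) with ht
  set κ : B ⊗[k] (B ⊗[k] B) →ₗ[k] B := contr T'.α ∘ₗ (contr T.α).lTensor B with hκ
  set v : B ⊗[k] (B ⊗[k] B) := 1 ⊗ₜ (T.β ⊗ₜ 1) with hv
  have h1 := pentagon₃ (Q := Q) e r s t
  have h2 : Q.phb e r s * Q.phb e (Q.conv r s) t =
      Q.phb (Q.conv e r) s t * Q.phb e r (Q.conv s t) * Q.ph r s t := by
    rw [← h1, mul_assoc, phb_mul_ph, mul_one]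
  have hrs : REq (vecK κ v) (Q.conv r s) (Q.triv _) :=
    T.cup_REq (TensorProduct.mk k B _ 1 ∘ₗ (TensorProduct.mk k B B).flip 1) rfl
      (fun x y => by simp [hr, hs, hv, mul_assoc])
  have her : LEq (vecK κ v) (Q.conv e r) (Q.triv _) := LEq.of_vec fun h => by
    ext a b c
    have := vec_ev2 (f := e) (g := r) (κ := κ) (v := a ⊗ₜ (b ⊗ₜ c))
      (G := LinearMap.mulLeft k a ∘ₗ LinearMap.mulRight k (b * (T.α * c)) ∘ₗ
        ev2 T'.S (LinearMap.mulLeft k T'.α ∘ₗ π)) (fun x y => by simp [he, hr, hκ, mul_assoc]) (Q.Δ h)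
    refine this.trans ?_
    simp [T'.cap, hκ, mul_assoc]
  have hst : LEq (vecK κ v) (Q.conv s t) (Q.triv _) := LEq.of_vec fun h => by
    ext a b c
    have := vec_ev2 (f := s) (g := t) (κ := κ) (v := a ⊗ₜ (b ⊗ₜ c))
      (G := LinearMap.mulLeft k (a * (T'.α * b)) ∘ₗ LinearMap.mulRight k c ∘ₗ
        ev2 T.S (LinearMap.mulLeft k T.α ∘ₗ π)) (fun x y => by simp [hs, ht, hκ, mul_assoc]) (Q.Δ h)
    refine this.trans ?_
    simp [T.cap, hκ]
  have h3 : vecK κ v (Q.phb e r s) = gauge T' T * T.α :=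
    vec_ev3 (f := e) (g := r) (l := s) (κ := κ) (v := v)
      (G := LinearMap.mulRight k T.α ∘ₗ ev3 T'.S (LinearMap.mulLeft k T'.α ∘ₗ π)
      (LinearMap.mulLeft k T.β ∘ₗ T.S)) (fun x y z => by simp [he, hr, hs, hv, hκ, mul_assoc]) Q.phiInv
  have h4 : vecK κ v (Q.ph r s t) = T'.α * T.zigzag :=
    vec_ev3 (f := r) (g := s) (l := t) (κ := κ) (v := v)
      (G := LinearMap.mulLeft k T'.α ∘ₗ ev3 (LinearMap.mulRight k T.β ∘ₗ π) T.S
      (LinearMap.mulLeft k T.α ∘ₗ π)) (fun x y z => by simp [hr, hs, ht, hv, hκ, mul_assoc]) Q.phi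
  have h5 := congrArg (vecK κ v) h2
  have h6 := hrs.phb_mid (f := e) (h := t) (Q.phb e r s) 1
  have h7 := her.phb_left (g := s) (h := t) 1 (Q.phb e r (Q.conv s t) * Q.ph r s t)
  have h8 := hst.phb_right (f := e) (g := r) 1 (Q.ph r s t)
  simp only [mul_one, one_mul] at h6 h7 h8
  rw [h6, mul_assoc, h7, h8, h3, h4, hT, mul_one] at h5
  exact h5

lemma β_gauge (T' T : Q.Antipode π) (hT : T.zigzag = 1) : T.β * gauge T T' = T'.β := by
  set p := lft B (lmul π) with hp
  set d := lft B T.rmul with hd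
  set r := rgt B (lmul π) with hr
  set s := rgt B T'.rmul with hs
  set v : B ⊗[k] B := T.β ⊗ₜ T'.β with hv
  have hpd : REq (vecK (contr T.α) v) (Q.conv p d) (Q.triv _) :=
    T.cup_REq ((TensorProduct.mk k B B).flip T'.β) rfl
      (fun x y => by simp [hp, hd, hv, mul_assoc])
  have hrs : REq (vecK (contr T.α) v) (Q.conv r s) (Q.triv _) :=
    T'.cup_REq (TensorProduct.mk k B B T.β) rfl (fun x y => by simp [hr, hs, hv, mul_assoc])
  have h1 := zigzag_word (Q := Q) p d r s hpd (T.contr_LEq v) 1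
  have h2 := hrs.ph_right (f := p) (g := d) (Q.phb d r s) 1
  simp only [mul_one, one_mul] at h1 h2
  rw [h2] at h1
  have h3 : vecK (contr T.α) v (Q.phb d r s) = T.β * gauge T T' :=
    vec_ev3 (f := d) (g := r) (l := s) (κ := contr T.α) (v := v)
      (G := LinearMap.mulLeft k T.β ∘ₗ ev3 T.S (LinearMap.mulLeft k T.α ∘ₗ π)
      (LinearMap.mulLeft k T'.β ∘ₗ T'.S)) (fun x y z => by simp [hd, hr, hs, hv, mul_assoc]) Q.phiInv
  have h4 : vecK (contr T.α) v (Q.ph p d r) = T.zigzag * T'.β :=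
    vec_ev3 (f := p) (g := d) (l := r) (κ := contr T.α) (v := v)
      (G := LinearMap.mulRight k T'.β ∘ₗ ev3 (LinearMap.mulRight k T.β ∘ₗ π) T.S
      (LinearMap.mulLeft k T.α ∘ₗ π)) (fun x y z => by simp [hp, hd, hr, hv, mul_assoc]) Q.phi
  rw [← h3, h1, h4, hT, one_mul]

lemma gauge_mul_gauge (T' T : Q.Antipode π) (hT' : T'.zigzag = 1) (hT : gauge T T = 1) :
    gauge T T' * gauge T' T = 1 := by
  rw [← hT]
  have : ∀ X, gauge T T' * ev3 T'.S (LinearMap.mulLeft k T'.α ∘ₗ π)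
      (LinearMap.mulLeft k T.β ∘ₗ T.S) X = ev3 T.S (LinearMap.mulLeft k T.α ∘ₗ π)
      (LinearMap.mulLeft k T.β ∘ₗ T.S) X := fun X => by
    refine map_ev3 (F := LinearMap.mulLeft k (gauge T T')) (fun x y z => ?_) X
    simp only [LinearMap.mulLeft_apply, LinearMap.comp_apply, ev3_tmul, ev2_tmul]
    rw [← mul_assoc, gauge_S, ← gauge_α T T' hT']
    simp only [mul_assoc]
  exact this _

end Antipode

end Antipodes
end
end QuasiHopfAlgebra

namespace QuasiHopfAlgebra

noncomputable section

section Drinfeld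

variable {k H : Type*} [Field k] [Ring H] [Algebra k H] (Q : QuasiHopfAlgebra k H)

/-! ### Drinfeld's gauge transformation -/

/-- The comultiplication as a representation in `H ⊗ H`. -/
def Δrep : Rep k H (H ⊗[k] H) := Q.Δ.toLinearMap

@[simp] lemma Δrep_apply (x : H) : Q.Δrep x = Q.Δ x := rfl

instance : IsRep Q.Δrep := ⟨by simp, by simp⟩

@[simp] lemma SSflip_tmul (x y : H) : Q.SSflip (x ⊗ₜ y) = Q.S y ⊗ₜ Q.S x := rfl

lemma SSflip_mul (s t : H ⊗[k] H) : Q.SSflip (s * t) = Q.SSflip t * Q.SSflip s := by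
  induction s with
  | zero => simp
  | add s s' hs hs' => simp only [add_mul, mul_add, map_add, hs, hs']
  | tmul x y =>
    induction t with
    | zero => simp
    | add s s' hs hs' => simp only [add_mul, mul_add, map_add, hs, hs']
    | tmul z w => simp [Q.S_mul]

lemma SSflip_one : Q.SSflip 1 = 1 := by
  rw [Algebra.TensorProduct.one_def, SSflip_tmul, Q.S_one]

/-- The antipode along `Δ` obtained by applying `Δ` to the antipode of `H`. -/
def antipodeΔ : Q.Antipode Q.Δrep where
  S := Q.Δ.toLinearMap ∘ₗ Q.S
  α := Q.Δ Q.α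
  β := Q.Δ Q.β
  S_one := by simp [Q.S_one]
  S_mul x y := by simp [Q.S_mul]
  cap h := by
    rw [← map_smul, ← Q.S_α]
    exact (map_ev2 (F := Q.Δ.toLinearMap) (G := ev2 (R := H ⊗[k] H) _ _)
      (fun x y => by simp) (Q.Δ h)).symm
  cup h := by
    rw [← map_smul, ← Q.S_β]
    exact (map_ev2 (F := Q.Δ.toLinearMap) (G := ev2 (R := H ⊗[k] H) _ _)
      (fun x y => by simp) (Q.Δ h)).symm

lemma antipodeΔ_gauge : Antipode.gauge Q.antipodeΔ Q.antipodeΔ = 1 := by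
  have h1 := congrArg Q.Δ Q.antipode_φ_inv
  rw [map_one] at h1
  refine Eq.trans ?_ h1
  exact (map_ev3 (R := H) (f := Q.S) (g := LinearMap.mulLeft k Q.α) (l := LinearMap.mulLeft k Q.β ∘ₗ Q.S)
    (F := Q.Δ.toLinearMap)
    (G := ev3 (R := H ⊗[k] H) Q.antipodeΔ.S (LinearMap.mulLeft k Q.antipodeΔ.α ∘ₗ Q.Δrep)
      (LinearMap.mulLeft k Q.antipodeΔ.β ∘ₗ Q.antipodeΔ.S))
      (fun x y z => by simp [antipodeΔ]) Q.phiInv).symm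

section Words

/-- Left multiplication on the first factor, for `H ⊗ H`. -/
abbrev l1 : Rep k H (Module.End k (H ⊗[k] H)) := lft H (Lm k H)
/-- Left multiplication on the second factor, for `H ⊗ H`. -/
abbrev l2 : Rep k H (Module.End k (H ⊗[k] H)) := rgt H (Lm k H)
/-- Right multiplication through the antipode on the first factor, for `H ⊗ H`. -/
abbrev r1 : Rep k H (Module.End k (H ⊗[k] H)) := lft H Q.RS
/-- Right multiplication through the antipode on the second factor, for `H ⊗ H`. -/
abbrev r2 : Rep k H (Module.End k (H ⊗[k] H)) := rgt H Q.RS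

/-- `(x ⊗ y) ⊗ (z ⊗ w) ↦ x α z ⊗ y α w` -/
def contr22 : (H ⊗[k] H) ⊗[k] (H ⊗[k] H) →ₗ[k] H ⊗[k] H :=
  TensorProduct.map (LinearMap.mul' k H ∘ₗ (LinearMap.mulLeft k Q.α).lTensor H)
    (LinearMap.mul' k H ∘ₗ (LinearMap.mulLeft k Q.α).lTensor H) ∘ₗ
  (TensorProduct.tensorTensorTensorComm k H H H H).toLinearMap

@[simp] lemma contr22_tmul (x y z w : H) : Q.contr22 ((x ⊗ₜ y) ⊗ₜ (z ⊗ₜ w)) =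
    (x * (Q.α * z)) ⊗ₜ (y * (Q.α * w)) := rfl

lemma IsCap.of₂₂ {A B C D N : Type*} [AddCommGroup A] [Module k A] [AddCommGroup B] [Module k B]
    [AddCommGroup C] [Module k C] [AddCommGroup D] [Module k D] [AddCommGroup N] [Module k N]
    {Q : QuasiHopfAlgebra k H} {κ : (A ⊗[k] B) ⊗[k] (C ⊗[k] D) →ₗ[k] N}
    {d r : Rep k H (Module.End k ((A ⊗[k] B) ⊗[k] (C ⊗[k] D)))}
    (h : ∀ a b c e, IsCap Q κ d r ((a ⊗ₜ b) ⊗ₜ (c ⊗ₜ e))) : ∀ m, IsCap Q κ d r m := by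
  refine IsCap.of₂ fun m m' => ?_
  induction m with
  | zero => simp only [TensorProduct.zero_tmul]; exact IsCap.zero
  | add x y hx hy => simp only [TensorProduct.add_tmul]; exact hx.add hy
  | tmul a b =>
    induction m' with
    | zero => simp only [TensorProduct.tmul_zero]; exact IsCap.zero
    | tmul c e => exact h a b c e
    | add x y hx hy => simp only [TensorProduct.tmul_add]; exact hx.add hy

local notation "HH" => H ⊗[k] H

/-- Left multiplication on the first factor of `(H ⊗ H) ⊗ (H ⊗ H)`. -/
abbrev v₁ : Rep k H (Module.End k (HH ⊗[k] HH)) := lft HH l1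

/-- Left multiplication on the second factor of `(H ⊗ H) ⊗ (H ⊗ H)`. -/
abbrev w₁ : Rep k H (Module.End k (HH ⊗[k] HH)) := lft HH l2

/-- Right multiplication through `S` on the first factor of `(H ⊗ H) ⊗ (H ⊗ H)`. -/
abbrev v₂ : Rep k H (Module.End k (HH ⊗[k] HH)) := lft HH Q.r1

/-- Right multiplication through `S` on the second factor of `(H ⊗ H) ⊗ (H ⊗ H)`. -/
abbrev w₂ : Rep k H (Module.End k (HH ⊗[k] HH)) := lft HH Q.r2

/-- Left multiplication on the third factor of `(H ⊗ H) ⊗ (H ⊗ H)`. -/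
abbrev v₃ : Rep k H (Module.End k (HH ⊗[k] HH)) := rgt HH l1

/-- Left multiplication on the fourth factor of `(H ⊗ H) ⊗ (H ⊗ H)`. -/
abbrev w₃ : Rep k H (Module.End k (HH ⊗[k] HH)) := rgt HH l2

/-- The word whose contraction is multiplication by `a`. -/
abbrev aWord : Module.End k (HH ⊗[k] HH) :=
  Q.phb Q.v₂ v₃ w₃ * Q.ph Q.w₂ Q.v₂ (Q.conv v₃ w₃)

/-- The word creating `b`. -/
abbrev bWord : Module.End k (HH ⊗[k] HH) :=
  Q.ph (Q.conv v₁ w₁) Q.w₂ Q.v₂ * Q.phb v₁ w₁ Q.w₂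

lemma cap_v (v : HH ⊗[k] HH) : LEq (vecK Q.contr22 v) (Q.conv Q.v₂ v₃) (Q.triv _) :=
  LEq.of_isCap (IsCap.of₂₂ fun a b c e => ⟨(TensorProduct.mk k H H).flip (b * (Q.α * e)) ∘ₗ
    LinearMap.mulLeft k a ∘ₗ LinearMap.mulRight k c, fun x y => by simp [mul_assoc]⟩) v

lemma cap_w (v : HH ⊗[k] HH) : LEq (vecK Q.contr22 v) (Q.conv Q.w₂ w₃) (Q.triv _) :=
  LEq.of_isCap (IsCap.of₂₂ fun a b c e => ⟨TensorProduct.mk k H H (a * (Q.α * c)) ∘ₗ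
    LinearMap.mulLeft k b ∘ₗ LinearMap.mulRight k e, fun x y => by simp [mul_assoc]⟩) v

lemma cup_v (t : HH) {N : Type*} [AddCommGroup N] [Module k N] (κ : HH ⊗[k] HH →ₗ[k] N) :
    REq (vecK κ ((Q.β ⊗ₜ Q.β) ⊗ₜ t)) (Q.conv v₁ Q.v₂) (Q.triv _) :=
  REq.of_cup ((TensorProduct.mk k HH HH).flip t ∘ₗ (TensorProduct.mk k H H).flip Q.β)
    (fun x y => by simp [mul_assoc])

lemma cup_w (t : HH) {N : Type*} [AddCommGroup N] [Module k N] (κ : HH ⊗[k] HH →ₗ[k] N) :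
    REq (vecK κ ((Q.β ⊗ₜ Q.β) ⊗ₜ t)) (Q.conv w₁ Q.w₂) (Q.triv _) :=
  REq.of_cup ((TensorProduct.mk k HH HH).flip t ∘ₗ TensorProduct.mk k H H Q.β)
    (fun x y => by simp [mul_assoc])

lemma vec_ev4 {M N : Type*} [AddCommGroup M] [Module k M] [AddCommGroup N] [Module k N]
    {f g h l : Rep k H (Module.End k M)} {κ : M →ₗ[k] N} {v : M}
    {G : H ⊗[k] (H ⊗[k] (H ⊗[k] H)) →ₗ[k] N}
    (hG : ∀ x y z w, κ (f x (g y (h z (l w v)))) = G (x ⊗ₜ (y ⊗ₜ (z ⊗ₜ w))))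
    (t : H ⊗[k] (H ⊗[k] (H ⊗[k] H))) : κ (ev4 f g h l t v) = G t := by
  have : vecK κ v ∘ₗ ev4 f g h l = G := by ext x y z w; simp [hG]
  exact LinearMap.congr_fun this t

lemma aWord_apply (s t : HH) : Q.contr22 (Q.aWord (s ⊗ₜ t)) = s * Q.aElt * t := by
  have h0 : Q.aWord = ev4 Q.w₂ Q.v₂ v₃ w₃ (((1 : H) ⊗ₜ[k] Q.phiInv) * Q.Δ₃ Q.phi) := by
    rw [ev4_mul, ev4_one_tmul, ev4_Δ₃]; rfl
  rw [h0]
  induction s with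
  | zero => simp
  | add s s' hs hs' => simp only [TensorProduct.add_tmul, map_add, add_mul, hs, hs']
  | tmul x y =>
    induction t with
    | zero => simp
    | add s s' hs hs' => simp only [TensorProduct.tmul_add, map_add, mul_add, hs, hs']
    | tmul z w =>
      refine vec_ev4 (G := LinearMap.mulRight k (z ⊗ₜ[k] w) ∘ₗ LinearMap.mulLeft k (x ⊗ₜ[k] y) ∘ₗ
        TensorProduct.map Q.mulSα Q.mulSα ∘ₗ perm2314) (fun a b c d => ?_) _
      simp [perm2314, mulSα, mul_assoc]

lemma bWord_apply (t : HH) : Q.bWord ((Q.β ⊗ₜ Q.β) ⊗ₜ t) = Q.bElt ⊗ₜ t := by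
  have h0 : Q.bWord = ev4 v₁ w₁ Q.w₂ Q.v₂ (Q.Δ₁ Q.phi * tensorOne Q.phiInv) := by
    rw [ev4_mul, ev4_tensorOne, ev4_Δ₁]; rfl
  rw [h0]
  refine vec_ev4 (κ := LinearMap.id) (G := (TensorProduct.mk k HH HH).flip t ∘ₗ
    TensorProduct.map Q.mulβS Q.mulβS ∘ₗ perm1423) (fun a b c d => ?_) _
  simp [perm1423, mulβS, mul_assoc]

lemma conv_v₁w₁ (x : H) (s t : HH) : Q.conv v₁ w₁ x (s ⊗ₜ t) = (Q.Δ x * s) ⊗ₜ t := by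
  induction s with
  | zero => simp
  | add s s' hs hs' => simp only [TensorProduct.add_tmul, map_add, mul_add, hs, hs']
  | tmul a b =>
    refine vec_ev2 (κ := LinearMap.id) (G := (TensorProduct.mk k HH HH).flip t ∘ₗ
      LinearMap.mulRight k (a ⊗ₜ b)) (fun y z => ?_) _
    simp

lemma conv_v₃w₃ (x : H) (s t : HH) : Q.conv v₃ w₃ x (t ⊗ₜ s) = t ⊗ₜ (Q.Δ x * s) := by
  induction s with
  | zero => simp
  | add s s' hs hs' => simp only [TensorProduct.tmul_add, map_add, mul_add, hs, hs']
  | tmul a b =>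
    refine vec_ev2 (κ := LinearMap.id) (G := TensorProduct.mk k HH HH t ∘ₗ
      LinearMap.mulRight k (a ⊗ₜ b)) (fun y z => ?_) _
    simp

lemma conv_w₂v₂ (x : H) (s t : HH) :
    Q.conv Q.w₂ Q.v₂ x (s ⊗ₜ t) = (s * Q.SSflip (Q.Δ x)) ⊗ₜ t := by
  induction s with
  | zero => simp
  | add s s' hs hs' => simp only [TensorProduct.add_tmul, map_add, add_mul, hs, hs']
  | tmul a b =>
    refine vec_ev2 (κ := LinearMap.id) (G := (TensorProduct.mk k HH HH).flip t ∘ₗ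
      LinearMap.mulLeft k (a ⊗ₜ b) ∘ₗ Q.SSflip) (fun y z => ?_) _
    simp

/-- Nested caps: the antipode axiom for `a`. -/
lemma aWord_cap (h : H) (v : HH ⊗[k] HH) :
    Q.contr22 (Q.aWord (Q.conv (Q.conv Q.w₂ Q.v₂) (Q.conv v₃ w₃) h v)) =
      Q.ε h • Q.contr22 (Q.aWord v) := by
  have h1 : Q.aWord * Q.conv (Q.conv Q.w₂ Q.v₂) (Q.conv v₃ w₃) h =
      Q.conv Q.w₂ (Q.conv (Q.conv Q.v₂ v₃) w₃) h * Q.aWord := by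
    have i1 : Inter (Q.phb Q.v₂ v₃ w₃) (Q.conv Q.w₂ (Q.conv Q.v₂ (Q.conv v₃ w₃)))
      (Q.conv Q.w₂ (Q.conv (Q.conv Q.v₂ v₃) w₃)) := inferInstance
    rw [aWord, mul_assoc, (Inter.ph (Q := Q) (a := Q.w₂) (b := Q.v₂) (c := Q.conv v₃ w₃)).eq,
      ← mul_assoc, i1.eq, mul_assoc]
  have h2 : LEq (vecK Q.contr22 v) (Q.conv Q.w₂ (Q.conv (Q.conv Q.v₂ v₃) w₃)) (Q.triv _) :=
    (LEq.conv (LEq.refl _ _) ((Q.cap_v v).conv_triv_left w₃)).trans (Q.cap_w v)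
  have h3 := h2 h Q.aWord
  rw [← h1] at h3
  simpa [triv_apply] using h3

/-- Nested cups: the antipode axiom for `b`. -/
lemma bWord_cup (h : H) (t : HH) :
    Q.conv (Q.conv v₁ w₁) (Q.conv Q.w₂ Q.v₂) h (Q.bWord ((Q.β ⊗ₜ Q.β) ⊗ₜ t)) =
      Q.ε h • Q.bWord ((Q.β ⊗ₜ Q.β) ⊗ₜ t) := by
  have h1 : Q.conv (Q.conv v₁ w₁) (Q.conv Q.w₂ Q.v₂) h * Q.bWord =
      Q.bWord * Q.conv (Q.conv v₁ (Q.conv w₁ Q.w₂)) Q.v₂ h := by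
    have i1 : Inter (Q.phb v₁ w₁ Q.w₂) (Q.conv (Q.conv v₁ (Q.conv w₁ Q.w₂)) Q.v₂)
      (Q.conv (Q.conv (Q.conv v₁ w₁) Q.w₂) Q.v₂) := inferInstance
    rw [bWord, ← mul_assoc, ← (Inter.ph (Q := Q) (a := Q.conv v₁ w₁) (b := Q.w₂) (c := Q.v₂)).eq,
      mul_assoc, ← i1.eq, mul_assoc]
  have h2 : REq (vecK LinearMap.id ((Q.β ⊗ₜ Q.β) ⊗ₜ t)) (Q.conv (Q.conv v₁ (Q.conv w₁ Q.w₂)) Q.v₂)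
      (Q.triv _) :=
    (REq.conv ((Q.cup_w t _).conv_triv_right v₁) (REq.refl _ _)).trans (Q.cup_v t _)
  have h3 := h2 h Q.bWord
  rw [← h1] at h3
  simpa [triv_apply] using h3

/-- The antipode along `Δ` obtained from the antipode on `H ⊗ H` with reversed factors. -/
def antipodeFlip : Q.Antipode Q.Δrep where
  S := Q.SSflip ∘ₗ Q.Δ.toLinearMap
  α := Q.aElt
  β := Q.bElt
  S_one := by simp [SSflip_one]
  S_mul x y := by simp [SSflip_mul]
  cap h := by
    have h1 := Q.aWord_cap h (1 ⊗ₜ 1)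
    rw [aWord_apply, one_mul, mul_one] at h1
    rw [← h1]
    refine (vec_ev2 (κ := Q.contr22 ∘ₗ Q.aWord) (G := ev2 (R := HH) _ _) (fun x y => ?_)
      (Q.Δ h)).symm
    rw [conv_v₃w₃, conv_w₂v₂, LinearMap.comp_apply, aWord_apply]
    simp [mul_assoc]
  cup h := by
    have h1 := congrArg (TensorProduct.lift ((LinearMap.mul k HH))) (Q.bWord_cup h 1)
    rw [map_smul, bWord_apply, TensorProduct.lift.tmul, LinearMap.mul_apply', mul_one] at h1
    rw [← h1]
    refine (vec_ev2 (κ := TensorProduct.lift ((LinearMap.mul k HH))) (G := ev2 (R := HH) _ _)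
      (fun x y => ?_) (Q.Δ h)).symm
    rw [conv_w₂v₂, conv_v₁w₁]
    simp [mul_assoc]

lemma antipodeFlip_zigzag : Q.antipodeFlip.zigzag = 1 := by
  set v : HH ⊗[k] HH := (Q.β ⊗ₜ Q.β) ⊗ₜ 1 with hv
  set K := vecK Q.contr22 v with hK
  have h1 : K (Q.aWord * Q.ph (Q.conv v₁ w₁) (Q.conv Q.w₂ Q.v₂) (Q.conv v₃ w₃) * Q.bWord) =
      Q.antipodeFlip.zigzag := by
    refine vec_ev3 (κ := Q.contr22 ∘ₗ Q.aWord) (v := Q.bWord v) (G := ev3 (R := HH) _ _ _)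
      (fun x y z => ?_) Q.phi
    rw [hv, bWord_apply, conv_v₃w₃, conv_w₂v₂, conv_v₁w₁, LinearMap.comp_apply, aWord_apply]
    simp [mul_assoc, antipodeFlip]
  rw [← h1]
  have h2 : Q.aWord * Q.ph (Q.conv v₁ w₁) (Q.conv Q.w₂ Q.v₂) (Q.conv v₃ w₃) * Q.bWord =
      Q.ph (Q.conv v₁ w₁) Q.w₂ (Q.conv (Q.conv Q.v₂ v₃) w₃) * (Q.phb Q.v₂ v₃ w₃ * Q.phb v₁ w₁ Q.w₂) *
        Q.ph (Q.conv v₁ (Q.conv w₁ Q.w₂)) Q.v₂ (Q.conv v₃ w₃) := by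
    have h3 := pentagon' (Q := Q) (Q.conv v₁ w₁) Q.w₂ Q.v₂ (Q.conv v₃ w₃)
    have h4 := ph_nat (Q := Q) (Q.phb Q.v₂ v₃ w₃) (f := Q.conv v₁ w₁) (f' := Q.conv v₁ w₁)
      (g := Q.w₂) (g' := Q.w₂) (h := Q.conv Q.v₂ (Q.conv v₃ w₃)) (h' := Q.conv (Q.conv Q.v₂ v₃) w₃)
    have h5 := ph_nat (Q := Q) (Q.phb v₁ w₁ Q.w₂) (f := Q.conv v₁ (Q.conv w₁ Q.w₂))
      (f' := Q.conv (Q.conv v₁ w₁) Q.w₂)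
      (g := Q.v₂) (g' := Q.v₂) (h := Q.conv v₃ w₃) (h' := Q.conv v₃ w₃)
    calc _ = Q.phb Q.v₂ v₃ w₃ * (Q.ph Q.w₂ Q.v₂ (Q.conv v₃ w₃) *
          Q.ph (Q.conv v₁ w₁) (Q.conv Q.w₂ Q.v₂) (Q.conv v₃ w₃) * Q.ph (Q.conv v₁ w₁) Q.w₂ Q.v₂) *
          Q.phb v₁ w₁ Q.w₂ := by simp only [mul_assoc]
      _ = (Q.phb Q.v₂ v₃ w₃ * Q.ph (Q.conv v₁ w₁) Q.w₂ (Q.conv Q.v₂ (Q.conv v₃ w₃))) *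
          (Q.ph (Q.conv (Q.conv v₁ w₁) Q.w₂) Q.v₂ (Q.conv v₃ w₃) * Q.phb v₁ w₁ Q.w₂) := by
        rw [← h3]; simp only [mul_assoc]
      _ = _ := by rw [h4, ← h5]; simp only [mul_assoc]
  have hcv := Q.cap_v v
  have hcw := Q.cap_w v
  have huv := Q.cup_v 1 Q.contr22
  have huw := Q.cup_w 1 Q.contr22
  rw [h2]
  have h6 := REq.ph (Q := Q) ((Q.cup_w 1 Q.contr22).conv_triv_right v₁) (REq.refl _ Q.v₂)
    (REq.refl _ (Q.conv v₃ w₃)) (Q.ph (Q.conv v₁ w₁) Q.w₂ (Q.conv (Q.conv Q.v₂ v₃) w₃) *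
      (Q.phb Q.v₂ v₃ w₃ * Q.phb v₁ w₁ Q.w₂))
  rw [← hv, ← hK] at h6
  rw [h6]
  have h7 := LEq.ph (Q := Q) (LEq.refl _ (Q.conv v₁ w₁)) (LEq.refl _ Q.w₂)
    (hcv.conv_triv_left w₃) (Q.phb Q.v₂ v₃ w₃ * Q.phb v₁ w₁ Q.w₂ * Q.ph v₁ Q.v₂ (Q.conv v₃ w₃))
  rw [← hK, ← mul_assoc] at h7
  rw [h7]
  have h8 : Q.phb Q.v₂ v₃ w₃ * Q.phb v₁ w₁ Q.w₂ = Q.phb v₁ w₁ Q.w₂ * Q.phb Q.v₂ v₃ w₃ :=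
    phb_nat (Q := Q) (Q.phb Q.v₂ v₃ w₃)
  rw [h8]
  have h9 := pentagon₅ (Q := Q) v₁ w₁ Q.w₂ w₃
  have h10 := hcw.phb_right (f := v₁) (g := w₁) 1 (Q.ph w₁ Q.w₂ w₃ *
    (Q.ph v₁ (Q.conv w₁ Q.w₂) w₃ * (Q.phb Q.v₂ v₃ w₃ * Q.ph v₁ Q.v₂ (Q.conv v₃ w₃))))
  have h11 := huw.ph_mid (f := v₁) (h := w₃) (Q.ph w₁ Q.w₂ w₃)
    (Q.phb Q.v₂ v₃ w₃ * Q.ph v₁ Q.v₂ (Q.conv v₃ w₃))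
  have h12 := zigzag_word (Q := Q) v₁ Q.v₂ v₃ w₃ huv hcv (Q.ph w₁ Q.w₂ w₃)
  rw [← hv, ← hK] at h11 h12
  rw [← hK] at h10
  calc _ = K (Q.ph (Q.conv v₁ w₁) Q.w₂ w₃ * Q.phb v₁ w₁ Q.w₂ *
      (Q.phb Q.v₂ v₃ w₃ * Q.ph v₁ Q.v₂ (Q.conv v₃ w₃))) := by simp only [mul_assoc]
    _ = K (1 * Q.phb v₁ w₁ (Q.conv Q.w₂ w₃) * (Q.ph w₁ Q.w₂ w₃ *
        (Q.ph v₁ (Q.conv w₁ Q.w₂) w₃ * (Q.phb Q.v₂ v₃ w₃ * Q.ph v₁ Q.v₂ (Q.conv v₃ w₃))))) := by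
      rw [h9]; simp only [mul_assoc, one_mul]
    _ = K (Q.ph w₁ Q.w₂ w₃ * Q.ph v₁ (Q.conv w₁ Q.w₂) w₃ *
        (Q.phb Q.v₂ v₃ w₃ * Q.ph v₁ Q.v₂ (Q.conv v₃ w₃))) := by
      rw [h10]; simp only [mul_assoc, one_mul]
    _ = K (Q.ph w₁ Q.w₂ w₃ * Q.ph v₁ Q.v₂ v₃) := by rw [h11, h12]
    _ = 1 := by
      have hz := Q.antipode_φ
      have e1 : ∀ a c : H, Q.contr22 (Q.ph w₁ Q.w₂ w₃ ((a ⊗ₜ Q.β) ⊗ₜ (c ⊗ₜ 1))) =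
          (a * (Q.α * c)) ⊗ₜ 1 := fun a c => by
        refine Eq.trans (vec_ev3 (G := TensorProduct.mk k H H (a * (Q.α * c)) ∘ₗ LinearMap.mul' k H ∘ₗ
          (TensorProduct.map (LinearMap.mulRight k Q.β)
            (LinearMap.mul' k H ∘ₗ TensorProduct.map Q.S (LinearMap.mulLeft k Q.α))))
            (fun x y z => ?_) Q.phi) (congrArg (TensorProduct.mk k H H (a * (Q.α * c))) hz)
        simp [mul_assoc]
      rw [Algebra.TensorProduct.one_def]
      refine Eq.trans (vec_ev3 (κ := Q.contr22 ∘ₗ Q.ph w₁ Q.w₂ w₃) (v := v)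
        (G := (TensorProduct.mk k H H).flip 1 ∘ₗ LinearMap.mul' k H ∘ₗ
          (TensorProduct.map (LinearMap.mulRight k Q.β)
            (LinearMap.mul' k H ∘ₗ TensorProduct.map Q.S (LinearMap.mulLeft k Q.α))))
            (fun x y z => ?_) Q.phi) (congrArg ((TensorProduct.mk k H H).flip 1) hz)
      have e2 : v₁ x (Q.v₂ y (v₃ z v)) = ((x * (Q.β * Q.S y)) ⊗ₜ Q.β) ⊗ₜ (z ⊗ₜ[k] 1) := by
        simp [hv, Algebra.TensorProduct.one_def]
      rw [e2, LinearMap.comp_apply, e1]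
      simp [mul_assoc]

lemma f_eq_gauge : Q.f = Antipode.gauge Q.antipodeFlip Q.antipodeΔ := by
  refine LinearMap.congr_fun (f := LinearMap.mul' k (H ⊗[k] H) ∘ₗ
    (TensorProduct.map
      (LinearMap.mulRight k Q.aElt ∘ₗ Q.SSflip ∘ₗ Q.Δ.toLinearMap) Q.Δ.toLinearMap) ∘ₗ
      Q.mulβS.lTensor H) (g := ev3 (R := H ⊗[k] H) _ _ _) ?_ Q.phiInv
  ext x y z
  simp [antipodeFlip, antipodeΔ, mulβS, mul_assoc]

lemma fInv_eq_gauge : Q.fInv = Antipode.gauge Q.antipodeΔ Q.antipodeFlip := by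
  refine LinearMap.congr_fun (f := LinearMap.mul' k (H ⊗[k] H) ∘ₗ
    (TensorProduct.map
      (LinearMap.mulRight k Q.bElt ∘ₗ Q.Δ.toLinearMap) (Q.SSflip ∘ₗ Q.Δ.toLinearMap)) ∘ₗ
      Q.mulSα.rTensor H ∘ₗ (TensorProduct.assoc k H H H).symm.toLinearMap)
      (g := ev3 (R := H ⊗[k] H) _ _ _) ?_ Q.phiInv
  ext x y z
  simp [antipodeFlip, antipodeΔ, mulSα, mul_assoc]

lemma f_Δ_S (h : H) : Q.f * Q.Δ (Q.S h) = Q.SSflip (Q.Δ h) * Q.f := by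
  rw [f_eq_gauge]; exact Antipode.gauge_S _ _ h

lemma fInv_SS_Δ (h : H) : Q.fInv * Q.SSflip (Q.Δ h) = Q.Δ (Q.S h) * Q.fInv := by
  rw [fInv_eq_gauge]; exact Antipode.gauge_S Q.antipodeΔ Q.antipodeFlip h

lemma fInv_mul_f : Q.fInv * Q.f = 1 := by
  rw [f_eq_gauge, fInv_eq_gauge]
  exact Antipode.gauge_mul_gauge _ _ Q.antipodeFlip_zigzag Q.antipodeΔ_gauge

lemma antipodeΔ_zigzag : Q.antipodeΔ.zigzag = 1 := by
  have h1 := congrArg Q.Δ Q.antipode_φ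
  rw [map_one] at h1
  refine Eq.trans ?_ h1
  exact (map_ev3 (R := H) (f := LinearMap.mulRight k Q.β) (g := Q.S) (l := LinearMap.mulLeft k Q.α)
    (F := Q.Δ.toLinearMap)
    (G := ev3 (R := H ⊗[k] H) (LinearMap.mulRight k Q.antipodeΔ.β ∘ₗ Q.Δrep) Q.antipodeΔ.S
      (LinearMap.mulLeft k Q.antipodeΔ.α ∘ₗ Q.Δrep)) (fun x y z => by simp [antipodeΔ]) Q.phi).symm

lemma f_Δ_α : Q.f * Q.Δ Q.α = Q.aElt := by
  rw [f_eq_gauge]; exact Antipode.gauge_α Q.antipodeFlip Q.antipodeΔ Q.antipodeΔ_zigzag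

lemma Δ_β_fInv : Q.Δ Q.β * Q.fInv = Q.bElt := by
  rw [fInv_eq_gauge]; exact Antipode.β_gauge Q.antipodeFlip Q.antipodeΔ Q.antipodeΔ_zigzag

lemma f_mul_fInv [FiniteDimensional k H] : Q.f * Q.fInv = 1 := by
  have h1 : LinearMap.mulLeft k Q.fInv * LinearMap.mulLeft k Q.f = 1 := by
    ext x; simp [← mul_assoc, Q.fInv_mul_f]
  have h2 := LinearMap.congr_fun (mul_eq_one_comm.1 h1) 1
  simpa using h2

end Words
end Drinfeld
end
end QuasiHopfAlgebra

namespace QuasiHopfAlgebra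

noncomputable section

section Sinv

variable {k H : Type*} [Field k] [Ring H] [Algebra k H] [FiniteDimensional k H]
  (Q : QuasiHopfAlgebra k H)

/-! ### The inverse antipode -/

lemma S_isUnit : IsUnit (Q.S : Module.End k H) :=
  (Module.End.isUnit_iff _).2 Q.S_bijective

@[simp] lemma S_Sinv (x : H) : Q.S (Q.Sinv x) = x :=
  LinearMap.congr_fun (Ring.mul_inverse_cancel _ Q.S_isUnit) x

@[simp] lemma Sinv_S (x : H) : Q.Sinv (Q.S x) = x :=
  LinearMap.congr_fun (Ring.inverse_mul_cancel _ Q.S_isUnit) x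

lemma Sinv_mul (x y : H) : Q.Sinv (x * y) = Q.Sinv y * Q.Sinv x :=
  Q.S_bijective.1 (by simp [Q.S_mul])

lemma Sinv_one : Q.Sinv 1 = 1 := Q.S_bijective.1 (by simp [Q.S_one])

lemma ε_Sinv (x : H) : Q.ε (Q.Sinv x) = Q.ε x := by
  rw [← Q.ε_S, S_Sinv]

omit [FiniteDimensional k H] in
@[simp] lemma SinvSinvflip_tmul (x y : H) :
    Q.SinvSinvflip (x ⊗ₜ y) = Q.Sinv y ⊗ₜ Q.Sinv x := rfl

@[simp] lemma SSflip_SinvSinvflip (t : H ⊗[k] H) : Q.SSflip (Q.SinvSinvflip t) = t := by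
  induction t with
  | zero => simp
  | add s s' hs hs' => simp only [map_add, hs, hs']
  | tmul x y => simp

lemma SSflip_injective : Function.Injective Q.SSflip := by
  have : Function.LeftInverse Q.SinvSinvflip Q.SSflip := fun t => by
    induction t with
    | zero => simp
    | add s s' hs hs' => simp only [map_add, hs, hs']
    | tmul x y => simp
  exact this.injective

lemma Δ_Sinv (h : H) : Q.fInv * Q.SSflip (Q.Δ (Q.Sinv h)) = Q.Δ h * Q.fInv := by
  rw [fInv_SS_Δ, S_Sinv]

/-! ### Identities for `qᴿ, pᴸ, qᴸ` -/

omit [FiniteDimensional k H] in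
lemma contrSα_Lm_ev3 (T : H ⊗[k] (H ⊗[k] H)) (t : H ⊗[k] (H ⊗[k] H)) :
    Q.contrSα (Lm k H) (ev3 (lft (H ⊗[k] H) (Lm k H)) (rgt H (lft H (Lm k H)))
      (rgt H (rgt H (Lm k H))) T t) = Q.contrSα (Lm k H) (T * t) := by
  congr 1
  induction t with
  | zero => simp
  | add s s' hs hs' => simp only [map_add, mul_add, hs, hs']
  | tmul x y =>
  induction y with
  | zero => simp
  | add s s' hs hs' => simp only [map_add, mul_add, TensorProduct.tmul_add, hs, hs']
  | tmul y z =>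
    exact vec_ev3 (κ := LinearMap.id) (G := LinearMap.mulRight k (x ⊗ₜ[k] (y ⊗ₜ[k] z)))
      (fun a b c => by simp) T

lemma SSflip_qR : Q.SSflip Q.qR =
    (TensorProduct.comm k H H) (Q.S.rTensor H (Q.contrSα (Lm k H) Q.phi)) := by
  refine LinearMap.congr_fun (f := Q.SSflip ∘ₗ (LinearMap.mul' k H ∘ₗ flip ∘ₗ
    (Q.Sinv ∘ₗ LinearMap.mulLeft k Q.α).lTensor H).lTensor H)
    (g := (TensorProduct.comm k H H).toLinearMap ∘ₗ Q.S.rTensor H ∘ₗ Q.contrSα (Lm k H)) ?_ Q.phi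
  ext x y z
  simp [flip, Q.S_mul, mul_assoc]

/-- `Δ(S(h₍₁₎)) Uᴸ (h₍₂₎ ⊗ 1) = Uᴸ (1 ⊗ S(h))` -/
lemma UL_comm (h : H) : ev2 (R := H ⊗[k] H)
    (LinearMap.mulRight k Q.UL ∘ₗ Q.Δ.toLinearMap ∘ₗ Q.S)
      ((TensorProduct.mk k H H).flip 1) (Q.Δ h) = Q.UL * ((1 : H) ⊗ₜ Q.S h) := by
  set a := lft (H ⊗[k] H) (Lm k H) with ha
  set b := rgt H (lft H (Lm k H)) with hb
  set c := rgt H (rgt H (Lm k H)) with hc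
  set κ : H ⊗[k] (H ⊗[k] H) →ₗ[k] H ⊗[k] H :=
    (TensorProduct.comm k H H).toLinearMap ∘ₗ Q.S.rTensor H ∘ₗ Q.contrSα (Lm k H) with hκ
  set v : H ⊗[k] (H ⊗[k] H) := 1 with hv
  have hcap := (LEq.of_isCap (Q.contrSα_isCap (Lm k H)) v)
  have hw : Q.SSflip Q.qR = κ (Q.ph a b c v) := by
    rw [SSflip_qR, hκ, ph, LinearMap.comp_apply, LinearMap.comp_apply, contrSα_Lm_ev3, hv, mul_one]
    rfl
  have h1 := congrArg (fun X => κ (X v)) (conv_assoc (Q := Q) a b c h)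
  have h2 := congrArg ((TensorProduct.comm k H H).toLinearMap ∘ₗ Q.S.rTensor H)
    (hcap.conv_triv_right a h (Q.ph a b c))
  have h3 : ∀ m, κ (a h m) = κ m * ((1 : H) ⊗ₜ Q.S h) := fun m => by
    have : κ ∘ₗ a h = LinearMap.mulRight k ((1 : H) ⊗ₜ Q.S h) ∘ₗ κ := by
      ext; simp [ha, hκ, Q.S_mul]
    exact LinearMap.congr_fun this m
  have h4 : κ (Q.ph a b c (Q.conv (Q.conv a b) c h v)) = κ (Q.ph a b c v) * ((1 : H) ⊗ₜ Q.S h) := by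
    rw [← h3]
    exact h1.symm.trans h2
  rw [UL, mul_assoc, hw, ← h4]
  symm
  refine vec_ev2 (κ := LinearMap.mulLeft k Q.fInv ∘ₗ κ ∘ₗ Q.ph a b c)
    (G := ev2 (R := H ⊗[k] H) _ _) (fun x y => ?_) (Q.Δ h)
  have h5 : ∀ t : H ⊗[k] H, κ (Q.ph a b c (ev2 a b t (c y v))) =
      Q.SSflip t * κ (Q.ph a b c v) * (y ⊗ₜ 1) := fun t => by
    have e1 : ∀ X, κ (ev3 a b c X (ev2 a b t (c y v))) = Q.SSflip t * κ (ev3 a b c X v) * (y ⊗ₜ 1) := by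
      intro X
      induction X with
      | zero => simp
      | add s s' hs hs' => simp only [map_add, add_mul, mul_add, LinearMap.add_apply, hs, hs']
      | tmul x X =>
      induction X with
      | zero => simp
      | add s s' hs hs' => simp only [map_add, TensorProduct.tmul_add, add_mul, mul_add,
          LinearMap.add_apply, hs, hs']
      | tmul u w =>
      induction t with
      | zero => simp
      | add s s' hs hs' => simp only [map_add, add_mul, LinearMap.add_apply, hs, hs']
      | tmul p q =>
        simp [ha, hb, hc, hv, hκ, Algebra.TensorProduct.one_def, Q.S_mul, mul_assoc]
    exact e1 Q.phi
  have h6 : Q.conv a b x (c y v) = ev2 a b (Q.Δ x) (c y v) := rfl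
  rw [h6, LinearMap.comp_apply, LinearMap.comp_apply, h5, ← hw]
  simp only [LinearMap.mulLeft_apply, ev2_tmul, LinearMap.comp_apply, LinearMap.mulRight_apply]
  simp only [← mul_assoc]
  rw [fInv_SS_Δ]
  rfl

omit [FiniteDimensional k H] in
lemma qL_comm_elt (h : H) : ((1 : H) ⊗ₜ[k] h) * Q.qL =
    ev2 (R := H ⊗[k] H) ((TensorProduct.mk k H H).flip 1 ∘ₗ Q.S)
      (LinearMap.mulLeft k Q.qL ∘ₗ Q.Δ.toLinearMap) (Q.Δ h) := by
  have h1 := Q.qL_comm (Lm k H) h 1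
  have h2 : ∀ t : H ⊗[k] H, (Lm k H h).lTensor H t = ((1 : H) ⊗ₜ h) * t := fun t => by
    induction t with
    | zero => simp
    | add s s' hs hs' => simp only [map_add, mul_add, hs, hs']
    | tmul x y => simp
  rw [act2_Lm, mul_one, h2] at h1
  rw [h1]
  refine vec_ev2 (f := lft H (Lm k H) ∘ₗ Q.S)
    (g := (LinearMap.mulLeft k (act2 (Lm k H) Q.qL)) ∘ₗ act2 (Lm k H) ∘ₗ Q.Δ.toLinearMap)
    (κ := LinearMap.id) (v := 1) (G := ev2 (R := H ⊗[k] H) _ _) (fun x y => ?_) (Q.Δ h)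
  simp only [LinearMap.comp_apply, LinearMap.id_apply, LinearMap.mulLeft_apply,
    Module.End.mul_apply, act2_Lm, ev2_tmul]
  have h3 : ∀ t : H ⊗[k] H, lft H (Lm k H) (Q.S x) t = (Q.S x ⊗ₜ 1) * t := fun t => by
    induction t with
    | zero => simp
    | add s s' hs hs' => simp only [map_add, mul_add, hs, hs']
    | tmul x y => simp
  rw [h3, mul_one]
  rfl

/-- `Δ(S̄(h₍₂₎)) Uᴿ (1 ⊗ h₍₁₎) = Uᴿ (S̄(h) ⊗ 1)` -/
lemma UR_comm (h : H) : ev2 (R := H ⊗[k] H) (LinearMap.mulRight k Q.UR ∘ₗ Q.Δ.toLinearMap ∘ₗ Q.Sinv)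
    (TensorProduct.mk k H H 1) (flip (Q.Δ h)) = Q.UR * (Q.Sinv h ⊗ₜ 1) := by
  apply Q.SSflip_injective
  have h1 : ∀ t : H ⊗[k] H, Q.SSflip (ev2 (R := H ⊗[k] H) (LinearMap.mulRight k Q.UR ∘ₗ
      Q.Δ.toLinearMap ∘ₗ Q.Sinv) (TensorProduct.mk k H H 1) (flip t)) =
      ev2 (R := H ⊗[k] H) ((TensorProduct.mk k H H).flip 1 ∘ₗ Q.S)
      (LinearMap.mulLeft k Q.qL ∘ₗ Q.Δ.toLinearMap) t * Q.fInv := fun t => by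
    induction t with
    | zero => simp
    | add s s' hs hs' => simp only [map_add, add_mul, hs, hs']
    | tmul x y =>
      simp only [flip, LinearEquiv.coe_coe, TensorProduct.comm_tmul, ev2_tmul, LinearMap.comp_apply,
        LinearMap.mulRight_apply, SSflip_mul, UR, SSflip_SinvSinvflip, LinearMap.mulLeft_apply]
      simp only [mul_assoc]
      rw [AlgHom.toLinearMap_apply, AlgHom.toLinearMap_apply, Δ_Sinv]
      simp [Q.S_one]
  rw [h1, ← qL_comm_elt, SSflip_mul, UR, SSflip_SinvSinvflip, mul_assoc]
  simp [Q.S_one]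

/-- `(1 ⊗ qᴸ₁) Vᴿ Δ(S(qᴸ₂)) = f` -/
lemma qL_VR : ev2 (R := H ⊗[k] H) (TensorProduct.mk k H H 1)
    (LinearMap.mulLeft k Q.VR ∘ₗ Q.Δ.toLinearMap ∘ₗ Q.S) Q.qL = Q.f := by
  set o := lft (H ⊗[k] H) (Lm k H) with ho
  set a := rgt H (lft H (Lm k H)) with ha
  set b := rgt H (lft H Q.RS) with hb
  set c := rgt H (rgt H (Lm k H)) with hc
  set v : H ⊗[k] (H ⊗[k] H) := 1 ⊗ₜ (Q.β ⊗ₜ 1) with hv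
  set κ : H ⊗[k] (H ⊗[k] H) →ₗ[k] H ⊗[k] H :=
    (TensorProduct.comm k H H).toLinearMap ∘ₗ Q.S.lTensor H ∘ₗ Q.contrα H ∘ₗ Q.S.rTensor _ with hκ
  have hcap : LEq (vecK κ v) (Q.conv o a) (Q.triv _) := LEq.of_isCap (IsCap.of₃ fun x y z =>
    ⟨TensorProduct.mk k H H (Q.S z) ∘ₗ LinearMap.mulLeft k (Q.S x) ∘ₗ LinearMap.mulRight k y,
      fun p q => by simp [ho, ha, hκ, Q.S_mul, mul_assoc]⟩) v
  have hcup : REq (vecK κ v) (Q.conv a b) (Q.triv _) :=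
    REq.of_cup (TensorProduct.mk k H _ 1 ∘ₗ (TensorProduct.mk k H H).flip 1)
      (fun x y => by simp [ha, hb, hv, mul_assoc])
  -- `S(φ₃) ⊗ φ₁ β S(φ₂)` is the flip of `pᴸ`
  obtain ⟨ψ, hψ, hψ2⟩ : ∃ ψ, Q.ph a b c v = 1 ⊗ₜ[k] ψ ∧
      Q.SSflip Q.pL = TensorProduct.comm k H H (Q.S.lTensor H ψ) := by
    refine ⟨(Q.mulβS.rTensor H ∘ₗ (TensorProduct.assoc k H H H).symm.toLinearMap) Q.phi, ?_, ?_⟩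
    · refine vec_ev3 (κ := LinearMap.id) (G := TensorProduct.mk k H _ 1 ∘ₗ Q.mulβS.rTensor H ∘ₗ
        (TensorProduct.assoc k H H H).symm.toLinearMap) (fun x y z => ?_) Q.phi
      simp [ha, hb, hc, hv, mulβS, mul_assoc]
    · refine LinearMap.congr_fun (f := Q.SSflip ∘ₗ (LinearMap.mul' k H ∘ₗ flip ∘ₗ
          (Q.Sinv ∘ₗ LinearMap.mulRight k Q.β).rTensor H).rTensor H ∘ₗ
          (TensorProduct.assoc k H H H).symm.toLinearMap)
        (g := (TensorProduct.comm k H H).toLinearMap ∘ₗ Q.S.lTensor H ∘ₗ Q.mulβS.rTensor H ∘ₗ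
          (TensorProduct.assoc k H H H).symm.toLinearMap) ?_ Q.phi
      ext x y z
      simp [flip, mulβS, Q.S_mul, mul_assoc]
  have h1 : κ (Q.phb o a (Q.conv b c) (Q.ph a b c v)) = 1 := by
    have h2 := pentagon₄ (Q := Q) o a b c
    have h3 := hcap.ph_left (g := b) (h := c) 1 (Q.phb o a b * Q.phb o (Q.conv a b) c)
    have h4 := hcup.phb_mid (f := o) (h := c) (Q.phb o a b) 1
    simp only [one_mul, mul_one] at h3 h4
    have h5 := congrArg (vecK κ v) h2
    rw [mul_assoc, h3, h4] at h5
    refine h5.trans ?_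
    refine Eq.trans (vec_ev3 (κ := κ) (v := v) (G := TensorProduct.mk k H H 1 ∘ₗ LinearMap.mul' k H ∘ₗ
      TensorProduct.map Q.S (LinearMap.mul' k H ∘ₗ
          TensorProduct.map (LinearMap.mulLeft k Q.α) (LinearMap.mulLeft k Q.β ∘ₗ Q.S)))
      (fun x y z => ?_) Q.phiInv) (congrArg (TensorProduct.mk k H H 1) Q.antipode_φ_inv)
    simp [ho, ha, hb, hv, hκ, Q.S_one, mul_assoc]
  have h2 : ∀ N : H ⊗[k] (H ⊗[k] H), κ (ev3 o a (Q.conv b c) N (1 ⊗ₜ[k] ψ)) * Q.f =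
      ev2 (R := H ⊗[k] H) (TensorProduct.mk k H H 1)
        (LinearMap.mulLeft k Q.VR ∘ₗ Q.Δ.toLinearMap ∘ₗ Q.S)
        (Q.mulSα.rTensor H ((TensorProduct.assoc k H H H).symm N)) := fun N => by
    refine vec_ev3 (κ := LinearMap.mulRight k Q.f ∘ₗ κ) (G := ev2 (R := H ⊗[k] H) _ _ ∘ₗ
      Q.mulSα.rTensor H ∘ₗ (TensorProduct.assoc k H H H).symm.toLinearMap) (fun x y z => ?_) N
    have h3 : κ (o x (a y (Q.conv b c z (1 ⊗ₜ[k] ψ)))) = ((1 : H) ⊗ₜ (Q.S x * Q.α * y)) *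
        (Q.SSflip Q.pL * Q.SSflip (Q.Δ z)) := by
      rw [hψ2, conv_apply]
      generalize Q.Δ z = t
      clear hψ hψ2
      induction t with
      | zero => simp
      | add s s' hs hs' => simp only [map_add, mul_add, LinearMap.add_apply, hs, hs']
      | tmul p q =>
        induction ψ with
        | zero => simp
        | add s s' hs hs' =>
          simp only [map_add, TensorProduct.tmul_add, mul_add, add_mul, hs, hs']
        | tmul r s => simp [ho, ha, hb, hc, hκ, Q.S_mul, mul_assoc]
    simp only [LinearMap.comp_apply, h3, LinearMap.mulRight_apply, LinearEquiv.coe_coe,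
      TensorProduct.assoc_symm_tmul, LinearMap.rTensor_tmul, ev2_tmul, LinearMap.mulLeft_apply, VR,
      AlgHom.toLinearMap_apply, mul_assoc, f_Δ_S]
    simp [mulSα]
  have h3 := h2 Q.phiInv
  rw [← hψ] at h3
  have h4 : κ (ev3 o a (Q.conv b c) Q.phiInv (Q.ph a b c v)) = 1 := h1
  rw [h4, one_mul] at h3
  exact h3.symm

/-! ### Counits of the gauge transformation -/

/-- `x ↦ x ⊗ 1` -/
def inl (k H : Type*) [Field k] [Ring H] [Algebra k H] : Rep k H (H ⊗[k] H) :=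
  (TensorProduct.mk k H H).flip 1

/-- `x ↦ 1 ⊗ x` -/
def inr (k H : Type*) [Field k] [Ring H] [Algebra k H] : Rep k H (H ⊗[k] H) :=
  TensorProduct.mk k H H 1

omit [FiniteDimensional k H] in
@[simp] lemma inl_apply (x : H) : inl k H x = x ⊗ₜ 1 := rfl

omit [FiniteDimensional k H] in
@[simp] lemma inr_apply (x : H) : inr k H x = 1 ⊗ₜ x := rfl

instance : IsRep (inl k H) := ⟨rfl, fun x y => by simp⟩
instance : IsRep (inr k H) := ⟨rfl, fun x y => by simp⟩
instance : Comm (inl k H) (inr k H) := ⟨fun x y => by rw [commute_iff_eq]; simp⟩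

/-- `ε ⊗ id` -/
def εl : H ⊗[k] H →ₐ[k] H :=
  (Algebra.TensorProduct.lid k H).toAlgHom.comp (Algebra.TensorProduct.map Q.ε (AlgHom.id k H))

/-- `id ⊗ ε` -/
def εr : H ⊗[k] H →ₐ[k] H :=
  (Algebra.TensorProduct.rid k k H).toAlgHom.comp (Algebra.TensorProduct.map (AlgHom.id k H) Q.ε)

omit [FiniteDimensional k H] in
@[simp] lemma εl_tmul (x y : H) : Q.εl (x ⊗ₜ y) = Q.ε x • y := by simp [εl]

omit [FiniteDimensional k H] in
@[simp] lemma εr_tmul (x y : H) : Q.εr (x ⊗ₜ y) = Q.ε y • x := by simp [εr]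

omit [FiniteDimensional k H] in
lemma εl_Δ (x : H) : Q.εl (Q.Δ x) = x := by
  conv_rhs => rw [← Q.counit_left x]
  induction Q.Δ x with
  | zero => simp
  | add s s' hs hs' => simp only [map_add, hs, hs']
  | tmul x y => simp

omit [FiniteDimensional k H] in
lemma εr_Δ (x : H) : Q.εr (Q.Δ x) = x := by
  conv_rhs => rw [← Q.counit_right x]
  induction Q.Δ x with
  | zero => simp
  | add s s' hs hs' => simp only [map_add, hs, hs']
  | tmul x y => simp

omit [FiniteDimensional k H] in
lemma εl_SSflip (t : H ⊗[k] H) : Q.εl (Q.SSflip t) = Q.S (Q.εr t) := by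
  induction t with
  | zero => simp
  | add s s' hs hs' => simp only [map_add, hs, hs']
  | tmul x y => simp [ε_S]

omit [FiniteDimensional k H] in
lemma εr_SSflip (t : H ⊗[k] H) : Q.εr (Q.SSflip t) = Q.S (Q.εl t) := by
  induction t with
  | zero => simp
  | add s s' hs hs' => simp only [map_add, hs, hs']
  | tmul x y => simp [ε_S]

omit [FiniteDimensional k H] in
lemma aElt_counits : Q.εl Q.aElt = Q.α ∧ Q.εr Q.aElt = Q.α := by
  have h1 : ev4 (inl k H) (Q.triv _) (Q.triv _) (inr k H)
      (((1 : H) ⊗ₜ[k] Q.phiInv) * Q.Δ₃ Q.phi) = 1 := by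
    rw [ev4_mul, ev4_one_tmul, ev4_Δ₃]
    have e1 := phb_triv_left (Q := Q) (Q.triv _) (inr k H)
    have e2 := ph_triv_mid (Q := Q) (inl k H) (Q.conv (Q.triv _) (inr k H))
    rw [phb] at e1
    rw [ph] at e2
    rw [e1, e2, one_mul]
  have h2 : ev4 (Q.triv _) (inl k H) (inr k H) (Q.triv _)
      (((1 : H) ⊗ₜ[k] Q.phiInv) * Q.Δ₃ Q.phi) = 1 := by
    rw [ev4_mul, ev4_one_tmul, ev4_Δ₃]
    have e1 := phb_triv_right (Q := Q) (inl k H) (inr k H)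
    have e2 := ph_triv_left (Q := Q) (inl k H) (Q.conv (inr k H) (Q.triv _))
    rw [phb] at e1
    rw [ph] at e2
    rw [e1, e2, one_mul]
  constructor
  · have : ∀ t, Q.εl (TensorProduct.map Q.mulSα Q.mulSα (perm2314 t)) =
        Q.mulSα (ev4 (inl k H) (Q.triv _) (Q.triv _) (inr k H) t) := fun t => by
      refine LinearMap.congr_fun (f := Q.εl.toLinearMap ∘ₗ TensorProduct.map Q.mulSα Q.mulSα ∘ₗ
        perm2314) (g := Q.mulSα ∘ₗ ev4 (inl k H) (Q.triv _) (Q.triv _) (inr k H)) ?_ t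
      ext x y z w
      simp [perm2314, mulSα, triv_apply, ε_S, Q.ε_α, smul_smul, mul_comm (Q.ε y)]
    rw [aElt, this, h1]
    simp [mulSα, Algebra.TensorProduct.one_def, Q.S_one]
  · have : ∀ t, Q.εr (TensorProduct.map Q.mulSα Q.mulSα (perm2314 t)) =
        Q.mulSα (ev4 (Q.triv _) (inl k H) (inr k H) (Q.triv _) t) := fun t => by
      refine LinearMap.congr_fun (f := Q.εr.toLinearMap ∘ₗ TensorProduct.map Q.mulSα Q.mulSα ∘ₗ
        perm2314) (g := Q.mulSα ∘ₗ ev4 (Q.triv _) (inl k H) (inr k H) (Q.triv _)) ?_ t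
      ext x y z w
      simp [perm2314, mulSα, triv_apply, ε_S, Q.ε_α, smul_smul, mul_comm]
    rw [aElt, this, h2]
    simp [mulSα, Algebra.TensorProduct.one_def, Q.S_one]

omit [FiniteDimensional k H] in
lemma f_counits : Q.εl Q.f = 1 ∧ Q.εr Q.f = 1 := by
  obtain ⟨ha, ha'⟩ := Q.aElt_counits
  have h0 := Q.antipode_φ_inv
  constructor
  · rw [f_eq_gauge, ← h0]
    refine map_ev3 (F := Q.εl.toLinearMap) (G := LinearMap.mul' k H ∘ₗ TensorProduct.map Q.S
        (LinearMap.mul' k H ∘ₗ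
          TensorProduct.map (LinearMap.mulLeft k Q.α) (LinearMap.mulLeft k Q.β ∘ₗ Q.S))) ?_ Q.phiInv
    intro x y z
    simp [antipodeFlip, antipodeΔ, εl_SSflip, εl_Δ, εr_Δ, ha, mul_assoc]
  · rw [f_eq_gauge, ← h0]
    refine map_ev3 (F := Q.εr.toLinearMap) (G := LinearMap.mul' k H ∘ₗ TensorProduct.map Q.S
        (LinearMap.mul' k H ∘ₗ
          TensorProduct.map (LinearMap.mulLeft k Q.α) (LinearMap.mulLeft k Q.β ∘ₗ Q.S))) ?_ Q.phiInv
    intro x y z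
    simp [antipodeFlip, antipodeΔ, εr_SSflip, εl_Δ, εr_Δ, ha', mul_assoc]

instance : IsRep (LinearMap.id : Rep k H H) := ⟨rfl, fun _ _ => rfl⟩

lemma εr_qR : Q.εr Q.qR = 1 := by
  rw [← ph_triv_mid (Q := Q) (LinearMap.id : Rep k H H) (Q.triv H)]
  symm
  refine map_ev3 (F := LinearMap.id) (G := Q.εr.toLinearMap ∘ₗ (LinearMap.mul' k H ∘ₗ flip ∘ₗ
    (Q.Sinv ∘ₗ LinearMap.mulLeft k Q.α).lTensor H).lTensor H) (fun x y z => ?_) Q.phi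
  simp [flip, triv_apply, ε_Sinv, Q.ε_α, smul_smul, mul_comm]

omit [FiniteDimensional k H] in
lemma εr_pR : Q.εr Q.pR = 1 := by
  rw [← phb_triv_mid (Q := Q) (LinearMap.id : Rep k H H) (Q.triv H)]
  symm
  refine map_ev3 (F := LinearMap.id) (G := Q.εr.toLinearMap ∘ₗ Q.mulβS.lTensor H)
    (fun x y z => ?_) Q.phiInv
  simp [triv_apply, mulβS, ε_S, Q.ε_β, smul_smul, mul_comm]

lemma fInv_counits : Q.εl Q.fInv = 1 ∧ Q.εr Q.fInv = 1 := by
  have h1 := congrArg Q.εl Q.f_mul_fInv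
  have h2 := congrArg Q.εr Q.f_mul_fInv
  rw [map_mul, Q.f_counits.1, one_mul, map_one] at h1
  rw [map_mul, Q.f_counits.2, one_mul, map_one] at h2
  exact ⟨h1, h2⟩

lemma εl_UL : Q.εl Q.UL = 1 := by
  rw [UL, map_mul, Q.fInv_counits.1, εl_SSflip, εr_qR, Q.S_one, one_mul]

lemma εl_VL : Q.εl Q.VL = 1 := by
  have h : ∀ t, Q.εl (Q.SinvSinvflip t) = Q.Sinv (Q.εr t) := fun t => by
    induction t with
    | zero => simp
    | add s s' hs hs' => simp only [map_add, hs, hs']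
    | tmul x y => simp [ε_Sinv]
  rw [VL, h, map_mul, Q.f_counits.2, εr_pR, one_mul, Sinv_one]

end Sinv
end
end QuasiHopfAlgebra

namespace QuasiHopfAlgebra

noncomputable section

section Cointegrals

variable {k H : Type*} [Field k] [Ring H] [Algebra k H] [FiniteDimensional k H]
  (Q : QuasiHopfAlgebra k H)

/-! ### Cointegrals and the modular function -/

/-- Right integrals: `x h = ε(h) x`. -/
lemma exists_rightIntegral : ∃ Λ : H, Λ ≠ 0 ∧ (∀ h, Λ * h = Q.ε h • Λ) ∧
    ∀ x : H, (∀ h, x * h = Q.ε h • x) → ∃ r : k, x = r • Λ := by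
  obtain ⟨ℓ, m, hℓ, huniq, -, h1⟩ := Q.exists_leftIntegral
  refine ⟨Q.S ℓ, ?_, fun h => ?_, fun x hx => ?_⟩
  · intro h0
    have : ℓ = 0 := Q.S_bijective.1 (by rw [h0, map_zero])
    have hn := Q.nontrivial_of_counit
    rw [this, cElt, map_zero, mul_zero, zero_mul, map_zero] at h1
    exact zero_ne_one h1
  · obtain ⟨g, rfl⟩ := Q.S_bijective.2 h
    rw [← Q.S_mul, hℓ, map_smul, ε_S]
  · obtain ⟨r, hr⟩ := huniq (Q.Sinv x) (fun h => Q.S_bijective.1 (by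
      rw [Q.S_mul, S_Sinv, hx, map_smul, S_Sinv, ε_S]))
    exact ⟨r, by rw [← map_smul, ← hr, S_Sinv]⟩

/-- An operator on `H*` with `E(ξ · h) = ε(h) E(ξ)` has rank at most one: it depends on `ξ` only
through its value at a right integral. -/
lemma exists_of_coinvariant {Λ : H} (hΛ : Λ ≠ 0)
    (huniq : ∀ x : H, (∀ h, x * h = Q.ε h • x) → ∃ r : k, x = r • Λ)
    (E : Module.Dual k H →ₗ[k] Module.Dual k H)
    (hE : ∀ h ξ, E (ξ ∘ₗ LinearMap.mulRight k h) = Q.ε h • E ξ) :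
    ∃ lam : Module.Dual k H, ∀ ξ, E ξ = ξ Λ • lam := by
  obtain ⟨n, hn⟩ : ∃ n : Module.Dual k H, n Λ = 1 := by
    obtain ⟨f, hf⟩ := not_forall.1 (mt (Module.forall_dual_apply_eq_zero_iff k Λ).1 hΛ)
    exact ⟨(f Λ)⁻¹ • f, inv_mul_cancel₀ hf⟩
  refine ⟨E n, fun ξ => ?_⟩
  ext z
  -- evaluation at `z` is evaluation of `ξ` at a right integral
  obtain ⟨y, hy⟩ := (Module.evalEquiv k H).surjective (Module.Dual.eval k H z ∘ₗ E)
  have hy' : ∀ ξ, E ξ z = ξ y := fun ξ => (LinearMap.congr_fun hy ξ).symm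
  obtain ⟨r, rfl⟩ := huniq y (fun h => by
    rw [← sub_eq_zero, ← Module.forall_dual_apply_eq_zero_iff k]
    intro ξ
    have := LinearMap.congr_fun (hE h ξ) z
    rw [hy', LinearMap.smul_apply, hy'] at this
    rw [map_sub, map_smul, ← this]
    simp)
  simp [hy', hn, mul_comm]

omit [FiniteDimensional k H] in
@[simp] lemma rdualActL_apply (h z : H) (ξ : Module.Dual k H) :
    Q.rdualActL h ξ z = ξ (Q.Sinv h * z) := rfl

omit [FiniteDimensional k H] in
@[simp] lemma rdualActR_apply (h z : H) (ξ : Module.Dual k H) :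
    Q.rdualActR h ξ z = ξ (z * Q.S h) := rfl

omit [FiniteDimensional k H] in
@[simp] lemma ldualActL_apply (h z : H) (ξ : Module.Dual k H) :
    Q.ldualActL h ξ z = ξ (Q.S h * z) := rfl

omit [FiniteDimensional k H] in
@[simp] lemma ldualActR_apply (h z : H) (ξ : Module.Dual k H) :
    Q.ldualActR h ξ z = ξ (z * Q.Sinv h) := rfl

/-- `x ⊗ y` acts on `H* ⊗ H` by `f(x) ⊗ g(y)`. -/
def pairAct (f : H →ₗ[k] Module.End k (Module.Dual k H)) (g : H →ₗ[k] Module.End k H) :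
    H ⊗[k] H →ₗ[k] (Module.Dual k H ⊗[k] H →ₗ[k] Module.Dual k H ⊗[k] H) :=
  TensorProduct.homTensorHomMap (RingHom.id k) _ _ _ _ ∘ₗ TensorProduct.map f g

omit [FiniteDimensional k H] in
@[simp] lemma pairAct_tmul (f : H →ₗ[k] Module.End k (Module.Dual k H))
    (g : H →ₗ[k] Module.End k H) (x y w : H) (η : Module.Dual k H) :
    pairAct f g (x ⊗ₜ y) (η ⊗ₜ w) = f x η ⊗ₜ g y w := rfl

/-- The map `(a ⊗ b) ⊗ (η ⊗ w) ↦ ⟨η, S̄(a) ? S(β S(b w))⟩` in the definition of left cointegrals. -/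
def leftContr : H ⊗[k] H →ₗ[k] Module.Dual k H ⊗[k] H →ₗ[k] Module.Dual k H :=
  (TensorProduct.mk k (H ⊗[k] H) (Module.Dual k H ⊗[k] H)).compr₂
    (TensorProduct.lift Q.rdualActR.flip ∘ₗ
      TensorProduct.map (TensorProduct.lift Q.rdualActL)
        (LinearMap.mulLeft k Q.β ∘ₗ Q.S ∘ₗ LinearMap.mul' k H) ∘ₗ
      (TensorProduct.tensorTensorTensorComm k H H (Module.Dual k H) H).toLinearMap)

omit [FiniteDimensional k H] in
@[simp] lemma leftContr_tmul (a b w z : H) (η : Module.Dual k H) :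
    Q.leftContr (a ⊗ₜ b) (η ⊗ₜ w) z = η (Q.Sinv a * (z * Q.S (Q.β * Q.S (b * w)))) := rfl

lemma leftCoinv_eq (ξ : Module.Dual k H) :
    Q.leftCoinv ξ = Q.leftContr Q.qR (Q.rdualCoact ξ) := rfl

lemma dualTensorHom_rdualCoact (ξ : Module.Dual k H) (x : H) :
    dualTensorHom k H H (Q.rdualCoact ξ) x = Q.rdualCoactMap ξ x := by
  rw [rdualCoact, LinearMap.comp_apply]
  exact LinearMap.congr_fun ((dualTensorHomEquiv k H H).apply_symm_apply _) x

/-- `(ξ · h)₍₀₎ ⊗ (ξ · h)₍₁₎ = ξ₍₀₎ · h₍₁₎ ⊗ ξ₍₁₎ h₍₂₎` -/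
lemma rdualCoact_actR (h : H) (ξ : Module.Dual k H) : Q.rdualCoact (Q.rdualActR h ξ) =
    pairAct Q.rdualActR (LinearMap.mul k H).flip (Q.Δ h) (Q.rdualCoact ξ) := by
  apply (dualTensorHomEquiv k H H).injective
  ext x
  change dualTensorHom k H H _ x = dualTensorHom k H H _ x
  rw [dualTensorHom_rdualCoact]
  have h1 : ∀ t : H ⊗[k] H, dualTensorHom k H H (pairAct Q.rdualActR (LinearMap.mul k H).flip t (Q.rdualCoact ξ)) x =
      TensorProduct.rid k H (ξ.lTensor H (Q.VL * (Q.Δ x * ev2 (R := H ⊗[k] H)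
    (LinearMap.mulRight k Q.UL ∘ₗ Q.Δ.toLinearMap ∘ₗ Q.S)
      ((TensorProduct.mk k H H).flip 1) t))) := by
    intro t
    induction t with
    | zero => simp
    | add s s' hs hs' => simp only [map_add, LinearMap.add_apply, mul_add, hs, hs']
    | tmul a b =>
      have h2 : ∀ T : Module.Dual k H ⊗[k] H, dualTensorHom k H H (pairAct Q.rdualActR (LinearMap.mul k H).flip (a ⊗ₜ b) T) x =
          dualTensorHom k H H T (x * Q.S a) * b := fun T => by
        induction T with
        | zero => simp
        | add s s' hs hs' => simp only [map_add, LinearMap.add_apply, add_mul, hs, hs']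
        | tmul η w => simp
      rw [h2, dualTensorHom_rdualCoact]
      have h3 : ∀ T : H ⊗[k] H, TensorProduct.rid k H (ξ.lTensor H (T * (b ⊗ₜ 1))) =
          TensorProduct.rid k H (ξ.lTensor H T) * b := fun T => by
        induction T with
        | zero => simp
        | add s s' hs hs' => simp only [map_add, add_mul, hs, hs']
        | tmul p q => simp
      simp only [ev2_tmul, LinearMap.comp_apply, LinearMap.flip_apply, TensorProduct.mk_apply,
        ← mul_assoc, h3, LinearMap.mulRight_apply]
      simp [rdualCoactMap, mul_assoc]
  rw [h1, UL_comm]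
  have h4 : ∀ T : H ⊗[k] H, Q.rdualActR h ξ = ξ ∘ₗ LinearMap.mulRight k (Q.S h) ∧
      (ξ ∘ₗ LinearMap.mulRight k (Q.S h)).lTensor H T = ξ.lTensor H (T * (1 ⊗ₜ Q.S h)) := fun T => by
    refine ⟨rfl, ?_⟩
    induction T with
    | zero => simp
    | add s s' hs hs' => simp only [map_add, add_mul, hs, hs']
    | tmul p q => simp
  change TensorProduct.rid k H ((Q.rdualActR h ξ).lTensor H (Q.VL * (Q.Δ x * Q.UL))) = _
  rw [(h4 0).1, (h4 _).2]
  simp only [mul_assoc]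

lemma leftCoinv_actR (h : H) (ξ : Module.Dual k H) :
    Q.leftCoinv (Q.rdualActR h ξ) = Q.ε h • Q.leftCoinv ξ := by
  rw [leftCoinv_eq, leftCoinv_eq, rdualCoact_actR]
  generalize Q.rdualCoact ξ = T
  ext z
  have h0 : ∀ q : H ⊗[k] H, Q.leftContr q (pairAct Q.rdualActR (LinearMap.mul k H).flip (Q.Δ h) T) z =
      Q.ε h • Q.leftContr q T z := fun q => by
    induction T with
    | zero => simp
    | add s s' hs hs' => simp only [map_add, LinearMap.add_apply, smul_add, hs, hs']
    | tmul η w =>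
    induction q with
    | zero => simp
    | add s s' hs hs' => simp only [map_add, LinearMap.add_apply, smul_add, hs, hs']
    | tmul a b =>
      have h1 := congrArg (η ∘ₗ LinearMap.mulLeft k (Q.Sinv a * z) ∘ₗ Q.S ∘ₗ
        LinearMap.mulRight k (Q.S (b * w))) (Q.S_β h)
      rw [map_smul] at h1
      refine Eq.trans ?_ (h1.trans (by simp))
      induction Q.Δ h with
      | zero => simp
      | add s s' hs hs' => simp only [map_add, LinearMap.add_apply, hs, hs']
      | tmul x y => simp [Q.S_mul, mul_assoc]
  exact h0 Q.qR

lemma leftCoinv_rightIntegral {Λ : H} (hΛ : ∀ h, Λ * h = Q.ε h • Λ) (ξ : Module.Dual k H) :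
    Q.leftCoinv ξ Λ = ξ Λ := by
  have h1 : ∀ T q, Q.leftContr q T Λ = Q.ε (dualTensorHom k H H T (Q.Sinv (Q.εr q) * Λ)) := by
    intro T q
    induction T with
    | zero => simp
    | add s s' hs hs' => simp only [map_add, LinearMap.add_apply, hs, hs']
    | tmul η w =>
    induction q with
    | zero => simp
    | add s s' hs hs' => simp only [map_add, LinearMap.add_apply, add_mul, hs, hs']
    | tmul a b =>
      rw [leftContr_tmul, hΛ]
      simp [ε_S, Q.ε_β, mul_assoc, mul_comm (η _)]
  have h2 : ∀ t : H ⊗[k] H, Q.ε (TensorProduct.rid k H (ξ.lTensor H t)) = ξ (Q.εl t) := fun t => by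
    induction t with
    | zero => simp
    | add s s' hs hs' => simp only [map_add, hs, hs']
    | tmul x y => simp [mul_comm]
  rw [leftCoinv_eq, h1, εr_qR, Sinv_one, one_mul, dualTensorHom_rdualCoact]
  change Q.ε (TensorProduct.rid k H (ξ.lTensor H (Q.VL * (Q.Δ Λ * Q.UL)))) = _
  rw [h2, map_mul Q.εl, map_mul Q.εl, εl_VL, εl_UL, εl_Δ, one_mul, mul_one]

lemma exists_leftCointegral {Λ : H} (h0 : Λ ≠ 0) (hΛ : ∀ h, Λ * h = Q.ε h • Λ)
    (huniq : ∀ x : H, (∀ h, x * h = Q.ε h • x) → ∃ r : k, x = r • Λ) :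
    ∃ lam : Module.Dual k H, lam Λ = 1 ∧ ∀ ξ, Q.leftCoinv ξ = ξ Λ • lam := by
  obtain ⟨lam, hlam⟩ := Q.exists_of_coinvariant h0 huniq Q.leftCoinv (fun h ξ => by
    have := Q.leftCoinv_actR (Q.Sinv h) ξ
    rw [ε_Sinv] at this
    rw [← this]
    congr 1
    ext z
    simp)
  refine ⟨lam, ?_, hlam⟩
  obtain ⟨f, hf⟩ := not_forall.1 (mt (Module.forall_dual_apply_eq_zero_iff k Λ).1 h0)
  have := Q.leftCoinv_rightIntegral hΛ f
  rw [hlam] at this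
  exact mul_left_cancel₀ hf (by simpa using this)

/-- An algebra map is the modular function if and only if `S̄(h) Λ = μ(h) Λ` for right integrals. -/
lemma isModularFunction_iff {Λ : H} (h0 : Λ ≠ 0) (hΛ : ∀ h, Λ * h = Q.ε h • Λ)
    (huniq : ∀ x : H, (∀ h, x * h = Q.ε h • x) → ∃ r : k, x = r • Λ) (μ : H →ₐ[k] k) :
    Q.IsModularFunction μ ↔ ∀ h, Q.Sinv h * Λ = μ h • Λ := by
  obtain ⟨lam, h1, hlam⟩ := Q.exists_leftCointegral h0 hΛ huniq
  have hne : lam ≠ 0 := fun h => by simp [h] at h1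
  have h2 : ∀ h, Q.leftCoinv (Q.rdualActL h lam) = lam (Q.Sinv h * Λ) • lam := fun h => hlam _
  have h3 : ∀ h, Q.Sinv h * Λ = lam (Q.Sinv h * Λ) • Λ := fun h => by
    obtain ⟨r, hr⟩ := huniq (Q.Sinv h * Λ) (fun g => by rw [mul_assoc, hΛ, mul_smul_comm])
    rw [hr, map_smul, h1, smul_eq_mul, mul_one]
  constructor
  · intro hμ h
    have := hμ h lam ⟨lam, by rw [hlam, h1, one_smul]⟩
    rw [h2] at this
    rw [h3, smul_left_injective k hne this]
  · rintro hμ h l ⟨ξ, rfl⟩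
    rw [hlam ξ, map_smul, map_smul, h2, hμ, map_smul, h1, smul_eq_mul, mul_one, smul_comm]

theorem existsUnique_modularFunction : ∃! μ : H →ₐ[k] k, Q.IsModularFunction μ := by
  obtain ⟨Λ, h0, hΛ, huniq⟩ := Q.exists_rightIntegral
  obtain ⟨lam, h1, -⟩ := Q.exists_leftCointegral h0 hΛ huniq
  have h3 : ∀ h, Q.Sinv h * Λ = lam (Q.Sinv h * Λ) • Λ := fun h => by
    obtain ⟨r, hr⟩ := huniq (Q.Sinv h * Λ) (fun g => by rw [mul_assoc, hΛ, mul_smul_comm])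
    rw [hr, map_smul, h1, smul_eq_mul, mul_one]
  refine ⟨AlgHom.ofLinearMap (lam ∘ₗ LinearMap.mulRight k Λ ∘ₗ Q.Sinv) ?_ ?_, ?_, ?_⟩
  · simp [Sinv_one, h1]
  · intro x y
    simp only [LinearMap.comp_apply, LinearMap.mulRight_apply]
    rw [Sinv_mul, mul_assoc, h3 x, mul_smul_comm, map_smul, smul_eq_mul]
    simp [h1]
  · exact (Q.isModularFunction_iff h0 hΛ huniq _).2 fun h => h3 h
  · intro μ hμ
    ext h
    have := (Q.isModularFunction_iff h0 hΛ huniq _).1 hμ h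
    simp [this, h1]

/-- The modular function describes right multiplication on left integrals. -/
lemma leftIntegral_mul {μ : H →ₐ[k] k} (hμ : Q.IsModularFunction μ) {ℓ : H}
    (hℓ : ∀ h, h * ℓ = Q.ε h • ℓ) (h : H) : ℓ * h = μ h • ℓ := by
  obtain ⟨Λ, h0, hΛ, huniq⟩ := Q.exists_rightIntegral
  have h1 := (Q.isModularFunction_iff h0 hΛ huniq _).1 hμ
  obtain ⟨r, hr⟩ := huniq (Q.Sinv ℓ) (fun g => Q.S_bijective.1 (by
    rw [Q.S_mul, S_Sinv, hℓ, map_smul, S_Sinv, ε_S]))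
  have h2 : ℓ = r • Q.S Λ := by rw [← map_smul, ← hr, S_Sinv]
  have h3 : Q.S Λ * h = Q.S (Q.Sinv h * Λ) := by rw [Q.S_mul, S_Sinv]
  rw [h2, smul_mul_assoc, h3, h1, map_smul, smul_comm]

/-! ### Right cointegrals -/

/-- The map `(a ⊗ b) ⊗ (w ⊗ η) ↦ ⟨η, S(b) ? S̄(S̄(a w β))⟩` in the definition of right cointegrals. -/
def rightContr : H ⊗[k] H →ₗ[k] H ⊗[k] Module.Dual k H →ₗ[k] Module.Dual k H :=
  (TensorProduct.mk k (H ⊗[k] H) (H ⊗[k] Module.Dual k H)).compr₂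
    (TensorProduct.lift Q.ldualActR ∘ₗ
      TensorProduct.map (LinearMap.mulLeft k (Q.Sinv Q.β) ∘ₗ Q.Sinv ∘ₗ LinearMap.mul' k H)
        (TensorProduct.lift Q.ldualActL) ∘ₗ
      (TensorProduct.tensorTensorTensorComm k H H H (Module.Dual k H)).toLinearMap)

@[simp] lemma rightContr_tmul (a b w z : H) (η : Module.Dual k H) :
    Q.rightContr (a ⊗ₜ b) (w ⊗ₜ η) z =
      η (Q.S b * (z * Q.Sinv (Q.Sinv (a * w * Q.β)))) := by
  rw [Q.Sinv_mul]; rfl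

lemma rightCoinv_eq (ξ : Module.Dual k H) :
    Q.rightCoinv ξ = Q.rightContr Q.qL (Q.ldualCoact ξ) := rfl

/-- `η ⊗ z ↦ ⟨η, ? S̄(S̄(z β))⟩` -/
def rightContrβ : Module.Dual k H ⊗[k] H →ₗ[k] Module.Dual k H :=
  TensorProduct.lift (Q.ldualActR.flip.compl₂ (Q.Sinv ∘ₗ LinearMap.mulRight k Q.β))

omit [FiniteDimensional k H] in
@[simp] lemma rightContrβ_tmul (η : Module.Dual k H) (w z : H) :
    Q.rightContrβ (η ⊗ₜ w) z = η (z * Q.Sinv (Q.Sinv (w * Q.β))) := rfl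

/-- The map `x ↦ ⟨ξ, f₁ x₍₁₎ Uᴿ₁⟩ f₂ x₍₂₎ Uᴿ₂`. -/
def twistedCoact (ξ : Module.Dual k H) : H →ₗ[k] H :=
  (TensorProduct.lid k H).toLinearMap ∘ₗ ξ.rTensor H ∘ₗ
    LinearMap.mulLeft k Q.f ∘ₗ LinearMap.mulRight k Q.UR ∘ₗ Q.Δ.toLinearMap

omit [FiniteDimensional k H] in
lemma twistedCoact_apply (ξ : Module.Dual k H) (x : H) : Q.twistedCoact ξ x =
    TensorProduct.lid k H (ξ.rTensor H (Q.f * (Q.Δ x * Q.UR))) := rfl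

/-- The element `qᴸ` and the factor `Vᴿ` in the coaction combine to Drinfeld's `f`. -/
lemma rightCoinv_eq_twistedCoact (ξ : Module.Dual k H) :
    Q.rightCoinv ξ = Q.rightContrβ ((dualTensorHomEquiv k H H).symm (Q.twistedCoact ξ)) := by
  have h1 : ∀ (q : H ⊗[k] H) (T : Module.Dual k H ⊗[k] H),
      Q.rightContr q (TensorProduct.comm k _ _ T) =
      Q.rightContrβ (pairAct Q.ldualActL (Lm k H) (flip q) T) := fun q T => by
    induction T with
    | zero => simp
    | add s s' hs hs' => simp only [map_add, hs, hs']
    | tmul η w =>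
    induction q with
    | zero => simp
    | add s s' hs hs' => simp only [map_add, LinearMap.add_apply, hs, hs']
    | tmul a b => ext z; simp [flip]
  rw [rightCoinv_eq]
  refine (h1 _ _).trans (congrArg _ ?_)
  apply (dualTensorHomEquiv k H H).injective
  rw [LinearEquiv.apply_symm_apply]
  ext x
  change dualTensorHom k H H _ x = _
  have h2 : ∀ T q, dualTensorHom k H H (pairAct Q.ldualActL (Lm k H) (flip q) T) x =
      ev2 (R := H) LinearMap.id (dualTensorHom k H H T ∘ₗ LinearMap.mulRight k x ∘ₗ Q.S) q := by
    intro T q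
    induction q with
    | zero => simp
    | add s s' hs hs' => simp only [map_add, LinearMap.add_apply, hs, hs']
    | tmul a b =>
    induction T with
    | zero => simp
    | add s s' hs hs' =>
      simp only [map_add, LinearMap.add_apply, LinearMap.add_comp, hs, ev2_tmul, mul_add] at *
      rw [hs']
    | tmul η w => simp [flip]
  have h3 : dualTensorHom k H H ((dualTensorHomEquiv k H H).symm (Q.ldualCoactMap ξ)) =
      Q.ldualCoactMap ξ := (dualTensorHomEquiv k H H).apply_symm_apply _
  refine (h2 _ _).trans ?_
  rw [LinearMap.comp_apply, LinearEquiv.coe_coe, h3, twistedCoact_apply, ← qL_VR]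
  refine map_ev2 (F := LinearMap.id) (G := (TensorProduct.lid k H).toLinearMap ∘ₗ ξ.rTensor H ∘ₗ
    LinearMap.mulRight k (Q.Δ x * Q.UR) ∘ₗ ev2 (R := H ⊗[k] H) (TensorProduct.mk k H H 1)
    (LinearMap.mulLeft k Q.VR ∘ₗ Q.Δ.toLinearMap ∘ₗ Q.S)) (fun a b => ?_) Q.qL
  have h4 : ∀ T : H ⊗[k] H, TensorProduct.lid k H (ξ.rTensor H ((1 ⊗ₜ a) * T)) =
      a * TensorProduct.lid k H (ξ.rTensor H T) := fun T => by
    induction T with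
    | zero => simp
    | add s s' hs hs' => simp only [map_add, mul_add, hs, hs']
    | tmul p q => simp
  simp only [LinearMap.comp_apply, ev2_tmul, LinearMap.mulRight_apply, TensorProduct.mk_apply,
    mul_assoc, LinearEquiv.coe_coe, h4]
  simp [ldualCoactMap, mul_assoc]

lemma twistedCoact_actR (h : H) (ξ : Module.Dual k H) :
    (dualTensorHomEquiv k H H).symm (Q.twistedCoact (Q.ldualActR h ξ)) =
    pairAct Q.ldualActR (LinearMap.mul k H).flip (flip (Q.Δ h)) ((dualTensorHomEquiv k H H).symm (Q.twistedCoact ξ)) := by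
  apply (dualTensorHomEquiv k H H).injective
  rw [LinearEquiv.apply_symm_apply]
  ext x
  change _ = dualTensorHom k H H _ x
  have hT : ∀ y, dualTensorHom k H H ((dualTensorHomEquiv k H H).symm (Q.twistedCoact ξ)) y =
    Q.twistedCoact ξ y := LinearMap.congr_fun ((dualTensorHomEquiv k H H).apply_symm_apply _)
  have h1 : ∀ t : H ⊗[k] H, dualTensorHom k H H (pairAct Q.ldualActR (LinearMap.mul k H).flip (flip t)
        ((dualTensorHomEquiv k H H).symm (Q.twistedCoact ξ))) x =
      TensorProduct.lid k H (ξ.rTensor H (Q.f * (Q.Δ x * ev2 (R := H ⊗[k] H)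
        (LinearMap.mulRight k Q.UR ∘ₗ Q.Δ.toLinearMap ∘ₗ Q.Sinv)
        (TensorProduct.mk k H H 1) (flip t)))) := by
    intro t
    induction t with
    | zero => simp
    | add s s' hs hs' => simp only [map_add, LinearMap.add_apply, mul_add, hs, hs']
    | tmul a b =>
      have h2 : ∀ T : Module.Dual k H ⊗[k] H, dualTensorHom k H H
          (pairAct Q.ldualActR (LinearMap.mul k H).flip (b ⊗ₜ a) T) x =
          dualTensorHom k H H T (x * Q.Sinv b) * a := fun T => by
        induction T with
        | zero => simp
        | add s s' hs hs' => simp only [map_add, LinearMap.add_apply, add_mul, hs, hs']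
        | tmul η w => simp
      have h5 : flip (a ⊗ₜ[k] b) = b ⊗ₜ a := rfl
      rw [h5, h2, hT]
      have h3 : ∀ T : H ⊗[k] H, TensorProduct.lid k H (ξ.rTensor H (T * (1 ⊗ₜ a))) =
          TensorProduct.lid k H (ξ.rTensor H T) * a := fun T => by
        induction T with
        | zero => simp
        | add s s' hs hs' => simp only [map_add, add_mul, hs, hs']
        | tmul p q => simp
      simp only [ev2_tmul, LinearMap.comp_apply,
        TensorProduct.mk_apply, ← mul_assoc, h3, LinearMap.mulRight_apply]
      simp [twistedCoact_apply, mul_assoc]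
  rw [h1, UR_comm, twistedCoact_apply]
  have h4 : ∀ T : H ⊗[k] H,
      (Q.ldualActR h ξ).rTensor H T = ξ.rTensor H (T * (Q.Sinv h ⊗ₜ 1)) := fun T => by
    induction T with
    | zero => simp
    | add s s' hs hs' => simp only [map_add, add_mul, hs, hs']
    | tmul p q => simp
  rw [h4]
  simp only [mul_assoc]

lemma rightCoinv_actR (h : H) (ξ : Module.Dual k H) :
    Q.rightCoinv (Q.ldualActR h ξ) = Q.ε h • Q.rightCoinv ξ := by
  rw [rightCoinv_eq_twistedCoact, rightCoinv_eq_twistedCoact, twistedCoact_actR]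
  generalize (dualTensorHomEquiv k H H).symm (Q.twistedCoact ξ) = T
  ext z
  induction T with
  | zero => simp
  | add s s' hs hs' => simp only [map_add, LinearMap.add_apply, smul_add, hs, hs']
  | tmul η w =>
    have h1 := congrArg (η ∘ₗ LinearMap.mulLeft k z ∘ₗ Q.Sinv ∘ₗ Q.Sinv ∘ₗ LinearMap.mulLeft k w)
      (Q.S_β h)
    rw [map_smul] at h1
    refine Eq.trans ?_ (h1.trans (by simp))
    induction Q.Δ h with
    | zero => simp
    | add s s' hs hs' => simp only [map_add, LinearMap.add_apply, hs, hs']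
    | tmul x y => simp [flip, Sinv_mul, mul_assoc]

/-- The right cointegrals form a space of dimension at most one. -/
lemma exists_rightCointegral : ∃ (Λ : H) (lam : Module.Dual k H),
    ∀ ξ, Q.rightCoinv ξ = ξ Λ • lam := by
  obtain ⟨Λ, h0, hΛ, huniq⟩ := Q.exists_rightIntegral
  obtain ⟨lam, hlam⟩ := Q.exists_of_coinvariant h0 huniq Q.rightCoinv (fun h ξ => by
    have := Q.rightCoinv_actR (Q.S h) ξ
    rw [ε_S] at this
    rw [← this]
    congr 1
    ext z
    simp)
  exact ⟨Λ, lam, hlam⟩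

end Cointegrals
end
end QuasiHopfAlgebra

namespace QuasiHopfAlgebra

noncomputable section

section CoactionWord

variable {k H : Type*} [Field k] [Ring H] [Algebra k H] {Q : QuasiHopfAlgebra k H}
  {R : Type*} [Ring R] [Algebra k R] {N : Type*} [AddCommGroup N] [Module k N]

/-! ### Morphisms of Yetter-Drinfeld modules to the unit object -/

lemma LEq.symm {K : R →ₗ[k] N} {f g : H →ₗ[k] R} (h : LEq K f g) : LEq K g f :=
  fun x X => (h x X).symm

/-- Rewriting of the word that expresses the coaction of `A_μ`, under the contractions `o a` and
`(b m) y`. -/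
lemma coaction_word {K : R →ₗ[k] N} (o a b m y x : H →ₗ[k] R) [IsRep o] [IsRep a] [IsRep b]
    [IsRep m] [IsRep y] [IsRep x] [Comm o a] [Comm o b] [Comm o m] [Comm o y] [Comm o x] [Comm a b]
    [Comm a m] [Comm a y] [Comm a x] [Comm b m] [Comm b y] [Comm b x] [Comm m y] [Comm m x]
    [Comm y x] (ho : LEq K (Q.conv o a) (Q.triv R))
    (hy : LEq K (Q.conv (Q.conv b m) y) (Q.triv R)) (X : R) :
    K (Q.phb o a x * (Q.ph a (Q.conv b m) y * Q.phb (Q.conv a (Q.conv b m)) y x) *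
      Q.ph a b m * X) = K (Q.phb (Q.conv b m) y x * Q.phb o a b *
        Q.phb o (Q.conv a b) m * Q.phb o (Q.conv (Q.conv a b) m) (Q.conv y x) * X) := by
  set c := Q.conv b m with hc
  set B := Q.conv y x with hB
  have h0 := pentagon₁ (Q := Q) a c y x
  rw [← hB] at h0
  have h1 := hy.phb_mid (f := a) (h := x) (Q.phb o a x) (Q.phb c y x * Q.ph a c B * Q.ph a b m * X)
  have h2 := LEq.phb (Q := Q) (LEq.refl K o) (LEq.refl K a) (hy.conv_triv_left x)
    (Q.phb c y x * Q.ph a c B * Q.ph a b m * X)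
  have h3 := phb_nat (Q := Q) (Q.phb c y x) (f := o) (f' := o) (g := a) (g' := a)
    (h := Q.conv c B) (h' := Q.conv (Q.conv c y) x)
  have h4 := pentagon₄ (Q := Q) o a c B
  have h5 := ho.ph_left (g := c) (h := B) (Q.phb c y x)
    (Q.phb o a c * Q.phb o (Q.conv a c) B * Q.ph a b m * X)
  have h6 := phb_nat (Q := Q) (Q.ph a b m) (f := o) (f' := o) (g := Q.conv (Q.conv a b) m)
    (g' := Q.conv a c) (h := B) (h' := B)
  have h7 := pentagon₄ (Q := Q) o a b m
  rw [← hc] at h7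
  have h8 := ho.ph_left (g := b) (h := m) (Q.phb c y x) (Q.phb o a b *
        Q.phb o (Q.conv a b) m * Q.phb o (Q.conv (Q.conv a b) m) B * X)
  calc _ = K (Q.phb o a x * Q.phb a (Q.conv c y) x *
        (Q.phb c y x * Q.ph a c B * Q.ph a b m * X)) := by rw [h0]; simp only [mul_assoc]
    _ = K (Q.phb o a (Q.conv (Q.conv c y) x) * Q.phb c y x * (Q.ph a c B * Q.ph a b m * X)) := by
      rw [h1, ← h2]; simp only [mul_assoc]
    _ = K (Q.phb c y x * (Q.phb o a (Q.conv c B) * Q.ph a c B) * (Q.ph a b m * X)) := by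
      rw [← h3]; simp only [mul_assoc]
    _ = K (Q.phb c y x * Q.ph (Q.conv o a) c B *
        (Q.phb o a c * Q.phb o (Q.conv a c) B * Q.ph a b m * X)) := by
      rw [h4]; simp only [mul_assoc]
    _ = K (Q.phb c y x * (Q.phb o a c * Q.ph a b m) *
        (Q.phb o (Q.conv (Q.conv a b) m) B * X)) := by
      rw [h5, mul_assoc (Q.phb o a c), ← h6]; simp only [mul_assoc]
    _ = K (Q.phb c y x * Q.ph (Q.conv o a) b m * (Q.phb o a b *
        Q.phb o (Q.conv a b) m * Q.phb o (Q.conv (Q.conv a b) m) B * X)) := by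
      rw [h7]; simp only [mul_assoc]
    _ = _ := by rw [h8]; simp only [mul_assoc]

end CoactionWord

section YetterDrinfeld

variable {k H : Type*} [Field k] [Ring H] [Algebra k H]
  (Q : QuasiHopfAlgebra k H)

/-- Right multiplication through the antipode on the first factor, for `H ⊗ (H ⊗ H)`. -/
abbrev eC : Rep k H (Module.End k (H ⊗[k] (H ⊗[k] H))) := lft (H ⊗[k] H) Q.RS
/-- Left multiplication on the second factor, for `H ⊗ (H ⊗ H)`. -/
abbrev eL₁ : Rep k H (Module.End k (H ⊗[k] (H ⊗[k] H))) := rgt H l1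
/-- Left multiplication on the third factor, for `H ⊗ (H ⊗ H)`. -/
abbrev eL₂ : Rep k H (Module.End k (H ⊗[k] (H ⊗[k] H))) := rgt H l2
/-- Right multiplication through the antipode on the second factor, for `H ⊗ (H ⊗ H)`. -/
abbrev eR₁ : Rep k H (Module.End k (H ⊗[k] (H ⊗[k] H))) := rgt H Q.r1
/-- Right multiplication through the antipode on the third factor, for `H ⊗ (H ⊗ H)`. -/
abbrev eR₂ : Rep k H (Module.End k (H ⊗[k] (H ⊗[k] H))) := rgt H Q.r2

/-- `x ⊗ y ↦ θ(y) x` -/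
def evalR (θ : H →ₗ[k] k) : H ⊗[k] H →ₗ[k] H := (TensorProduct.rid k H).toLinearMap ∘ₗ θ.lTensor H

@[simp] lemma evalR_tmul (θ : H →ₗ[k] k) (x y : H) : evalR θ (x ⊗ₜ y) = θ y • x := by
  simp [evalR]

/-- `c ⊗ x ⊗ y ↦ θ(y) c ⊗ x` -/
def slice (θ : H →ₗ[k] k) : H ⊗[k] (H ⊗[k] H) →ₗ[k] H ⊗[k] H := (evalR θ).lTensor H

@[simp] lemma slice_tmul (θ : H →ₗ[k] k) (x : H) (y : H ⊗[k] H) :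
    slice θ (x ⊗ₜ y) = x ⊗ₜ evalR θ y := rfl

/-- `x ⊗ y ↦ x α y` -/
def mulα : H ⊗[k] H →ₗ[k] H := LinearMap.mul' k H ∘ₗ (LinearMap.mulLeft k Q.α).lTensor H

@[simp] lemma mulα_tmul (x y : H) : Q.mulα (x ⊗ₜ y) = x * (Q.α * y) := rfl

lemma mulα_isCap (m : H ⊗[k] H) : IsCap Q Q.mulα Q.r1 l2 m :=
  IsCap.of₂ (fun a b => ⟨LinearMap.mulLeft k a ∘ₗ LinearMap.mulRight k b,
    fun x y => by simp [mul_assoc]⟩) m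

variable (θ : H →ₗ[k] k)

instance : Intw (slice θ) Q.eC Q.r1 := ⟨fun x m => by
  have : slice θ ∘ₗ Q.eC x = Q.r1 x ∘ₗ slice θ := by ext; simp
  exact LinearMap.congr_fun this m⟩

instance : Intw (slice θ) eL₁ l2 := ⟨fun x m => by
  have : slice θ ∘ₗ eL₁ x = l2 x ∘ₗ slice θ := by ext; simp
  exact LinearMap.congr_fun this m⟩

instance : Intw (slice θ) Q.eR₁ Q.r2 := ⟨fun x m => by
  have : slice θ ∘ₗ Q.eR₁ x = Q.r2 x ∘ₗ slice θ := by ext; simp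
  exact LinearMap.congr_fun this m⟩

/-- `c ⊗ u ↦ c ⊗ Δ(u) f⁻¹` -/
def gaugedΔ : H ⊗[k] H →ₗ[k] H ⊗[k] (H ⊗[k] H) :=
  (LinearMap.mulRight k Q.fInv ∘ₗ Q.Δ.toLinearMap).lTensor H

@[simp] lemma gaugedΔ_tmul (c u : H) : Q.gaugedΔ (c ⊗ₜ u) = c ⊗ₜ (Q.Δ u * Q.fInv) := rfl

lemma conv_l1_l2 (x : H) (t : H ⊗[k] H) : Q.conv l1 l2 x t = Q.Δ x * t := by
  induction t with
  | zero => simp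
  | add s s' hs hs' => simp only [map_add, mul_add, hs, hs']
  | tmul a b =>
    exact vec_ev2 (κ := LinearMap.id) (G := LinearMap.mulRight k (a ⊗ₜ b)) (fun y z => by simp) _

lemma conv_r2_r1 (x : H) (t : H ⊗[k] H) : Q.conv Q.r2 Q.r1 x t = t * Q.SSflip (Q.Δ x) := by
  induction t with
  | zero => simp
  | add s s' hs hs' => simp only [map_add, add_mul, hs, hs']
  | tmul a b =>
    exact vec_ev2 (f := Q.r2) (g := Q.r1) (κ := LinearMap.id)
      (G := LinearMap.mulLeft k (a ⊗ₜ b) ∘ₗ Q.SSflip) (fun y z => by simp) _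

lemma conv_rgt {M U : Type*} [AddCommGroup M] [Module k M] [AddCommGroup U] [Module k U]
    (f g : Rep k H (Module.End k U)) (x : H) (c : M) (t : U) :
    Q.conv (rgt M f) (rgt M g) x (c ⊗ₜ t) = c ⊗ₜ Q.conv f g x t :=
  vec_ev2 (κ := LinearMap.id) (G := TensorProduct.mk k M U c ∘ₗ LinearMap.applyₗ t ∘ₗ ev2 f g)
      (fun y z => by simp) _

instance : Intw Q.gaugedΔ Q.r1 Q.eC := ⟨fun x m => by
  have : Q.gaugedΔ ∘ₗ Q.r1 x = Q.eC x ∘ₗ Q.gaugedΔ := by ext; simp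
  exact LinearMap.congr_fun this m⟩

instance : Intw Q.gaugedΔ l2 (Q.conv eL₁ eL₂) := ⟨fun x m => by
  have : Q.gaugedΔ ∘ₗ l2 x = Q.conv eL₁ eL₂ x ∘ₗ Q.gaugedΔ := by
    ext c u; simp [conv_rgt, conv_l1_l2, mul_assoc]
  exact LinearMap.congr_fun this m⟩

instance {M N : Type*} [AddCommGroup M] [Module k M] [AddCommGroup N] [Module k N]
    (j : M →ₗ[k] N) (μ : H →ₐ[k] k) : Intw j (chr M μ) (chr N μ) := ⟨fun x m => by simp⟩

instance [FiniteDimensional k H] : Intw Q.gaugedΔ Q.r2 (Q.conv Q.eR₂ Q.eR₁) := ⟨fun x m => by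
  have : Q.gaugedΔ ∘ₗ Q.r2 x = Q.conv Q.eR₂ Q.eR₁ x ∘ₗ Q.gaugedΔ := by
    ext c u; simp [conv_rgt, conv_r2_r1, mul_assoc, fInv_SS_Δ]
  exact LinearMap.congr_fun this m⟩

variable (μ : H →ₐ[k] k)

/-- The coaction of `A_μ` as a word in commuting representations. -/
lemma adjCoact_eq (c u : H) : (Q.ph eL₁ (Q.conv eL₂ (chr _ μ)) Q.eR₂ *
    Q.phb (Q.conv eL₁ (Q.conv eL₂ (chr _ μ))) Q.eR₂ Q.eR₁ * Q.ph eL₁ eL₂ (chr _ μ))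
      (Q.gaugedΔ (c ⊗ₜ u)) = c ⊗ₜ Q.adjCoact μ u := by
  have h0 : Q.ph eL₁ (Q.conv eL₂ (chr _ μ)) Q.eR₂ *
    Q.phb (Q.conv eL₁ (Q.conv eL₂ (chr _ μ))) Q.eR₂ Q.eR₁ =
      ev4 eL₁ (Q.conv eL₂ (chr _ μ)) Q.eR₂ Q.eR₁ Q.chi := by
    rw [chi, ev4_mul, ev4_tensorOne, ev4_Δ₁]; rfl
  rw [h0, Module.End.mul_apply, ph, gaugedΔ_tmul, adjCoact, omega, LinearMap.comp_apply,
    AlgHom.toLinearMap_apply]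
  generalize Q.chi = T
  generalize Q.phi = P
  generalize Q.fInv = F
  generalize Q.Δ u = d
  induction T with
  | zero => simp
  | add s s' hs hs' => simp only [map_add, LinearMap.add_apply, hs, hs', TensorProduct.tmul_add]
  | tmul x T =>
  induction T with
  | zero => simp
  | add s s' hs hs' => simp only [map_add, LinearMap.add_apply, hs, hs', TensorProduct.tmul_add]
  | tmul y T =>
  induction T with
  | zero => simp
  | add s s' hs hs' => simp only [map_add, LinearMap.add_apply, hs, hs', TensorProduct.tmul_add]
  | tmul z w =>
  induction F with
  | zero => simp
  | add s s' hs hs' =>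
    simp only [mul_add, TensorProduct.tmul_add, map_add, hs, hs', LinearMap.comp_apply,
      TensorProduct.assoc_symm_tmul, TensorProduct.map_tmul, LinearMap.mulLeft_apply, add_mul,
      LinearMap.add_apply]
  | tmul p q =>
  induction d with
  | zero => simp
  | add s s' hs hs' => simp only [add_mul, map_add, hs, hs', TensorProduct.tmul_add]
  | tmul r s =>
  induction P with
  | zero => simp
  | add s s' hs hs' =>
    simp only [mul_add, TensorProduct.tmul_add, TensorProduct.add_tmul, map_add, hs, hs',
      LinearMap.comp_apply,
      TensorProduct.assoc_symm_tmul, TensorProduct.map_tmul, LinearMap.mulRight_apply,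
      LinearMap.add_apply]
  | tmul a P =>
  induction P with
  | zero => simp
  | add s s' hs hs' =>
    simp only [mul_add, TensorProduct.tmul_add, TensorProduct.add_tmul, map_add, hs, hs',
      LinearMap.comp_apply,
      TensorProduct.assoc_symm_tmul, TensorProduct.map_tmul, LinearMap.mulRight_apply,
      LinearMap.add_apply]
  | tmul b e =>
  simp only [ev4_tmul, ev3_tmul, ev2_tmul, Module.End.mul_apply, conv_apply, LinearMap.comp_apply,
    TensorProduct.assoc_symm_tmul, TensorProduct.map_tmul, LinearMap.lTensor_tmul,
    AlgHom.toLinearMap_apply]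
  generalize Q.Δ y = t
  induction t with
  | zero => simp
  | add s s' hs hs' =>
    simp only [TensorProduct.tmul_add, TensorProduct.add_tmul, map_add, hs, hs',
      LinearMap.mulRight_apply, LinearMap.add_apply] at *
  | tmul g h =>
    simp [flip, contractMiddle, sandwich, mul_assoc, smul_smul, mul_comm, TensorProduct.smul_tmul']
    simp [← TensorProduct.smul_tmul']

/-- `u ↦ (id ⊗ θ)(δ(u))` for the coaction `δ` of `A_μ` -/
def coactEval : H →ₗ[k] H := evalR θ ∘ₗ Q.adjCoact μ

lemma conv_adjAct (c u h : H) : Q.conv (Q.conv l2 (chr _ μ)) Q.r2 h (c ⊗ₜ u) =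
    c ⊗ₜ Q.adjAct μ h u := by
  refine vec_ev2 (κ := LinearMap.id) (G := TensorProduct.mk k H H c ∘ₗ LinearMap.applyₗ u ∘ₗ
    sandwich k H ∘ₗ
    TensorProduct.map
      ((TensorProduct.rid k H).toLinearMap ∘ₗ μ.toLinearMap.lTensor H ∘ₗ Q.Δ.toLinearMap) Q.S)
      (fun y z => ?_) _
  simp only [conv_apply, LinearMap.comp_apply, TensorProduct.map_tmul, AlgHom.toLinearMap_apply,
    LinearMap.id_apply]
  generalize Q.Δ y = t
  induction t with
  | zero => simp
  | add s s' hs hs' =>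
    simp only [TensorProduct.add_tmul, map_add, hs, hs',
      LinearMap.add_apply] at *
  | tmul g h => simp [sandwich]

/-- Invariance of `θ` under the action of `H` on `A_μ`, as a contraction. -/
lemma slice_invariant (hθ : ∀ h u, θ (Q.adjAct μ h u) = Q.ε h * θ u)
    (v : H ⊗[k] (H ⊗[k] H)) : LEq (vecK (slice θ) v) (Q.conv (Q.conv eL₂ (chr _ μ)) Q.eR₂)
      (Q.triv _) := LEq.of_vec fun x => by
  ext c a b
  have h1 : Intw (TensorProduct.mk k H (H ⊗[k] H) c) l2 eL₂ := ⟨fun x m => rfl⟩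
  have h2 : Intw (TensorProduct.mk k H (H ⊗[k] H) c) Q.r2 Q.eR₂ := ⟨fun x m => rfl⟩
  have h3 : Intw (TensorProduct.mk k H (H ⊗[k] H) c) (Q.conv (Q.conv l2 (chr _ μ)) Q.r2)
    (Q.conv (Q.conv eL₂ (chr _ μ)) Q.eR₂) := inferInstance
  have h4 := h3.eq x (a ⊗ₜ b)
  rw [conv_adjAct] at h4
  simp only [LinearMap.comp_apply, TensorProduct.AlgebraTensorModule.curry_apply,
    TensorProduct.curry_apply, LinearMap.coe_restrictScalars]
  change slice θ (Q.conv (Q.conv eL₂ (chr _ μ)) Q.eR₂ x (TensorProduct.mk k H _ c (a ⊗ₜ b))) = _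
  rw [← h4]
  simp [hθ, mul_smul]

/-- Equivariance: `h₍₁₎ P(u) S(h₍₂₎) = P(h ▷ u)` for `P = (id ⊗ θ) δ`. -/
lemma coactEval_adjAct [FiniteDimensional k H]
    (hθ : ∀ h u, θ (Q.adjAct μ h u) = Q.ε h * θ u) (c u h : H) :
    Q.conv l2 Q.r2 h (c ⊗ₜ Q.coactEval θ μ u) = c ⊗ₜ Q.coactEval θ μ (Q.adjAct μ h u) := by
  set m : Rep k H (Module.End k (H ⊗[k] (H ⊗[k] H))) := chr _ μ with hm
  set W := Q.ph eL₁ (Q.conv eL₂ m) Q.eR₂ *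
    Q.phb (Q.conv eL₁ (Q.conv eL₂ m)) Q.eR₂ Q.eR₁ * Q.ph eL₁ eL₂ m with hW
  have h1 : ∀ c u : H, slice θ (W (Q.gaugedΔ (c ⊗ₜ u))) = c ⊗ₜ Q.coactEval θ μ u := fun c u => by
    rw [hW, adjCoact_eq]; rfl
  have i1 : Inter (Q.ph eL₁ eL₂ m) (Q.conv (Q.conv (Q.conv eL₁ eL₂) m) (Q.conv Q.eR₂ Q.eR₁))
    (Q.conv (Q.conv eL₁ (Q.conv eL₂ m)) (Q.conv Q.eR₂ Q.eR₁)) := inferInstance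
  have i2 : Inter (Q.phb (Q.conv eL₁ (Q.conv eL₂ m)) Q.eR₂ Q.eR₁)
    (Q.conv (Q.conv eL₁ (Q.conv eL₂ m)) (Q.conv Q.eR₂ Q.eR₁))
    (Q.conv (Q.conv (Q.conv eL₁ (Q.conv eL₂ m)) Q.eR₂) Q.eR₁) := inferInstance
  have i3 : Inter (Q.ph eL₁ (Q.conv eL₂ m) Q.eR₂)
    (Q.conv (Q.conv (Q.conv eL₁ (Q.conv eL₂ m)) Q.eR₂) Q.eR₁)
    (Q.conv (Q.conv eL₁ (Q.conv (Q.conv eL₂ m) Q.eR₂)) Q.eR₁) := inferInstance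
  have i4 : W * Q.conv (Q.conv (Q.conv eL₁ eL₂) m) (Q.conv Q.eR₂ Q.eR₁) h =
    Q.conv (Q.conv eL₁ (Q.conv (Q.conv eL₂ m) Q.eR₂)) Q.eR₁ h * W := by
    rw [hW, mul_assoc, i1.eq, ← mul_assoc, mul_assoc _ _ (Q.conv _ _ h), i2.eq, ← mul_assoc, i3.eq]
    simp only [mul_assoc]
  have h2 : Intw Q.gaugedΔ (Q.conv (Q.conv l2 (chr _ μ)) Q.r2)
    (Q.conv (Q.conv (Q.conv eL₁ eL₂) m) (Q.conv Q.eR₂ Q.eR₁)) := inferInstance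
  have h3 : Intw (slice θ) (Q.conv eL₁ Q.eR₁) (Q.conv l2 Q.r2) := inferInstance
  have h4 := LEq.conv (Q := Q) ((Q.slice_invariant θ μ hθ (Q.gaugedΔ (c ⊗ₜ u))).conv_triv_right eL₁)
    (LEq.refl _ Q.eR₁) h W
  rw [← h1 c u, ← h3.eq, ← h1, ← conv_adjAct, h2.eq]
  rw [← hm, ← i4] at h4
  exact h4.symm

/-- The condition on `θ` that is equivalent to compatibility with the coactions, for `θ` compatible
with the actions. -/
def CoactCompat : Prop := ∀ t : H ⊗[k] H,
  Q.mulα (slice θ (Q.phb (Q.conv eL₂ (chr _ μ)) Q.eR₂ Q.eR₁ (Q.phb Q.eC eL₁ eL₂ (Q.gaugedΔ t)))) =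
    evalR θ (Q.ph Q.r1 (Q.conv l2 (chr _ μ)) Q.r2 (Q.ph Q.r1 l2 (chr _ μ) t))

lemma coactEval_word [FiniteDimensional k H] (hθ : ∀ h u, θ (Q.adjAct μ h u) = Q.ε h * θ u)
    (c u : H) : Q.mulα (Q.phb Q.r1 l2 Q.r2 (c ⊗ₜ Q.coactEval θ μ u)) =
      Q.mulα (slice θ (Q.phb (Q.conv eL₂ (chr _ μ)) Q.eR₂ Q.eR₁ (Q.phb Q.eC eL₁ eL₂ (Q.gaugedΔ
        (Q.phb Q.r1 l2 (chr _ μ) (Q.phb Q.r1 (Q.conv l2 (chr _ μ)) Q.r2 (c ⊗ₜ u))))))) := by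
  set m : Rep k H (Module.End k (H ⊗[k] (H ⊗[k] H))) := chr _ μ with hm
  set v := Q.gaugedΔ (c ⊗ₜ u) with hv
  have hcap : LEq (vecK (Q.mulα ∘ₗ slice θ) v) (Q.conv Q.eC eL₁) (Q.triv _) := by
    refine LEq.of_vec fun x => ?_
    ext c a b
    have h3 : Intw (slice θ) (Q.conv Q.eC eL₁) (Q.conv Q.r1 l2) := inferInstance
    have := h3.eq x (c ⊗ₜ (a ⊗ₜ b))
    simp only [LinearMap.comp_apply, TensorProduct.AlgebraTensorModule.curry_apply,
      TensorProduct.curry_apply, LinearMap.coe_restrictScalars]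
    rw [this, (Q.mulα_isCap _).apply]
    simp
  have hinv : LEq (vecK (Q.mulα ∘ₗ slice θ) v) (Q.conv (Q.conv eL₂ m) Q.eR₂) (Q.triv _) :=
    fun x X => congrArg Q.mulα (Q.slice_invariant θ μ hθ v x X)
  have h1 := coaction_word (Q := Q) Q.eC eL₁ eL₂ m Q.eR₂ Q.eR₁ hcap hinv 1
  have h2 : c ⊗ₜ Q.coactEval θ μ u = slice θ (c ⊗ₜ Q.adjCoact μ u) := rfl
  rw [h2, ← adjCoact_eq, ← phb_intw (slice θ) (f := Q.eC) (g := eL₁) (l := Q.eR₁),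
    phb_intw Q.gaugedΔ (f := Q.r1) (g := l2) (l := chr _ μ) (f' := Q.eC) (g' := Q.conv eL₁ eL₂)
      (l' := m),
    phb_intw Q.gaugedΔ (f := Q.r1) (g := Q.conv l2 (chr _ μ)) (l := Q.r2) (f' := Q.eC)
      (g' := Q.conv (Q.conv eL₁ eL₂) m) (l' := Q.conv Q.eR₂ Q.eR₁)]
  simp only [mul_one, mul_assoc] at h1 ⊢
  exact h1

/-- Compatibility with the coactions, for maps `θ` compatible with the actions. -/
lemma coactCompat_of_coactEval [FiniteDimensional k H]
    (hθ : ∀ h u, θ (Q.adjAct μ h u) = Q.ε h * θ u)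
    (hδ : ∀ u, Q.coactEval θ μ u = θ u • Q.β) : Q.CoactCompat θ μ := fun t => by
  set t' := Q.ph Q.r1 (Q.conv l2 (chr _ μ)) Q.r2 (Q.ph Q.r1 l2 (chr _ μ) t) with ht'
  have ht : t = Q.phb Q.r1 l2 (chr _ μ) (Q.phb Q.r1 (Q.conv l2 (chr _ μ)) Q.r2 t') := by
    rw [ht']
    simp only [← Module.End.mul_apply]
    rw [← mul_assoc (Q.phb Q.r1 (Q.conv l2 _) _), phb_mul_ph, one_mul, phb_mul_ph]
    rfl
  rw [ht]
  clear_value t'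
  clear ht ht' t
  induction t' with
  | zero => simp
  | add s s' hs hs' => simp only [map_add, hs, hs']
  | tmul c u =>
    rw [← coactEval_word Q θ μ hθ, hδ, evalR_tmul, TensorProduct.tmul_smul, map_smul, map_smul]
    congr 1
    refine Eq.trans (vec_ev3 (κ := Q.mulα) (G := LinearMap.mulLeft k c ∘ₗ LinearMap.mul' k H ∘ₗ
      TensorProduct.map Q.S (LinearMap.mul' k H ∘ₗ
          TensorProduct.map (LinearMap.mulLeft k Q.α) (LinearMap.mulLeft k Q.β ∘ₗ Q.S)))
          (fun x y z => ?_) Q.phiInv) ((congrArg (LinearMap.mulLeft k c) Q.antipode_φ_inv).trans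
            (mul_one c))
    simp [mul_assoc]

lemma coactEval_of_coactCompat [FiniteDimensional k H]
    (hθ : ∀ h u, θ (Q.adjAct μ h u) = Q.ε h * θ u)
    (hc : Q.CoactCompat θ μ) (u : H) : Q.coactEval θ μ u = θ u • Q.β := by
  have h1 : ∀ c u, Q.mulα (Q.phb Q.r1 l2 Q.r2 (c ⊗ₜ Q.coactEval θ μ u)) = θ u • c := fun c u => by
    rw [coactEval_word Q θ μ hθ, hc]
    simp only [← Module.End.mul_apply]
    rw [← mul_assoc (Q.ph Q.r1 l2 _), ph_mul_phb, one_mul, ph_mul_phb]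
    simp
  set v := Q.β ⊗ₜ[k] Q.coactEval θ μ u with hv
  have hcap := LEq.of_isCap Q.mulα_isCap v
  have hcup : REq (vecK Q.mulα v) (Q.conv l1 Q.r1) (Q.triv _) :=
    REq.of_cup ((TensorProduct.mk k H H).flip (Q.coactEval θ μ u))
      (fun x y => by simp [hv, mul_assoc])
  have h2 := zigzag_word (Q := Q) l1 Q.r1 l2 Q.r2 hcup hcap 1
  rw [one_mul, one_mul] at h2
  have h3 : Q.mulα (Q.ph l1 Q.r1 l2 v) = Q.coactEval θ μ u := by
    refine Eq.trans (vec_ev3 (G := LinearMap.mulRight k (Q.coactEval θ μ u) ∘ₗ LinearMap.mul' k H ∘ₗ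
      (TensorProduct.map (LinearMap.mulRight k Q.β)
        (LinearMap.mul' k H ∘ₗ TensorProduct.map Q.S (LinearMap.mulLeft k Q.α))))
        (fun x y z => ?_) Q.phi) ((congrArg (LinearMap.mulRight k (Q.coactEval θ μ u))
          Q.antipode_φ).trans (one_mul _))
    simp [hv, mul_assoc]
  have h4 : Q.mulα (Q.phb Q.r1 l2 Q.r2 (Q.ph l1 Q.r1 (Q.conv l2 Q.r2) v)) = θ u • Q.β := by
    have h5 := ph_triv_right (Q := Q) l1 Q.r1
    refine Eq.trans (vec_ev3 (κ := Q.mulα ∘ₗ Q.phb Q.r1 l2 Q.r2) (G := θ u • (evalR Q.ε.toLinearMap ∘ₗ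
      LinearMap.applyₗ (Q.β ⊗ₜ[k] (1 : H)) ∘ₗ ev3 l1 Q.r1 (Q.triv _))) (fun x y z => ?_) Q.phi) ?_
    · rw [hv, coactEval_adjAct Q θ μ hθ]
      simp [h1, hθ, smul_smul, mul_comm]
    · rw [LinearMap.smul_apply, LinearMap.comp_apply, LinearMap.comp_apply]
      rw [ph] at h5
      rw [h5]
      simp
  exact h3.symm.trans (h2.symm.trans h4)

end YetterDrinfeld
end
end QuasiHopfAlgebra

namespace QuasiHopfAlgebra

noncomputable section

section Uniqueness

variable {k H : Type*} [Field k] [Ring H] [Algebra k H] {Q : QuasiHopfAlgebra k H}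

/-! ### Recovering a categorical cointegral from its right cointegral -/

lemma rgt_conv {M U : Type*} [AddCommGroup M] [Module k M] [AddCommGroup U] [Module k U]
    (f g : Rep k H (Module.End k U)) : rgt M (Q.conv f g) = Q.conv (rgt M f) (rgt M g) := by
  ext x c t
  simp [conv_rgt]

lemma rgt_chr {M U : Type*} [AddCommGroup M] [Module k M] [AddCommGroup U] [Module k U]
    (μ : H →ₐ[k] k) : rgt M (chr U μ) = chr (M ⊗[k] U) μ := by
  ext x c t
  simp

/-- Tensoring with the character `μ` amounts to `x ↦ f(x₍₁₎) μ(x₍₂₎)`. -/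
lemma conv_chr {M : Type*} [AddCommGroup M] [Module k M] (μ : H →ₐ[k] k)
    (f : Rep k H (Module.End k M)) (x : H) :
    Q.conv f (chr M μ) x = f (evalR μ.toLinearMap (Q.Δ x)) := by
  rw [conv_apply]
  induction Q.Δ x with
  | zero => simp
  | add s s' hs hs' => simp only [map_add, hs, hs']
  | tmul a b => ext; simp

lemma LEq.of_rgt {M U N₀ N : Type*} [AddCommGroup M] [Module k M] [AddCommGroup U] [Module k U]
    [AddCommGroup N₀] [Module k N₀] [AddCommGroup N] [Module k N] {κ : U →ₗ[k] N₀}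
    {f : Rep k H (Module.End k U)} (h : ∀ u, LEq (vecK κ u) f (Q.triv _)) (B : M ⊗[k] N₀ →ₗ[k] N)
    (v : M ⊗[k] U) : LEq (vecK (B ∘ₗ κ.lTensor M) v) (rgt M f) (Q.triv _) := LEq.of_vec fun x => by
  ext m u
  have := h u x 1
  simp only [mul_one, vecK_apply, triv_End_apply, map_smul] at this
  simp [this]

instance Intw.rgt {M U U' : Type*} [AddCommGroup M] [Module k M] [AddCommGroup U] [Module k U]
    [AddCommGroup U'] [Module k U'] {j : U →ₗ[k] U'} {f : Rep k H (Module.End k U)}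
    {f' : Rep k H (Module.End k U')} [h : Intw j f f'] :
    Intw (j.lTensor M) (rgt M f) (QuasiHopfAlgebra.rgt M f') := ⟨fun x m => by
  have : j.lTensor M ∘ₗ QuasiHopfAlgebra.rgt M f x = QuasiHopfAlgebra.rgt M f' x ∘ₗ j.lTensor M := by
    ext; simp [h.eq]
  exact LinearMap.congr_fun this m⟩

instance Intw.lft {M U U' : Type*} [AddCommGroup M] [Module k M] [AddCommGroup U] [Module k U]
    [AddCommGroup U'] [Module k U'] {j : U →ₗ[k] U'} {f : Rep k H (Module.End k M)} :
    Intw (j.lTensor M) (lft U f) (QuasiHopfAlgebra.lft U' f) := ⟨fun x m => by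
  have : j.lTensor M ∘ₗ QuasiHopfAlgebra.lft U f x = QuasiHopfAlgebra.lft U' f x ∘ₗ j.lTensor M := by
    ext; simp
  exact LinearMap.congr_fun this m⟩

variable (Q) (θ : H →ₗ[k] k) (μ : H →ₐ[k] k)

/-- `a ⊗ c ↦ θ(a S(c))` -/
def evalMulS : H ⊗[k] H →ₗ[k] k := θ ∘ₗ LinearMap.mul' k H ∘ₗ Q.S.lTensor H

@[simp] lemma evalMulS_tmul (a c : H) : Q.evalMulS θ (a ⊗ₜ c) = θ (a * Q.S c) := rfl

/-- The functional `x ↦ μ(φ̄₁₍₂₎) θ(φ̄₁₍₁₎ S(x) S(φ̄₂ β S(φ̄₃)))`, whose associated right cointegral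
gives back `θ`. -/
def preCointegral : Module.Dual k H :=
  Q.evalMulS θ ∘ₗ Q.phb (Q.conv l1 (chr _ μ)) l2 Q.r2 ∘ₗ (TensorProduct.mk k H H).flip Q.β ∘ₗ Q.S

/-- `a ⊗ c ⊗ x ↦ θ(a S(c α x))` -/
def evalMulSα : H ⊗[k] (H ⊗[k] H) →ₗ[k] k := Q.evalMulS θ ∘ₗ Q.mulα.lTensor H

@[simp] lemma evalMulSα_tmul (a c x : H) :
    Q.evalMulSα θ (a ⊗ₜ (c ⊗ₜ x)) = θ (a * Q.S (c * (Q.α * x))) := rfl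

section

variable {θ μ}

lemma evalMulSα_invariant (hθ : ∀ h u, θ (Q.adjAct μ h u) = Q.ε h * θ u)
    (v : H ⊗[k] (H ⊗[k] H)) : LEq (vecK (Q.evalMulSα θ) v)
      (Q.conv (Q.conv (lft (H ⊗[k] H) (Lm k H)) (chr _ μ)) (rgt H l1)) (Q.triv _) :=
  LEq.of_vec fun x => by
  ext a c y
  set j : H ⊗[k] (H ⊗[k] H) →ₗ[k] H ⊗[k] H := TensorProduct.mk k H H 1 ∘ₗ LinearMap.mul' k H ∘ₗ
    (Q.S ∘ₗ Q.mulα).lTensor H with hj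
  have h1 : Intw j (lft (H ⊗[k] H) (Lm k H)) l2 := ⟨fun x m => by
    have : j ∘ₗ lft (H ⊗[k] H) (Lm k H) x = l2 x ∘ₗ j := by ext; simp [hj, mul_assoc]
    exact LinearMap.congr_fun this m⟩
  have h2 : Intw j (rgt H l1) Q.r2 := ⟨fun x m => by
    have : j ∘ₗ rgt H l1 x = Q.r2 x ∘ₗ j := by ext; simp [hj, Q.S_mul, mul_assoc]
    exact LinearMap.congr_fun this m⟩
  have h3 : Intw j (Q.conv (Q.conv (lft (H ⊗[k] H) (Lm k H)) (chr _ μ)) (rgt H l1))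
    (Q.conv (Q.conv l2 (chr _ μ)) Q.r2) := inferInstance
  have h4 := h3.eq x (a ⊗ₜ (c ⊗ₜ y))
  have h5 : Q.evalMulSα θ = θ ∘ₗ (TensorProduct.lid k H).toLinearMap ∘ₗ
      Q.ε.toLinearMap.rTensor H ∘ₗ j := by
    ext; simp [hj]
  simp only [LinearMap.comp_apply, TensorProduct.AlgebraTensorModule.curry_apply,
    TensorProduct.curry_apply, LinearMap.coe_restrictScalars, h5]
  rw [h4]
  have h6 : j (a ⊗ₜ (c ⊗ₜ y)) = 1 ⊗ₜ (a * Q.S (c * (Q.α * y))) := rfl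
  rw [h6, conv_adjAct]
  simp [hθ, h6]

/-- `l(S(h) α S̄(a)) = θ(h₍₁₎ a) μ(h₍₂₎)` for the functional `l` attached to `θ`. -/
lemma preCointegral_apply [FiniteDimensional k H]
    (hθ : ∀ h u, θ (Q.adjAct μ h u) = Q.ε h * θ u) (h a : H) :
    Q.preCointegral θ μ (Q.S h * Q.α * Q.Sinv a) = θ (evalR μ.toLinearMap (Q.Δ h) * a) := by
  set A : Rep k H (Module.End k (H ⊗[k] (H ⊗[k] H))) :=
    Q.conv (lft (H ⊗[k] H) (Lm k H)) (chr _ μ) with hA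
  set p : Rep k H (Module.End k (H ⊗[k] (H ⊗[k] H))) := rgt H l1 with hp
  set d : Rep k H (Module.End k (H ⊗[k] (H ⊗[k] H))) := rgt H Q.r1 with hd
  set r : Rep k H (Module.End k (H ⊗[k] (H ⊗[k] H))) := rgt H l2 with hr
  have hA' : ∀ (x : H) (a : H) (t : H ⊗[k] H), A x (a ⊗ₜ t) =
      (evalR μ.toLinearMap (Q.Δ x) * a) ⊗ₜ t := fun x a t => by
    rw [hA, conv_chr]; rfl
  have hAp : ∀ v, LEq (vecK (Q.evalMulSα θ) v) (Q.conv A p) (Q.triv _) :=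
    Q.evalMulSα_invariant hθ
  have hdr : ∀ v, LEq (vecK (Q.evalMulSα θ) v) (Q.conv d r) (Q.triv _) := fun v =>
    LEq.of_isCap (IsCap.of₃ fun a b c => ⟨θ ∘ₗ LinearMap.mulLeft k a ∘ₗ Q.S ∘ₗ LinearMap.mulLeft k b ∘ₗ
      LinearMap.mulRight k c, fun x y => by simp [hd, hr, mul_assoc]⟩) v
  have hpd : ∀ a, REq (vecK (Q.evalMulSα θ) (a ⊗ₜ[k] (Q.β ⊗ₜ[k] 1))) (Q.conv p d) (Q.triv _) := fun a =>
    REq.of_cup (TensorProduct.mk k _ _ a ∘ₗ (TensorProduct.mk k H H).flip 1)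
      (fun x y => by simp [hp, hd, mul_assoc])
  -- the word `A p d` acts as the identity
  have h1 : ∀ a, Q.evalMulSα θ (Q.phb A p d (a ⊗ₜ[k] (Q.β ⊗ₜ[k] 1))) = θ a := fun a => by
    set v := a ⊗ₜ[k] (Q.β ⊗ₜ[k] (1 : H)) with hv
    have e1 := pentagon₃ (Q := Q) A p d r
    have e2 := (hAp v).phb_left (g := d) (h := r) 1
      (Q.phb A p (Q.conv d r) * (Q.ph p d r * Q.ph A (Q.conv p d) r))
    have e3 := (hdr v).phb_right (f := A) (g := p) 1 (Q.ph p d r * Q.ph A (Q.conv p d) r)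
    have e4 := (hpd a).ph_mid (f := A) (h := r) (Q.ph p d r) 1
    have e5 : Q.phb A p d = 1 * Q.phb (Q.conv A p) d r * (Q.phb A p (Q.conv d r) *
        (Q.ph p d r * Q.ph A (Q.conv p d) r)) := by
      rw [one_mul, ← mul_assoc, ← e1]
      simp only [mul_assoc]
      rw [← mul_assoc (Q.phb p d r), phb_mul_ph, one_mul, phb_mul_ph, mul_one]
    have e6 : vecK (Q.evalMulSα θ) v (Q.ph p d r) = θ a := by
      refine Eq.trans (vec_ev3 (κ := Q.evalMulSα θ) (v := v) (G := θ ∘ₗ LinearMap.mulLeft k a ∘ₗ Q.S ∘ₗ LinearMap.mul' k H ∘ₗ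
        (TensorProduct.map (LinearMap.mulRight k Q.β)
          (LinearMap.mul' k H ∘ₗ TensorProduct.map Q.S (LinearMap.mulLeft k Q.α))))
          (fun x y z => ?_) Q.phi) ((congrArg (θ ∘ₗ LinearMap.mulLeft k a ∘ₗ Q.S) Q.antipode_φ).trans
            (by simp [Q.S_one]))
      simp [hv, hp, hd, hr, mul_assoc]
    have e7 : vecK (Q.evalMulSα θ) v (Q.phb A p d) = θ a := by
      rw [e5, e2, ← mul_assoc, e3, one_mul, ← mul_one (Q.ph p d r * _), e4, mul_one, e6]
    exact e7
  have h2 : Q.evalMulSα θ (d h (Q.phb A p d (a ⊗ₜ[k] (Q.β ⊗ₜ[k] 1)))) =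
      Q.evalMulSα θ (Q.phb A p d (A h (a ⊗ₜ[k] (Q.β ⊗ₜ[k] 1)))) := by
    have e1 := congrArg (fun X => vecK (Q.evalMulSα θ) (a ⊗ₜ[k] (Q.β ⊗ₜ[k] 1)) X)
      (conv_assoc' (Q := Q) A p d h)
    have e2 := (hAp (a ⊗ₜ[k] (Q.β ⊗ₜ[k] 1))).conv_triv_left d h (Q.phb A p d)
    have e3 := (hpd a).conv_triv_right A h (Q.phb A p d)
    exact e2.symm.trans (e1.symm.trans e3)
  rw [hA', h1] at h2
  rw [← h2]
  have h3 : ∀ T, Q.evalMulS θ (ev3 (Q.conv l1 (chr _ μ)) l2 Q.r2 T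
      ((a * Q.S Q.α * Q.S (Q.S h)) ⊗ₜ Q.β)) =
      Q.evalMulSα θ (d h (ev3 A p d T (a ⊗ₜ[k] (Q.β ⊗ₜ[k] 1)))) := fun T => by
    refine vec_ev3 (κ := Q.evalMulS θ) (G := Q.evalMulSα θ ∘ₗ d h ∘ₗ LinearMap.applyₗ (a ⊗ₜ[k] (Q.β ⊗ₜ[k] 1)) ∘ₗ ev3 A p d)
      (fun x y z => ?_) T
    simp only [LinearMap.comp_apply, ev3_tmul, ev2_tmul, LinearMap.applyₗ_apply_apply,
      Module.End.mul_apply, conv_chr]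
    simp [hA', hp, hd, Q.S_mul, mul_assoc]
  refine Eq.trans ?_ (h3 Q.phiInv)
  simp [preCointegral, Q.S_mul, mul_assoc, phb]

/-- The product of `f Δ(α S̄(u)) Uᴿ` in terms of `Δ(u) f⁻¹`. -/
lemma f_mul_Δ_mul_UR [FiniteDimensional k H] (u : H) :
    Q.f * (Q.Δ (Q.α * Q.Sinv u) * Q.UR) =
      Q.aElt * Q.SinvSinvflip (Q.qL * (Q.Δ u * Q.fInv)) := by
  have h1 : Q.Δ (Q.Sinv u) * Q.UR = Q.SinvSinvflip (Q.qL * (Q.Δ u * Q.fInv)) := by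
    apply Q.SSflip_injective
    rw [SSflip_SinvSinvflip, SSflip_mul, UR, SSflip_SinvSinvflip, mul_assoc, Δ_Sinv]
  rw [map_mul, mul_assoc, ← mul_assoc Q.f, f_Δ_α, h1]

end

end Uniqueness
end
end QuasiHopfAlgebra

namespace QuasiHopfAlgebra

noncomputable section

section UniquenessWords

variable {k H : Type*} [Field k] [Ring H] [Algebra k H] {Q : QuasiHopfAlgebra k H}
  {R : Type*} [Ring R] [Algebra k R] {N : Type*} [AddCommGroup N] [Module k N]

/-! ### Words for the right cointegral of a categorical cointegral -/

/-- Moving an associator to the right, past one whose first two strands are contracted. -/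
lemma slide_word {K : R →ₗ[k] N} (s o a b m y x : H →ₗ[k] R) [IsRep s] [IsRep o] [IsRep a] [IsRep b]
    [IsRep m] [IsRep y] [IsRep x] [Comm s o] [Comm s a] [Comm s b] [Comm s m] [Comm s y] [Comm s x]
    [Comm o a] [Comm o b] [Comm o m] [Comm o y] [Comm o x] [Comm a b]
    [Comm a m] [Comm a y] [Comm a x] [Comm b m] [Comm b y] [Comm b x] [Comm m y] [Comm m x]
    [Comm y x] (ho : LEq K (Q.conv o a) (Q.triv R)) (X : R) :
    K (Q.phb (Q.conv b m) y x * Q.ph s (Q.conv b m) (Q.conv y x) * Q.phb o a b * X) =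
      K (Q.phb (Q.conv b m) y x * Q.phb o a b *
        Q.ph s (Q.conv (Q.conv o (Q.conv a b)) m) (Q.conv y x) * X) := by
  set W := Q.phb (Q.conv b m) y x with hW
  have h1 : LEq (K ∘ₗ LinearMap.mulLeft k W) (Q.conv (Q.conv (Q.conv o a) b) m) (Q.conv b m) :=
    LEq.conv ((ho.comp W).conv_triv_left b) (LEq.refl _ m)
  have h2 := LEq.ph (Q := Q) (LEq.refl _ s) h1 (LEq.refl _ (Q.conv y x)) (Q.phb o a b * X)
  have h3 := ph_nat (Q := Q) (Q.phb o a b) (f := s) (f' := s)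
    (g := Q.conv (Q.conv o (Q.conv a b)) m) (g' := Q.conv (Q.conv (Q.conv o a) b) m)
    (h := Q.conv y x) (h' := Q.conv y x)
  simp only [LinearMap.comp_apply, LinearMap.mulLeft_apply] at h2
  rw [mul_assoc, mul_assoc, ← h2, ← mul_assoc (Q.ph _ _ _), ← h3]
  simp only [mul_assoc]

lemma contract_word {K : R →ₗ[k] N} (s o b m y : H →ₗ[k] R) [IsRep s] [IsRep o] [IsRep b]
    [IsRep m] [IsRep y] [Comm s o] [Comm s b] [Comm s m] [Comm s y]
    [Comm o b] [Comm o m] [Comm o y] [Comm b m] [Comm b y] [Comm m y]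
    (hs : LEq K (Q.conv s o) (Q.triv R)) (hy : LEq K (Q.conv (Q.conv b m) y) (Q.triv R)) (X : R) :
    K (Q.ph o (Q.conv b m) y * Q.ph o b m * Q.ph s (Q.conv (Q.conv o b) m) y * X) =
      K (Q.phb s o (Q.conv b m) * Q.ph o b m * X) := by
  have h1 := ph_nat (Q := Q) (Q.ph o b m) (f := s) (f' := s)
    (g := Q.conv (Q.conv o b) m) (g' := Q.conv o (Q.conv b m)) (h := y) (h' := y)
  have h2 : Q.ph o (Q.conv b m) y * Q.ph s (Q.conv o (Q.conv b m)) y =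
      Q.ph s o (Q.conv (Q.conv b m) y) * Q.ph (Q.conv s o) (Q.conv b m) y *
        Q.phb s o (Q.conv b m) := by
    rw [pentagon' s o (Q.conv b m) y]
    simp only [mul_assoc]
    rw [ph_mul_phb, mul_one]
  have h3 := hy.ph_right (f := s) (g := o) 1 (Q.ph (Q.conv s o) (Q.conv b m) y *
        Q.phb s o (Q.conv b m) * Q.ph o b m * X)
  have h4 := hs.ph_left (g := Q.conv b m) (h := y) 1 (Q.phb s o (Q.conv b m) * Q.ph o b m * X)
  rw [mul_assoc _ (Q.ph o b m) (Q.ph _ _ _), h1, ← mul_assoc, h2]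
  simp only [one_mul, mul_assoc] at h3 h4 ⊢
  rw [h3, h4]

end UniquenessWords

section Uniqueness

variable {k H : Type*} [Field k] [Ring H] [Algebra k H] [FiniteDimensional k H]
  (Q : QuasiHopfAlgebra k H) (θ : H →ₗ[k] k) (μ : H →ₐ[k] k)

/-- `x ⊗ r ↦ r S(α) S²(x)` -/
def mulSαSS : H ⊗[k] H →ₗ[k] H :=
  LinearMap.mul' k H ∘ₗ flip ∘ₗ (LinearMap.mulLeft k (Q.S Q.α) ∘ₗ Q.S ∘ₗ Q.S).rTensor H

omit [FiniteDimensional k H] in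
@[simp] lemma mulSαSS_tmul (x r : H) : Q.mulSαSS (x ⊗ₜ r) = r * (Q.S Q.α * Q.S (Q.S x)) := rfl

omit [FiniteDimensional k H] in
instance {M U : Type*} [AddCommGroup M] [Module k M] [AddCommGroup U] [Module k U] (x : M)
    {f : Rep k H (Module.End k U)} : Intw (TensorProduct.mk k M U x) f (rgt M f) :=
  ⟨fun _ _ => rfl⟩

instance : Intw (Q.contrα H) eL₂ l2 := ⟨fun x m => by
  have : Q.contrα H ∘ₗ eL₂ x = l2 x ∘ₗ Q.contrα H := by ext; simp
  exact LinearMap.congr_fun this m⟩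

instance : Intw (Q.contrα H) Q.eR₁ Q.r1 := ⟨fun x m => by
  have : Q.contrα H ∘ₗ Q.eR₁ x = Q.r1 x ∘ₗ Q.contrα H := by ext; simp [mul_assoc]
  exact LinearMap.congr_fun this m⟩

instance : Intw (Q.contrα H) Q.eR₂ Q.r2 := ⟨fun x m => by
  have : Q.contrα H ∘ₗ Q.eR₂ x = Q.r2 x ∘ₗ Q.contrα H := by ext; simp
  exact LinearMap.congr_fun this m⟩

variable {θ μ}

/-- The twisted coaction of the functional attached to `θ`, as a word. -/
lemma S_twistedCoact (hθ : ∀ h u, θ (Q.adjAct μ h u) = Q.ε h * θ u) (u : H) :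
    Q.S (Q.twistedCoact (Q.preCointegral θ μ) (Q.α * Q.Sinv u)) =
      Q.mulSαSS ((Q.mulα ∘ₗ slice θ).lTensor H
        (Q.phb (Q.conv (rgt H eL₂) (chr _ μ)) (rgt H Q.eR₂) (rgt H Q.eR₁)
        (Q.ph (lft _ (Lm k H)) (Q.conv (rgt H eL₂) (chr _ μ)) (Q.conv (rgt H Q.eR₂) (rgt H Q.eR₁))
        (Q.phb (rgt H Q.eC) (rgt H eL₁) (rgt H eL₂) (1 ⊗ₜ (1 ⊗ₜ (Q.Δ u * Q.fInv))))))) := by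
  set m : Rep k H (Module.End k (H ⊗[k] (H ⊗[k] H))) := chr _ μ with hm
  set s : Rep k H (Module.End k (H ⊗[k] (H ⊗[k] H))) := lft _ (Lm k H) with hs
  have h1 : ∀ W : H ⊗[k] H, Q.S (TensorProduct.lid k H ((Q.preCointegral θ μ).rTensor H
      (Q.aElt * Q.SinvSinvflip W))) = Q.mulSαSS ((evalR θ).lTensor H (Q.phb (Q.conv eL₂ m) Q.eR₂ Q.eR₁
        (Q.ph s (Q.conv eL₂ m) (Q.conv Q.eR₂ Q.eR₁) (1 ⊗ₜ W)))) := fun W => by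
    have h0 : Q.phb (Q.conv eL₂ m) Q.eR₂ Q.eR₁ * Q.ph s (Q.conv eL₂ m) (Q.conv Q.eR₂ Q.eR₁) =
        ev4 s (Q.conv eL₂ m) Q.eR₂ Q.eR₁ (((1 : H) ⊗ₜ[k] Q.phiInv) * Q.Δ₃ Q.phi) := by
      rw [ev4_mul, ev4_one_tmul, ev4_Δ₃]; rfl
    rw [← Module.End.mul_apply, h0, aElt]
    induction W with
    | zero => simp
    | add w w' hw hw' => simp only [map_add, mul_add, TensorProduct.tmul_add, hw, hw']
    | tmul w₁ w₂ =>
      refine (vec_ev4 (κ := Q.mulSαSS ∘ₗ (evalR θ).lTensor H) (G := Q.S ∘ₗ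
        (TensorProduct.lid k H).toLinearMap ∘ₗ (Q.preCointegral θ μ).rTensor H ∘ₗ
        LinearMap.mulRight k (Q.SinvSinvflip (w₁ ⊗ₜ w₂)) ∘ₗ TensorProduct.map Q.mulSα Q.mulSα ∘ₗ
        perm2314) (fun x y z w => ?_) _).symm
      have h2 := Q.preCointegral_apply hθ y (w₂ * Q.S z)
      rw [Sinv_mul, Sinv_S] at h2
      have h3 : ∀ t, Q.conv eL₂ m y t = eL₂ (evalR μ.toLinearMap (Q.Δ y)) t := fun t => by
        rw [hm, conv_chr]
      simp only [← mul_assoc] at h2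
      simp [hs, h3, perm2314, mulSα, Q.S_mul, ← mul_assoc, h2]
  have h2 : Q.contrα H (Q.phb Q.eC eL₁ eL₂ ((1 : H) ⊗ₜ (Q.Δ u * Q.fInv))) =
      Q.qL * (Q.Δ u * Q.fInv) := by
    refine (Q.contrα_phb (Lm k H) (Q.Δ u * Q.fInv) 1 Q.phiInv).trans ?_
    rw [act2_Lm, IsRep.one]
    rfl
  have h3 : (Q.mulα ∘ₗ slice θ).lTensor H = (evalR θ).lTensor H ∘ₗ (Q.contrα H).lTensor H := by
    ext; simp
  have h4 : Q.phb (rgt H Q.eC) (rgt H eL₁) (rgt H eL₂) ((1 : H) ⊗ₜ ((1 : H) ⊗ₜ (Q.Δ u * Q.fInv))) =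
      1 ⊗ₜ Q.phb Q.eC eL₁ eL₂ ((1 : H) ⊗ₜ (Q.Δ u * Q.fInv)) := by
    refine (phb_intw (TensorProduct.mk k H _ 1) (f := Q.eC) (g := eL₁) (l := eL₂)
      (f' := rgt H Q.eC) (g' := rgt H eL₁) (l' := rgt H eL₂) _).symm
  rw [twistedCoact_apply, f_mul_Δ_mul_UR, h1, ← h2, h3, LinearMap.comp_apply, h4,
    phb_intw ((Q.contrα H).lTensor H) (f' := Q.conv eL₂ m) (g' := Q.eR₂) (l' := Q.eR₁),
    ph_intw ((Q.contrα H).lTensor H) (f' := s) (g' := Q.conv eL₂ m) (l' := Q.conv Q.eR₂ Q.eR₁)]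
  rfl

/-- For a categorical cointegral `θ`, the twisted coaction of the associated functional. -/
lemma S_twistedCoact_eq (hθ : ∀ h u, θ (Q.adjAct μ h u) = Q.ε h * θ u)
    (hc : Q.CoactCompat θ μ) (u : H) :
    Q.S (Q.twistedCoact (Q.preCointegral θ μ) (Q.α * Q.Sinv u)) =
      Q.mulSαSS ((evalR θ).lTensor H (Q.phb (lft _ (Lm k H)) (rgt H Q.r1)
        (Q.conv (rgt H l2) (chr _ μ)) (Q.ph (rgt H Q.r1) (rgt H l2) (chr _ μ)
        (1 ⊗ₜ (1 ⊗ₜ u))))) := by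
  set m : Rep k H (Module.End k (H ⊗[k] (H ⊗[k] (H ⊗[k] H)))) := chr _ μ with hm
  set s : Rep k H (Module.End k (H ⊗[k] (H ⊗[k] (H ⊗[k] H)))) := lft _ (Lm k H) with hs
  set m' : Rep k H (Module.End k (H ⊗[k] (H ⊗[k] H))) := chr _ μ with hm'
  set s' : Rep k H (Module.End k (H ⊗[k] (H ⊗[k] H))) := lft _ (Lm k H) with hs'
  set J := (Q.gaugedΔ).lTensor H with hJ
  set v : H ⊗[k] (H ⊗[k] H) := 1 ⊗ₜ (1 ⊗ₜ u) with hv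
  set κ := Q.mulSαSS ∘ₗ (Q.mulα ∘ₗ slice θ).lTensor H with hκ
  set κ' := Q.mulSαSS ∘ₗ (evalR θ).lTensor H with hκ'
  have i2 : Intw J (rgt H l2) (Q.conv (rgt H eL₁) (rgt H eL₂)) := by
    rw [← rgt_conv]; infer_instance
  have i4 : Intw J (rgt H Q.r2) (Q.conv (rgt H Q.eR₂) (rgt H Q.eR₁)) := by
    rw [← rgt_conv]; infer_instance
  have ho : LEq (vecK κ (J v)) (Q.conv (rgt H Q.eC) (rgt H eL₁)) (Q.triv _) := by
    rw [← rgt_conv]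
    refine LEq.of_rgt (fun w => LEq.of_vec fun x => ?_) _ _
    ext c a b
    have h3 : Intw (slice θ) (Q.conv Q.eC eL₁) (Q.conv Q.r1 l2) := inferInstance
    have := h3.eq x (c ⊗ₜ (a ⊗ₜ b))
    simp only [LinearMap.comp_apply, TensorProduct.AlgebraTensorModule.curry_apply,
      TensorProduct.curry_apply, LinearMap.coe_restrictScalars]
    rw [this, (Q.mulα_isCap _).apply]
    simp
  have hs1 : LEq (vecK κ' v) (Q.conv s' (rgt H Q.r1)) (Q.triv _) :=
    LEq.of_isCap (IsCap.of₃ fun a b c => ⟨θ c • (LinearMap.mulLeft k b ∘ₗ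
      LinearMap.mulRight k (Q.S (Q.S a)) ∘ₗ Q.S),
      fun x y => by simp [hκ', hs', Q.S_mul, mul_assoc]⟩) v
  have hy : LEq (vecK κ' v) (Q.conv (Q.conv (rgt H l2) m') (rgt H Q.r2)) (Q.triv _) := by
    rw [hm', ← rgt_chr, ← rgt_conv, ← rgt_conv]
    refine LEq.of_rgt (fun w => LEq.of_vec fun x => ?_) _ _
    ext c a
    simp [conv_adjAct, hθ, mul_smul]
  have h1 := slide_word (Q := Q) s (rgt H Q.eC) (rgt H eL₁) (rgt H eL₂) m (rgt H Q.eR₂) (rgt H Q.eR₁)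
    ho 1
  have h2 := contract_word (Q := Q) s' (rgt H Q.r1) (rgt H l2) m' (rgt H Q.r2) hs1 hy 1
  -- compatibility with the coactions, with a further tensor factor
  have h3 : ∀ t, κ (Q.phb (Q.conv (rgt H eL₂) m) (rgt H Q.eR₂) (rgt H Q.eR₁)
      (Q.phb (rgt H Q.eC) (rgt H eL₁) (rgt H eL₂) (J t))) =
      κ' (Q.ph (rgt H Q.r1) (Q.conv (rgt H l2) m') (rgt H Q.r2) (Q.ph (rgt H Q.r1) (rgt H l2) m' t)) := by
    intro t
    induction t with
    | zero => simp
    | add w w' hw hw' => simp only [map_add, hw, hw']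
    | tmul x t =>
      have e1 : ∀ w : H ⊗[k] (H ⊗[k] H), Q.phb (rgt H Q.eC) (rgt H eL₁) (rgt H eL₂) (x ⊗ₜ w) =
          x ⊗ₜ Q.phb Q.eC eL₁ eL₂ w := fun w =>
        (phb_intw (TensorProduct.mk k H _ x) (f := Q.eC) (g := eL₁) (l := eL₂)
          (f' := rgt H Q.eC) (g' := rgt H eL₁) (l' := rgt H eL₂) _).symm
      have e2 : ∀ w : H ⊗[k] (H ⊗[k] H), Q.phb (Q.conv (rgt H eL₂) m) (rgt H Q.eR₂) (rgt H Q.eR₁)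
          (x ⊗ₜ w) = x ⊗ₜ Q.phb (Q.conv eL₂ (chr _ μ)) Q.eR₂ Q.eR₁ w := fun w =>
        (phb_intw (TensorProduct.mk k H _ x) (f := Q.conv eL₂ (chr _ μ)) (g := Q.eR₂) (l := Q.eR₁)
          (f' := Q.conv (rgt H eL₂) m) (g' := rgt H Q.eR₂) (l' := rgt H Q.eR₁) _).symm
      have e3 : ∀ w : H ⊗[k] H, Q.ph (rgt H Q.r1) (rgt H l2) m' (x ⊗ₜ w) =
          x ⊗ₜ Q.ph Q.r1 l2 (chr _ μ) w := fun w =>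
        (ph_intw (TensorProduct.mk k H _ x) (f := Q.r1) (g := l2) (l := chr _ μ)
          (f' := rgt H Q.r1) (g' := rgt H l2) (l' := m') _).symm
      have e4 : ∀ w : H ⊗[k] H, Q.ph (rgt H Q.r1) (Q.conv (rgt H l2) m') (rgt H Q.r2) (x ⊗ₜ w) =
          x ⊗ₜ Q.ph Q.r1 (Q.conv l2 (chr _ μ)) Q.r2 w := fun w =>
        (ph_intw (TensorProduct.mk k H _ x) (f := Q.r1) (g := Q.conv l2 (chr _ μ)) (l := Q.r2)
          (f' := rgt H Q.r1) (g' := Q.conv (rgt H l2) m') (l' := rgt H Q.r2) _).symm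
      rw [hJ, LinearMap.lTensor_tmul, e1, e2, e3, e4, hκ, hκ', LinearMap.comp_apply,
        LinearMap.comp_apply, LinearMap.lTensor_tmul, LinearMap.lTensor_tmul, LinearMap.comp_apply,
        hc]
  have h4 := ph_intw (Q := Q) J (f := s') (g := Q.conv (Q.conv (rgt H Q.r1) (rgt H l2)) m') (l := rgt H Q.r2)
    (f' := s) (g' := Q.conv (Q.conv (rgt H Q.eC) (Q.conv (rgt H eL₁) (rgt H eL₂))) m)
    (l' := Q.conv (rgt H Q.eR₂) (rgt H Q.eR₁)) v
  rw [S_twistedCoact Q hθ]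
  refine Eq.trans ?_ h2
  refine Eq.trans ?_ ((h3 (Q.ph s' (Q.conv (Q.conv (rgt H Q.r1) (rgt H l2)) m') (rgt H Q.r2) v)).trans ?_)
  · rw [h4]
    simp only [mul_one, mul_assoc] at h1
    exact h1
  · simp only [mul_one, mul_assoc]
    rfl

end Uniqueness
end
end QuasiHopfAlgebra

namespace QuasiHopfAlgebra

noncomputable section

section Uniqueness

variable {k H : Type*} [Field k] [Ring H] [Algebra k H] [FiniteDimensional k H]
  (Q : QuasiHopfAlgebra k H) (θ : H →ₗ[k] k) (μ : H →ₐ[k] k)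

/-- `w ↦ S̄(w β) a` -/
def SinvMul (a : H) : H →ₗ[k] H :=
  LinearMap.mulRight k a ∘ₗ Q.Sinv ∘ₗ LinearMap.mulRight k Q.β

omit [FiniteDimensional k H] in
@[simp] lemma SinvMul_apply (a w : H) : Q.SinvMul a w = Q.Sinv (w * Q.β) * a := rfl

/-- The values of the right cointegral attached to a functional are traces. -/
lemma rightCoinv_eq_trace (ξ : Module.Dual k H) (a : H) :
    Q.rightCoinv ξ (Q.α * Q.Sinv a) = LinearMap.trace k H (Q.SinvMul a ∘ₗ Q.twistedCoact ξ ∘ₗ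
      LinearMap.mulLeft k Q.α ∘ₗ Q.Sinv) := by
  rw [rightCoinv_eq_twistedCoact]
  obtain ⟨t, ht⟩ := (dualTensorHomEquiv k H H).surjective (Q.twistedCoact ξ)
  rw [← ht, LinearEquiv.symm_apply_apply]
  clear ht
  induction t with
  | zero => simp
  | add s s' hs hs' =>
    simp only [map_add, LinearMap.add_apply, hs, hs', LinearMap.add_comp, LinearMap.comp_add]
  | tmul η w =>
    have h1 : Q.SinvMul a ∘ₗ dualTensorHomEquiv k H H (η ⊗ₜ w) ∘ₗ LinearMap.mulLeft k Q.α ∘ₗ Q.Sinv =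
        dualTensorHom k H H ((η ∘ₗ LinearMap.mulLeft k Q.α ∘ₗ Q.Sinv) ⊗ₜ Q.SinvMul a w) := by
      ext; simp
    rw [h1, LinearMap.trace_eq_contract_apply]
    simp [Sinv_mul, mul_assoc]

/-- The trace of the coaction word of `S_twistedCoact_eq`, as a word in three strands. -/
lemma trace_word (a : H) (N K : H ⊗[k] (H ⊗[k] H)) :
    LinearMap.trace k H (Q.SinvMul a ∘ₗ Q.Sinv ∘ₗ Q.mulSαSS ∘ₗ (evalR θ).lTensor H ∘ₗ
      ev3 (lft _ (Lm k H)) (rgt H Q.r1) (Q.conv (rgt H l2) (chr _ μ)) N ∘ₗ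
      ev3 (rgt H Q.r1) (rgt H l2) (chr _ μ) K ∘ₗ TensorProduct.mk k H _ 1 ∘ₗ
        TensorProduct.mk k H H 1) =
    θ (Q.Sinv (Q.mulSα (ev3 l1 l2 (Q.conv Q.r2 (chr _ μ)) N (ev3 l2 Q.r2 (chr _ μ) K
      (1 ⊗ₜ Q.β)))) * a) := by
  induction N with
  | zero => simp
  | add s s' hs hs' =>
    simp only [map_add, LinearMap.add_apply, hs, hs', LinearMap.add_comp, LinearMap.comp_add, add_mul]
  | tmul x N =>
  induction N with
  | zero => simp
  | add s s' hs hs' =>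
    simp only [map_add, LinearMap.add_apply, hs, hs', LinearMap.add_comp, LinearMap.comp_add, add_mul,
      TensorProduct.tmul_add]
  | tmul y z =>
  induction K with
  | zero => simp
  | add s s' hs hs' =>
    simp only [map_add, LinearMap.add_apply, hs, hs', LinearMap.add_comp, LinearMap.comp_add, add_mul]
  | tmul b K =>
  induction K with
  | zero => simp
  | add s s' hs hs' =>
    simp only [map_add, LinearMap.add_apply, hs, hs', LinearMap.add_comp, LinearMap.comp_add, add_mul,
      TensorProduct.tmul_add]
  | tmul c d =>
    set e := evalR μ.toLinearMap (Q.Δ z) with he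
    have h1 : Q.SinvMul a ∘ₗ Q.Sinv ∘ₗ Q.mulSαSS ∘ₗ (evalR θ).lTensor H ∘ₗ
      ev3 (lft _ (Lm k H)) (rgt H Q.r1) (Q.conv (rgt H l2) (chr _ μ)) (x ⊗ₜ (y ⊗ₜ z)) ∘ₗ
      ev3 (rgt H Q.r1) (rgt H l2) (chr _ μ) (b ⊗ₜ (c ⊗ₜ d)) ∘ₗ TensorProduct.mk k H _ 1 ∘ₗ
        TensorProduct.mk k H H 1 = dualTensorHom k H H ((μ d • θ ∘ₗ LinearMap.mulLeft k (e * c)) ⊗ₜ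
          Q.SinvMul a (Q.S x * Q.α * y * b)) := by
      ext u
      simp [conv_chr, ← he, Sinv_mul, Sinv_S, smul_smul, mul_assoc, mul_comm (μ d)]
    rw [h1, LinearMap.trace_eq_contract_apply]
    simp [conv_chr, ← he, mulSα, Sinv_mul, Sinv_S, mul_assoc]

omit [FiniteDimensional k H] in
/-- The element of `H` to which the trace word reduces is the unit. -/
lemma mulSα_word : Q.mulSα (Q.phb l1 l2 (Q.conv Q.r2 (chr _ μ)) (Q.ph l2 Q.r2 (chr _ μ)
    (1 ⊗ₜ Q.β))) = 1 := by
  set m : Rep k H (Module.End k (H ⊗[k] H)) := chr _ μ with hm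
  set v : H ⊗[k] H := 1 ⊗ₜ Q.β with hv
  have hcap : LEq (vecK Q.mulSα v) (Q.conv l1 l2) (Q.triv _) := LEq.of_vec fun x => by
    ext a b
    have : ∀ t : H ⊗[k] H, Q.mulSα (ev2 l1 l2 t (a ⊗ₜ b)) =
        Q.S a * (ev2 (R := H) Q.S (LinearMap.mulLeft k Q.α) t) * b := fun t =>
      vec_ev2 (G := LinearMap.mulRight k b ∘ₗ LinearMap.mulLeft k (Q.S a) ∘ₗ
        ev2 (R := H) Q.S (LinearMap.mulLeft k Q.α))
        (fun x y => by simp [mulSα, Q.S_mul, mul_assoc]) t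
    simp only [LinearMap.comp_apply, TensorProduct.AlgebraTensorModule.curry_apply,
      TensorProduct.curry_apply, LinearMap.coe_restrictScalars]
    rw [conv_apply, this, S_α]
    simp [mulSα, mul_assoc]
  have hcup : REq (vecK Q.mulSα v) (Q.conv l2 Q.r2) (Q.triv _) :=
    REq.of_cup (TensorProduct.mk k H H 1) (fun x y => by simp [hv, mul_assoc])
  have h1 := pentagon₄ (Q := Q) l1 l2 Q.r2 m
  have h2 := hcap.ph_left (g := Q.r2) (h := m) 1 (Q.phb l1 l2 Q.r2 * Q.phb l1 (Q.conv l2 Q.r2) m)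
  have h3 := hcup.phb_mid (f := l1) (h := m) (Q.phb l1 l2 Q.r2) 1
  rw [one_mul, one_mul, ← mul_assoc, ← h1] at h2
  rw [mul_one, mul_one] at h3
  refine (h2.trans h3).trans ?_
  refine (vec_ev3 (κ := Q.mulSα) (v := v) (G := LinearMap.mul' k H ∘ₗ
        (TensorProduct.map Q.S
          (LinearMap.mul' k H ∘ₗ
          TensorProduct.map (LinearMap.mulLeft k Q.α) (LinearMap.mulLeft k Q.β ∘ₗ Q.S))))
          (fun x y z => ?_) Q.phiInv).trans Q.antipode_φ_inv
  simp [hv, mulSα, mul_assoc]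

variable {θ μ}

/-- A categorical cointegral is recovered from the right cointegral attached to it. -/
lemma lamCat_rightCoinv_preCointegral (hθ : ∀ h u, θ (Q.adjAct μ h u) = Q.ε h * θ u)
    (hc : Q.CoactCompat θ μ) : Q.lamCat (Q.rightCoinv (Q.preCointegral θ μ)) = θ := by
  ext a
  have h1 : Q.SinvMul a ∘ₗ Q.twistedCoact (Q.preCointegral θ μ) ∘ₗ
      LinearMap.mulLeft k Q.α ∘ₗ Q.Sinv = Q.SinvMul a ∘ₗ Q.Sinv ∘ₗ Q.mulSαSS ∘ₗ (evalR θ).lTensor H ∘ₗ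
      ev3 (lft _ (Lm k H)) (rgt H Q.r1) (Q.conv (rgt H l2) (chr _ μ)) Q.phiInv ∘ₗ
      ev3 (rgt H Q.r1) (rgt H l2) (chr _ μ) Q.phi ∘ₗ TensorProduct.mk k H _ 1 ∘ₗ
        TensorProduct.mk k H H 1 := by
    ext u
    have := Q.S_twistedCoact_eq hθ hc u
    simp only [LinearMap.comp_apply, LinearMap.mulLeft_apply]
    rw [← Q.Sinv_S (Q.twistedCoact _ _), this]
    rfl
  change Q.rightCoinv _ (Q.α * Q.Sinv a) = _
  rw [rightCoinv_eq_trace, h1, trace_word]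
  have := Q.mulSα_word μ
  rw [phb, ph] at this
  rw [this, Sinv_one, one_mul]

lemma mem_catCointegrals_iff : θ ∈ Q.catCointegrals μ ↔
    (∀ h u, θ (Q.adjAct μ h u) = Q.ε h * θ u) ∧ Q.CoactCompat θ μ := by
  have h1 : θ ∈ Q.catCointegrals μ ↔ (∀ h u, θ (Q.adjAct μ h u) = Q.ε h * θ u) ∧
      ∀ u, Q.coactEval θ μ u = θ u • Q.β := by
    refine and_congr Iff.rfl (forall_congr' fun u => ?_)
    rw [← (TensorProduct.rid k H).injective.eq_iff, eq_comm]
    simp [coactEval, evalR, unitCoact]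
  rw [h1]
  exact and_congr_right fun hθ => ⟨fun h => Q.coactCompat_of_coactEval θ μ hθ h,
    fun h => Q.coactEval_of_coactCompat θ μ hθ h⟩

end Uniqueness
end
end QuasiHopfAlgebra

namespace QuasiHopfAlgebra

noncomputable section

section ExistenceWords

variable {k H : Type*} [Field k] [Ring H] [Algebra k H] {Q : QuasiHopfAlgebra k H}
  {R : Type*} [Ring R] [Algebra k R] {N : Type*} [AddCommGroup N] [Module k N] {K : R →ₗ[k] N}

/-! ### Rewriting the coaction of an integral -/

/-- A cup `b y`, nested inside the strands `a` and `z` and next to a strand `x`. -/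
lemma nested_cups_word (x a b y z : H →ₗ[k] R) [IsRep x] [IsRep a] [IsRep b] [IsRep y] [IsRep z]
    [Comm x a] [Comm x b] [Comm x y] [Comm x z] [Comm a b] [Comm a y] [Comm a z] [Comm b y]
    [Comm b z] [Comm y z] (hby : REq K (Q.conv b y) (Q.triv R)) (W : R) :
    K (W * (Q.phb x a b * Q.phb x (Q.conv a b) (Q.conv y z) * Q.ph (Q.conv a b) y z *
      Q.phb a b y)) =
    K (W * (Q.ph (Q.conv (Q.conv x a) b) y z * Q.phb (Q.conv x a) b y * Q.phb x a z)) := by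
  have h1 := pentagon₄ (Q := Q) x (Q.conv a b) y z
  have h2 := ph_nat (Q := Q) (Q.phb x a b) (f := Q.conv x (Q.conv a b))
    (f' := Q.conv (Q.conv x a) b) (g := y) (g' := y) (h := z) (h' := z)
  have h3 := phb_nat (Q := Q) (Q.phb a b y) (f := x) (f' := x) (g := Q.conv a (Q.conv b y))
    (g' := Q.conv (Q.conv a b) y) (h := z) (h' := z)
  have h4 := pentagon₃ (Q := Q) x a b y
  set V := Q.ph (Q.conv (Q.conv x a) b) y z with hV
  have h5 := REq.phb (Q := Q) (REq.refl K x) (hby.conv_triv_right a) (REq.refl K z)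
    (W * V * Q.phb x a b * Q.phb x (Q.conv a b) y * Q.phb a b y)
  have h6 := hby.phb_right (f := x) (g := a) (W * V * Q.phb (Q.conv x a) b y) (Q.phb x a z)
  calc _ = K (W * (Q.phb x a b * (Q.phb x (Q.conv a b) (Q.conv y z) * Q.ph (Q.conv a b) y z) *
        Q.phb a b y)) := by simp only [mul_assoc]
    _ = K (W * (Q.phb x a b * Q.ph (Q.conv x (Q.conv a b)) y z) * Q.phb x (Q.conv a b) y *
        (Q.phb x (Q.conv (Q.conv a b) y) z * Q.phb a b y)) := by rw [h1]; simp only [mul_assoc]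
    _ = K (W * V * Q.phb x a b * Q.phb x (Q.conv a b) y * Q.phb a b y *
        Q.phb x (Q.conv a (Q.conv b y)) z) := by rw [h2, ← h3]; simp only [mul_assoc]
    _ = K (W * V * (Q.phb x a b * Q.phb x (Q.conv a b) y * Q.phb a b y) * Q.phb x a z) := by
        rw [h5]; simp only [mul_assoc]
    _ = _ := by
        rw [h4, ← mul_assoc, h6]; simp only [mul_assoc]

/-- The cap `d x` allows to exchange the order in which strands are reassociated. -/
lemma cap_word (o d x a b : H →ₗ[k] R) [IsRep o] [IsRep d] [IsRep x] [IsRep a] [IsRep b]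
    [Comm o d] [Comm o x] [Comm o a] [Comm o b] [Comm d x] [Comm d a] [Comm d b] [Comm x a]
    [Comm x b] [Comm a b] (hdx : LEq K (Q.conv d x) (Q.triv R))
    (Z V : R) [Cent d Z] [Cent x Z] :
    K (Z * (Q.phb o a b * Q.phb d x (Q.conv a b) * Q.ph x a b *
      Q.ph o d (Q.conv (Q.conv x a) b)) * V) =
    K (Z * (Q.phb d x a * Q.ph o d (Q.conv x a) * Q.phb (Q.conv o d) (Q.conv x a) b) * V) := by
  have h1 := pentagon₄ (Q := Q) d x a b
  have h2 := pentagon₂ (Q := Q) o d (Q.conv x a) b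
  have h3 := ph_nat (Q := Q) (Q.phb d x a) (f := o) (f' := o) (g := Q.conv d (Q.conv x a))
    (g' := Q.conv (Q.conv d x) a) (h := b) (h' := b)
  set U := Q.ph o d (Q.conv x a) * Q.phb (Q.conv o d) (Q.conv x a) b with hU
  have h4 := hdx.ph_left (g := a) (h := b) (Z * Q.phb o a b) (Q.phb d x a * Q.phb d (Q.conv x a) b *
    Q.ph o d (Q.conv (Q.conv x a) b) * V)
  have h5 := LEq.ph (Q := Q) (LEq.refl _ o) ((hdx.comp (Z * Q.phb o a b)).conv_triv_left a)
    (LEq.refl _ b) (Q.phb d x a * U * V)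
  simp only [LinearMap.comp_apply, LinearMap.mulLeft_apply] at h5
  calc _ = K (Z * Q.phb o a b * (Q.phb d x (Q.conv a b) * Q.ph x a b) *
        (Q.ph o d (Q.conv (Q.conv x a) b) * V)) := by simp only [mul_assoc]
    _ = K (Z * Q.phb o a b * Q.phb d x a * (Q.phb d (Q.conv x a) b *
        Q.ph o d (Q.conv (Q.conv x a) b)) * V) := by
        rw [h1]; simp only [mul_assoc] at h4 ⊢; rw [h4]
    _ = K (Z * Q.phb o a b * (Q.phb d x a * Q.ph o (Q.conv d (Q.conv x a)) b) * (U * V)) := by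
        rw [h2]; simp only [hU, mul_assoc]
    _ = K (Z * Q.phb o a b * (Q.ph o (Q.conv (Q.conv d x) a) b * (Q.phb d x a * U * V))) := by
        rw [h3]; simp only [mul_assoc]
    _ = K (Z * (Q.phb o a b * Q.ph o a b) * (Q.phb d x a * U * V)) := by
        rw [h5]; simp only [mul_assoc]
    _ = _ := by rw [phb_mul_ph, mul_one]; simp only [hU, mul_assoc]

/-- Straightening the strand `a` with the cap `o a` and the cup `a z`. -/
lemma straighten_word (o d x a z : H →ₗ[k] R) [IsRep o] [IsRep d] [IsRep x] [IsRep a] [IsRep z]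
    [Comm o d] [Comm o x] [Comm o a] [Comm o z] [Comm d x] [Comm d a] [Comm d z] [Comm x a]
    [Comm x z] [Comm a z] (hdx : LEq K (Q.conv d x) (Q.triv R))
    (haz : REq K (Q.conv a z) (Q.triv R)) :
    K (Q.phb d x a * Q.ph o d (Q.conv x a) * Q.phb (Q.conv o d) (Q.conv x a) z * Q.phb x a z) =
      K (Q.phb o a z * Q.ph o d x) := by
  have h1 := pentagon₁ (Q := Q) o d (Q.conv x a) z
  have h2 := ph_nat (Q := Q) (Q.phb x a z) (f := o) (f' := o) (g := d) (g' := d)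
    (h := Q.conv x (Q.conv a z)) (h' := Q.conv (Q.conv x a) z)
  have h3 := phb_nat (Q := Q) (Q.phb d x a) (f := o) (f' := o) (g := Q.conv d (Q.conv x a))
    (g' := Q.conv (Q.conv d x) a) (h := z) (h' := z)
  have h4 := pentagon₃ (Q := Q) d x a z
  have h5 := REq.ph (Q := Q) (REq.refl K o) (REq.refl K d) (haz.conv_triv_right x)
    (Q.phb d x a * Q.phb o (Q.conv d (Q.conv x a)) z * Q.phb d (Q.conv x a) z * Q.phb x a z)
  have h6 := LEq.phb (Q := Q) (LEq.refl K o) (hdx.conv_triv_left a) (LEq.refl K z)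
    (Q.phb d x a * Q.phb d (Q.conv x a) z * Q.phb x a z * Q.ph o d x)
  have h7 := hdx.phb_left (g := a) (h := z) (Q.phb o a z) (Q.phb d x (Q.conv a z) * Q.ph o d x)
  have h8 := haz.phb_right (f := d) (g := x) (Q.phb o a z) (Q.ph o d x)
  calc _ = K (Q.phb d x a * (Q.ph o d (Q.conv x a) * Q.phb (Q.conv o d) (Q.conv x a) z) *
        Q.phb x a z) := by simp only [mul_assoc]
    _ = K (Q.phb d x a * Q.phb o (Q.conv d (Q.conv x a)) z * Q.phb d (Q.conv x a) z * Q.phb x a z *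
        Q.ph o d (Q.conv x (Q.conv a z))) := by
        rw [h1]; simp only [mul_assoc]; rw [h2]
    _ = K (Q.phb o (Q.conv (Q.conv d x) a) z * (Q.phb d x a * Q.phb d (Q.conv x a) z * Q.phb x a z *
        Q.ph o d x)) := by rw [h5, h3]; simp only [mul_assoc]
    _ = K (Q.phb o a z * (Q.phb d x a * Q.phb d (Q.conv x a) z * Q.phb x a z) *
        Q.ph o d x) := by rw [h6]; simp only [mul_assoc]
    _ = K (Q.phb o a z * Q.phb (Q.conv d x) a z * (Q.phb d x (Q.conv a z) * Q.ph o d x)) := by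
        rw [h4]; simp only [mul_assoc]
    _ = _ := by rw [h7, ← mul_assoc, h8]

/-- Moving an associator through an integral `L` of the strands `(x a) b`, on the left of which
these strands act trivially, and on the right of which they act in the same way as `m`. -/
lemma slide_integral_word (o d x a b m y z : H →ₗ[k] R) [IsRep o] [IsRep d] [IsRep x] [IsRep a]
    [IsRep b] [IsRep m] [IsRep y] [IsRep z]
    [Comm o d] [Comm o x] [Comm o a] [Comm o b] [Comm o m] [Comm o y] [Comm o z]
    [Comm d x] [Comm d a] [Comm d b] [Comm d m] [Comm d y] [Comm d z]
    [Comm x a] [Comm x b] [Comm x m] [Comm x y] [Comm x z] [Comm a b] [Comm a m] [Comm a y] [Comm a z]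
    [Comm b m] [Comm b y] [Comm b z] [Comm m y] [Comm m z] [Comm y z]
    {L : R} (hL : ∀ h, Q.conv (Q.conv x a) b h * L = Q.ε h • L)
    (hR : ∀ h, L * Q.conv (Q.conv x a) b h = L * m h) [Cent o L] [Cent d L] [Cent m L] [Cent y L] [Cent z L]
    (hdx : LEq K (Q.conv d x) (Q.triv R)) (hoa : LEq K (Q.conv o a) (Q.triv R))
    (hby : REq K (Q.conv b y) (Q.triv R)) :
    K (Q.phb b (Q.conv m y) z * (Q.phb d x a * Q.ph o d (Q.conv x a) *
      Q.phb (Q.conv o d) (Q.conv x a) b) * (L * Q.phb (Q.conv x a) b y * Q.phb x a z)) =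
    K (Q.phb d x a * Q.ph o d (Q.conv x a) * Q.phb (Q.conv o d) (Q.conv x a) b * L *
      Q.phb (Q.conv x a) b y * Q.phb (Q.conv o d) (Q.conv x a) z * Q.phb x a z) := by
  set Y := Q.conv (Q.conv x a) b with hY
  set A := Q.phb d x a * Q.ph o d (Q.conv x a) with hA
  have h1 : A * Q.phb b (Q.conv m y) z = Q.phb b (Q.conv m y) z * A :=
    phb_nat (Q := Q) A
  have h2 : LEq (K ∘ₗ LinearMap.mulLeft k A) (Q.conv (Q.conv o d) (Q.conv x a)) (Q.triv R) :=
    fun h X => by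
      have e1 := conv_assoc (Q := Q) o d (Q.conv x a) h
      have e2 : Q.phb d x a * Q.conv o (Q.conv d (Q.conv x a)) h =
          Q.conv o (Q.conv (Q.conv d x) a) h * Q.phb d x a := Inter.eq h
      have e3 := (LEq.conv (Q := Q) (LEq.refl K o) (hdx.conv_triv_left a)).trans hoa h (A * X)
      simp only [LinearMap.comp_apply, LinearMap.mulLeft_apply]
      have e4 : A * Q.conv (Q.conv o d) (Q.conv x a) h =
          Q.conv o (Q.conv (Q.conv d x) a) h * A := by
        rw [hA, mul_assoc, ← e1, ← mul_assoc, e2, mul_assoc]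
      rw [← mul_assoc, e4, mul_assoc, e3, triv_apply]
      simp
  have h3 := LEq.phb (Q := Q) (h2.conv_triv_left b).symm (LEq.refl _ (Q.conv m y)) (LEq.refl _ z)
    (Q.phb (Q.conv o d) (Q.conv x a) b * (L * Q.phb (Q.conv x a) b y * Q.phb x a z))
  have h4 := phb_nat (Q := Q) (Q.phb (Q.conv o d) (Q.conv x a) b) (f := Q.conv (Q.conv o d) Y)
    (f' := Q.conv (Q.conv (Q.conv o d) (Q.conv x a)) b) (g := Q.conv m y) (g' := Q.conv m y)
    (h := z) (h' := z)
  have h5 : REq (LinearMap.mulRight k L) Y (Q.triv R) := fun h X => by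
    simp only [LinearMap.mulRight_apply]
    rw [mul_assoc, hL, triv_apply]
    simp
  have h6 := REq.phb (Q := Q) (h5.conv_triv_right (Q.conv o d)) (REq.refl _ (Q.conv m y))
    (REq.refl _ z) 1
  have h7 : L * Q.phb (Q.conv o d) (Q.conv m y) z = Q.phb (Q.conv o d) (Q.conv m y) z * L :=
    phb_nat (Q := Q) L
  have h8 : LEq (LinearMap.mulLeft k L) m Y := fun h X => by
    simp only [LinearMap.mulLeft_apply]
    rw [← mul_assoc, ← hR, mul_assoc]
  have h9 := LEq.phb (Q := Q) (LEq.refl _ (Q.conv o d)) (h8.conv (Q := Q) (LEq.refl _ y)) (LEq.refl _ z) 1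
  have h10 := phb_nat (Q := Q) (Q.phb (Q.conv x a) b y) (f := Q.conv o d) (f' := Q.conv o d)
    (g := Q.conv (Q.conv x a) (Q.conv b y)) (g' := Q.conv Y y) (h := z) (h' := z)
  have h11 := REq.phb (Q := Q) (REq.refl _ (Q.conv o d))
    ((hby.comp (Q.phb x a z)).conv_triv_right (Q.conv x a)) (REq.refl _ z)
    (A * Q.phb (Q.conv o d) (Q.conv x a) b * L * Q.phb (Q.conv x a) b y)
  simp only [LinearMap.mulRight_apply, LinearMap.mulLeft_apply, LinearMap.comp_apply, one_mul,
    mul_one] at h3 h6 h9 h11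
  calc _ = K (A * (Q.phb b (Q.conv m y) z *
        (Q.phb (Q.conv o d) (Q.conv x a) b * (L * Q.phb (Q.conv x a) b y * Q.phb x a z)))) := by
        rw [← mul_assoc A, h1]; simp only [mul_assoc]
    _ = K (A * (Q.phb (Q.conv (Q.conv (Q.conv o d) (Q.conv x a)) b) (Q.conv m y) z *
        Q.phb (Q.conv o d) (Q.conv x a) b) * (L * Q.phb (Q.conv x a) b y * Q.phb x a z)) := by
        rw [h3]; simp only [mul_assoc]
    _ = K (A * Q.phb (Q.conv o d) (Q.conv x a) b * (Q.phb (Q.conv (Q.conv o d) Y) (Q.conv m y) z * L) *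
        Q.phb (Q.conv x a) b y * Q.phb x a z) := by
        rw [← h4]; simp only [mul_assoc]
    _ = K (A * Q.phb (Q.conv o d) (Q.conv x a) b * L * (Q.phb (Q.conv o d) (Q.conv Y y) z *
        Q.phb (Q.conv x a) b y) * Q.phb x a z) := by
        rw [h6, ← h7, h9]; simp only [mul_assoc]
    _ = K (A * Q.phb (Q.conv o d) (Q.conv x a) b * L * Q.phb (Q.conv x a) b y *
        Q.phb (Q.conv o d) (Q.conv (Q.conv x a) (Q.conv b y)) z * Q.phb x a z) := by
        rw [← h10]; simp only [mul_assoc]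
    _ = _ := by rw [h11]

/-- The word that expresses the coaction of `θ` evaluated on `cElt ℓ`, for a left integral `ℓ`. -/
lemma integral_word (o d x a b m y z : H →ₗ[k] R) [IsRep o] [IsRep d] [IsRep x] [IsRep a] [IsRep b]
    [IsRep m] [IsRep y] [IsRep z]
    [Comm o d] [Comm o x] [Comm o a] [Comm o b] [Comm o m] [Comm o y] [Comm o z]
    [Comm d x] [Comm d a] [Comm d b] [Comm d m] [Comm d y] [Comm d z]
    [Comm x a] [Comm x b] [Comm x m] [Comm x y] [Comm x z] [Comm a b] [Comm a m] [Comm a y] [Comm a z]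
    [Comm b m] [Comm b y] [Comm b z] [Comm m y] [Comm m z] [Comm y z]
    {ℓ : H} {μ : H →ₐ[k] k} (hm : ∀ h, m h = μ h • (1 : R)) (hℓ : ∀ h, h * ℓ = Q.ε h • ℓ)
    (hμ : ∀ h, ℓ * h = μ h • ℓ)
    (hdx : LEq K (Q.conv d x) (Q.triv R)) (hoa : LEq K (Q.conv o a) (Q.triv R))
    (hby : REq K (Q.conv b y) (Q.triv R)) :
    K (Q.phb b (Q.conv m y) z * Q.phb m y z * Q.phb o a b * (Q.phb d x (Q.conv a b) *
      Q.conv x (Q.conv a b) ℓ * (Q.phb x (Q.conv a b) (Q.conv y z) * Q.ph (Q.conv a b) y z *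
      Q.phb a b y))) =
    K (Q.phb d x a * Q.ph o d (Q.conv x a) * Q.phb (Q.conv o d) (Q.conv x a) b *
      Q.conv (Q.conv x a) b ℓ *
      Q.phb (Q.conv x a) b y * Q.phb (Q.conv o d) (Q.conv x a) z * Q.phb x a z) := by
  set Y := Q.conv (Q.conv x a) b with hY
  set L := Y ℓ with hLdef
  have hL : ∀ h, Y h * L = Q.ε h • L := fun h => by
    rw [hLdef, ← IsRep.mul, hℓ, map_smul]
  have hR : ∀ h, L * Y h = L * m h := fun h => by
    rw [hLdef, ← IsRep.mul, hμ, map_smul, hm, mul_smul_comm, mul_one]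
  have h1 : Q.conv x (Q.conv a b) ℓ = Q.ph x a b * L * Q.phb x a b := by
    have := conv_assoc (Q := Q) x a b ℓ
    rw [← this, mul_assoc, ph_mul_phb, mul_one]
  have h2 := nested_cups_word (Q := Q) x a b y z hby (Q.phb b (Q.conv m y) z * Q.phb m y z *
    Q.phb o a b * Q.phb d x (Q.conv a b) * Q.ph x a b * L)
  have h3 : L * Q.ph Y y z = Q.ph m y z * L := by
    have e1 : LEq (LinearMap.mulLeft k L) Y m := fun h X => by
      simp only [LinearMap.mulLeft_apply]
      rw [← mul_assoc, hR, mul_assoc]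
    have e2 := LEq.ph (Q := Q) e1 (LEq.refl _ y) (LEq.refl _ z) 1
    simp only [LinearMap.mulLeft_apply, mul_one] at e2
    rw [e2]
    exact ph_nat (Q := Q) L
  have h4 : Q.ph o d Y * L = L := by
    have e1 : REq (LinearMap.mulRight k L) Y (Q.triv R) := fun h X => by
      simp only [LinearMap.mulRight_apply]
      rw [mul_assoc, hL, triv_apply]
      simp
    have e2 := e1.ph_right (f := o) (g := d) 1 1
    simpa using e2
  have h5 : (Q.phb o a b * Q.phb d x (Q.conv a b) * Q.ph x a b) * Q.ph m y z =
      Q.ph m y z * (Q.phb o a b * Q.phb d x (Q.conv a b) * Q.ph x a b) := ph_nat (Q := Q) _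
  have h6 := cap_word (Q := Q) o d x a b hdx (Q.phb b (Q.conv m y) z)
    (L * Q.phb (Q.conv x a) b y * Q.phb x a z)
  rw [← slide_integral_word (Q := Q) o d x a b m y z hL hR hdx hoa hby, ← h6]
  calc _ = K (Q.phb b (Q.conv m y) z * Q.phb m y z *
        Q.phb o a b * Q.phb d x (Q.conv a b) * Q.ph x a b * L * (Q.phb x a b *
          Q.phb x (Q.conv a b) (Q.conv y z) * Q.ph (Q.conv a b) y z * Q.phb a b y)) := by
        rw [h1]; simp only [mul_assoc]
    _ = K (Q.phb b (Q.conv m y) z * Q.phb m y z *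
        (Q.phb o a b * Q.phb d x (Q.conv a b) * Q.ph x a b) * (L * Q.ph Y y z) *
        Q.phb (Q.conv x a) b y * Q.phb x a z) := by
        rw [h2]; simp only [hY, mul_assoc]
    _ = K (Q.phb b (Q.conv m y) z * Q.phb m y z *
        ((Q.phb o a b * Q.phb d x (Q.conv a b) * Q.ph x a b) * Q.ph m y z) * L *
        Q.phb (Q.conv x a) b y * Q.phb x a z) := by
        rw [h3]; simp only [mul_assoc]
    _ = K (Q.phb b (Q.conv m y) z * (Q.phb m y z * Q.ph m y z) *
        (Q.phb o a b * Q.phb d x (Q.conv a b) * Q.ph x a b) * (Q.ph o d Y * L) *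
        Q.phb (Q.conv x a) b y * Q.phb x a z) := by
        rw [h5, h4]; simp only [mul_assoc]
    _ = _ := by rw [phb_mul_ph, mul_one]; simp only [hY, mul_assoc]

end ExistenceWords
end
end QuasiHopfAlgebra

namespace QuasiHopfAlgebra

noncomputable section

section Existence

variable {k H : Type*} [Field k] [Ring H] [Algebra k H] (Q : QuasiHopfAlgebra k H) {μ : H →ₐ[k] k}

/-! ### The functional attached to a left integral -/

/-- A left integral `ℓ` on which `H` acts on the right through `μ`, with a functional `η` such that
the element `c = qᴸ Δ(ℓ) pᴿ` satisfies `x = c₁ η(S(c₂) x)` and `η(c₁) c₂ = 1`. -/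
structure IntegralPair (μ : H →ₐ[k] k) where
  ℓ : H
  η : Module.Dual k H
  mul_ℓ : ∀ h, h * ℓ = Q.ε h • ℓ
  ℓ_mul : ∀ h, ℓ * h = μ h • ℓ
  expand_eq : ∀ z, Q.expand η z (Q.cElt ℓ) = z
  evalL_eq : evalL η (Q.cElt ℓ) = 1

lemma pR_eq : Q.pR = Q.phb l1 l2 Q.r2 (1 ⊗ₜ Q.β) := by
  refine (vec_ev3 (κ := LinearMap.id) (G := Q.mulβS.lTensor H) (fun x y z => ?_) Q.phiInv).symm
  simp [mulβS, mul_assoc]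

/-- `Δ(h₍₁₎) pᴿ (1 ⊗ S(h₍₂₎)) = pᴿ (h ⊗ 1)` -/
lemma conv_pR (h : H) : Q.conv (Q.conv l1 l2) Q.r2 h Q.pR = Q.pR * (h ⊗ₜ 1) := by
  have h1 := LinearMap.congr_fun (conv_assoc' (Q := Q) l1 l2 Q.r2 h) (1 ⊗ₜ Q.β)
  have hcup : REq (vecK LinearMap.id ((1 : H) ⊗ₜ[k] Q.β)) (Q.conv l2 Q.r2) (Q.triv _) :=
    REq.of_cup (TensorProduct.mk k H H 1) (fun x y => by simp [mul_assoc])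
  have h2 := hcup.conv_triv_right l1 h (Q.phb l1 l2 Q.r2)
  have h3 : Q.phb l1 l2 Q.r2 (h ⊗ₜ Q.β) = Q.pR * (h ⊗ₜ 1) := by
    refine vec_ev3 (κ := LinearMap.id) (G := LinearMap.mulRight k (h ⊗ₜ[k] (1 : H)) ∘ₗ Q.mulβS.lTensor H)
      (fun x y z => ?_) Q.phiInv
    simp [mulβS, mul_assoc]
  rw [pR_eq]
  refine h1.symm.trans (h2.trans ?_)
  rw [← pR_eq, ← h3]
  simp

namespace IntegralPair

variable {Q} (D : Q.IntegralPair μ)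

/-- `μ(h₍₁₎) c (1 ⊗ S(h₍₂₎)) = c (h ⊗ 1)` for `c = qᴸ Δ(ℓ) pᴿ` -/
lemma conv_cElt (h : H) : Q.conv (chr _ μ) Q.r2 h (Q.cElt D.ℓ) = Q.cElt D.ℓ * (h ⊗ₜ 1) := by
  rw [cElt, mul_assoc _ Q.pR, ← conv_pR]
  have h1 : ∀ t : H ⊗[k] H, ev2 (chr _ μ) Q.r2 t (Q.qL * Q.Δ D.ℓ * Q.pR) =
      Q.qL * Q.Δ D.ℓ * ev2 (Q.conv l1 l2) Q.r2 t Q.pR := fun t => by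
    have hr : ∀ (y : H) (s s' : H ⊗[k] H), Q.r2 y (s * s') = s * Q.r2 y s' := fun y s s' => by
      have e : ∀ w : H ⊗[k] H, Q.r2 y w = w * (1 ⊗ₜ Q.S y) := fun w => by
        induction w with
        | zero => simp
        | add a b ha hb => simp only [map_add, add_mul, ha, hb]
        | tmul a b => simp
      rw [e, e, mul_assoc]
    refine vec_ev2 (κ := LinearMap.id) (G := LinearMap.mulLeft k (Q.qL * Q.Δ D.ℓ) ∘ₗ
      LinearMap.applyₗ Q.pR ∘ₗ ev2 (Q.conv l1 l2) Q.r2) (fun x y => ?_) t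
    simp only [LinearMap.id_apply, chr_apply, LinearMap.comp_apply, ev2_tmul, LinearMap.mulLeft_apply,
      LinearMap.applyₗ_apply_apply, Module.End.mul_apply, conv_l1_l2]
    rw [hr, ← mul_assoc _ (Q.Δ x), mul_assoc Q.qL (Q.Δ D.ℓ) (Q.Δ x), ← map_mul, D.ℓ_mul]
    simp
  exact h1 _

/-- Linear maps on `H` are determined by their values on the second leg of `c = qᴸ Δ(ℓ) pᴿ`. -/
lemma hom_ext {N : Type*} [AddCommGroup N] [Module k N] {F G : H →ₗ[k] N}
    (h : F.lTensor H (Q.cElt D.ℓ) = G.lTensor H (Q.cElt D.ℓ)) : F = G := by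
  ext u
  have h1 : ∀ F : H →ₗ[k] N, TensorProduct.lid k N ((D.η ∘ₗ LinearMap.mulLeft k (Q.S u)).rTensor N
      (F.lTensor H (Q.cElt D.ℓ))) = F u := fun F => by
    have h2 : F (evalL D.η ((Q.S u ⊗ₜ 1) * Q.cElt D.ℓ)) = F u := by
      rw [← Q.cElt_comm D.mul_ℓ, evalL_mul, D.evalL_eq, mul_one]
    rw [← h2]
    generalize Q.cElt D.ℓ = t
    induction t with
    | zero => simp
    | add a b ha hb => simp only [map_add, mul_add, ha, hb]
    | tmul a b => simp
  rw [← h1 F, h, h1]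

lemma η_conv (h u x : H) : D.η (Q.S (Q.conv (chr _ μ) Q.RS h u) * x) = D.η (Q.S u * (x * h)) := by
  have h1 : (D.η ∘ₗ LinearMap.mulRight k x ∘ₗ Q.S ∘ₗ Q.conv (chr _ μ) Q.RS h) =
      (D.η ∘ₗ LinearMap.mulRight k (x * h) ∘ₗ Q.S) := by
    refine D.hom_ext ((TensorProduct.rid k H).injective ?_)
    have e1 := D.expand_eq (x * h)
    have e2 : ∀ t : H ⊗[k] H, Q.expand D.η x (t * (h ⊗ₜ 1)) = Q.expand D.η x t * h := fun t => by
      induction t with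
      | zero => simp
      | add a b ha hb => simp only [map_add, add_mul, ha, hb]
      | tmul a b => simp
    have e3 : Q.expand D.η x (Q.conv (chr _ μ) Q.r2 h (Q.cElt D.ℓ)) =
        TensorProduct.rid k H ((D.η ∘ₗ LinearMap.mulRight k x ∘ₗ Q.S ∘ₗ
          Q.conv (chr _ μ) Q.RS h).lTensor H (Q.cElt D.ℓ)) := by
      rw [← rgt_chr, ← rgt_conv]
      generalize Q.cElt D.ℓ = t
      induction t with
      | zero => simp
      | add a b ha hb => simp only [map_add, ha, hb]
      | tmul a b => simp
    rw [← e3, conv_cElt, e2, D.expand_eq]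
    exact e1.symm
  exact LinearMap.congr_fun h1 u

/-- `a ↦ η(S(a) α)` -/
def form : H →ₗ[k] k := D.η ∘ₗ LinearMap.mulRight k Q.α ∘ₗ Q.S

@[simp] lemma form_apply (a : H) : D.form a = D.η (Q.S a * Q.α) := rfl

lemma evalR_form : evalR D.form (Q.cElt D.ℓ) = Q.α := D.expand_eq Q.α

lemma form_mul_conv (b d u : H) :
    D.form (b * Q.conv (chr _ μ) Q.RS d u) = D.η (Q.S u * Q.mulSα (b ⊗ₜ d)) := by
  rw [form_apply, Q.S_mul, mul_assoc, η_conv]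
  simp [mulSα, mul_assoc]

lemma form_conv (h u : H) : D.form (Q.conv (Lm k H) (Q.conv (chr _ μ) Q.RS) h u) =
    Q.ε h * D.form u := by
  have h1 := vec_ev2 (f := Lm k H) (g := Q.conv (chr _ μ) Q.RS) (κ := D.form) (v := u)
    (G := D.η ∘ₗ LinearMap.mulLeft k (Q.S u) ∘ₗ Q.mulSα) (fun x y => D.form_mul_conv x y u) (Q.Δ h)
  refine h1.trans ?_
  have := Q.antipode_α h
  rw [mulSα]
  simp [this]

/-- The categorical cointegral attached to a left integral. -/
def cointegral : H →ₗ[k] k := D.form ∘ₗ Q.ph (Lm k H) (chr _ μ) Q.RS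

lemma conv_adjAct' (u h : H) : Q.conv (Q.conv (Lm k H) (chr _ μ)) Q.RS h u = Q.adjAct μ h u := by
  have h1 := Q.conv_adjAct μ 1 u h
  rw [← rgt_chr, ← rgt_conv, ← rgt_conv] at h1
  have h2 := congrArg (TensorProduct.lid k H ∘ Q.ε.toLinearMap.rTensor H) h1
  simpa using h2

lemma cointegral_adjAct (h u : H) : D.cointegral (Q.adjAct μ h u) = Q.ε h * D.cointegral u := by
  rw [← conv_adjAct', cointegral, LinearMap.comp_apply, ← Module.End.mul_apply, ← conv_assoc,
    Module.End.mul_apply, form_conv]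
  rfl

lemma cointegral_ne_zero : D.cointegral ≠ 0 := by
  intro h
  have h1 : D.form = 0 := by
    have : D.form = D.cointegral ∘ₗ Q.phb (Lm k H) (chr _ μ) Q.RS := by
      ext u
      rw [cointegral, LinearMap.comp_apply, LinearMap.comp_apply, ← Module.End.mul_apply, ph_mul_phb]
      rfl
    rw [this, h, LinearMap.zero_comp]
  have h2 := D.evalR_form
  rw [h1] at h2
  have h3 := Q.ε_α
  rw [← h2] at h3
  simp [evalR] at h3

end IntegralPair

end Existence
end
end QuasiHopfAlgebra

namespace QuasiHopfAlgebra

noncomputable section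

section Existence

variable {k H : Type*} [Field k] [Ring H] [Algebra k H] {Q : QuasiHopfAlgebra k H}

/-! ### Contracting the coaction word of an integral -/

local notation "HH" => H ⊗[k] H

set_option maxSynthPendingDepth 4

lemma lft_conv {M U : Type*} [AddCommGroup M] [Module k M] [AddCommGroup U] [Module k U]
    (f g : Rep k H (Module.End k M)) : lft U (Q.conv f g) = Q.conv (lft U f) (lft U g) := by
  ext x m u
  exact (vec_ev2 (κ := LinearMap.id) (G := (TensorProduct.mk k M U).flip u ∘ₗ LinearMap.applyₗ m ∘ₗ
    ev2 f g) (fun y z => by simp) (Q.Δ x)).symm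

/-- `u ⊗ y ↦ θ(y) u` -/
def evalLast (U : Type*) [AddCommGroup U] [Module k U] (θ : H →ₗ[k] k) : U ⊗[k] H →ₗ[k] U :=
  (TensorProduct.rid k U).toLinearMap ∘ₗ θ.lTensor U

@[simp] lemma evalLast_tmul {U : Type*} [AddCommGroup U] [Module k U] (θ : H →ₗ[k] k) (u : U) (y : H) :
    evalLast U θ (u ⊗ₜ y) = θ y • u := by
  simp [evalLast]

instance {U : Type*} [AddCommGroup U] [Module k U] (θ : H →ₗ[k] k)
    (f : Rep k H (Module.End k U)) : Intw (evalLast U θ) (lft H f) f := ⟨fun x m => by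
  have : evalLast U θ ∘ₗ lft H f x = f x ∘ₗ evalLast U θ := by ext; simp
  exact LinearMap.congr_fun this m⟩

instance {U V : Type*} [AddCommGroup U] [Module k U] [AddCommGroup V] [Module k V] (y : V)
    (f : Rep k H (Module.End k U)) : Intw ((TensorProduct.mk k U V).flip y) f (lft V f) :=
  ⟨fun _ _ => rfl⟩

lemma contr22_aWord_conv (p q : H) (s t : HH) :
    Q.contr22 (Q.aWord (Q.conv Q.w₂ Q.v₂ p (Q.conv v₃ w₃ q (s ⊗ₜ t)))) =
      s * (Q.f * (Q.Δ (Q.S p * Q.α * q) * t)) := by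
  rw [conv_v₃w₃, conv_w₂v₂, aWord_apply, ← f_Δ_α, map_mul, map_mul]
  simp only [← mul_assoc]
  rw [mul_assoc s, ← f_Δ_S]
  simp only [mul_assoc]

variable {μ : H →ₐ[k] k} (D : Q.IntegralPair μ)

/-- The integral disappears from the word when its second leg is evaluated with `D.form`. -/
lemma contr22_integral (n : HH ⊗[k] HH) :
    Q.contr22 (evalLast _ D.form ((Q.phb (lft H Q.v₂) (lft H v₃) (lft H w₃) *
      Q.ph (lft H Q.w₂) (lft H Q.v₂) (Q.conv (lft H v₃) (lft H w₃)) *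
      Q.phb (Q.conv (lft H Q.w₂) (lft H Q.v₂)) (Q.conv (lft H v₃) (lft H w₃)) (rgt _ (Lm k H)) *
      Q.conv (Q.conv (lft H v₃) (lft H w₃)) (rgt _ (Lm k H)) D.ℓ *
      Q.phb (Q.conv (lft H v₃) (lft H w₃)) (rgt _ (Lm k H)) (rgt _ Q.RS)) (n ⊗ₜ Q.β))) =
      Q.contr22 (Q.aWord n) := by
  induction n with
  | zero => simp
  | add s s' hs hs' => simp only [TensorProduct.add_tmul, map_add, hs, hs']
  | tmul s t =>
  set n : HH ⊗[k] HH := s ⊗ₜ t with hn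
  have h1 : ∀ X : (HH ⊗[k] HH) ⊗[k] H, evalLast _ D.form ((Q.phb (lft H Q.v₂) (lft H v₃) (lft H w₃) *
      Q.ph (lft H Q.w₂) (lft H Q.v₂) (Q.conv (lft H v₃) (lft H w₃))) X) =
      Q.aWord (evalLast _ D.form X) := fun X => by
    rw [Module.End.mul_apply, phb_intw (evalLast _ D.form) (f' := Q.v₂) (g' := v₃) (l' := w₃),
      ph_intw (evalLast _ D.form) (f' := Q.w₂) (g' := Q.v₂) (l' := Q.conv v₃ w₃)]
    rfl
  have c1 := lft_conv (Q := Q) (U := H) Q.w₂ Q.v₂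
  have c2 := lft_conv (Q := Q) (U := H) v₃ w₃
  simp only [← c1, ← c2, Module.End.mul_apply] at h1 ⊢
  set P : Rep k H (Module.End k ((HH ⊗[k] HH) ⊗[k] H)) := lft H (Q.conv v₃ w₃) with hP
  set O : Rep k H (Module.End k ((HH ⊗[k] HH) ⊗[k] H)) := lft H (Q.conv Q.w₂ Q.v₂) with hO
  -- `x ⊗ y ↦ Δ(x) n ⊗ y`
  set G : HH →ₗ[k] (HH ⊗[k] HH) ⊗[k] H := (LinearMap.applyₗ n ∘ₗ Q.conv v₃ w₃).rTensor H with hG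
  have i1 : Intw G l1 P := ⟨fun x m => by
    have : G ∘ₗ l1 x = P x ∘ₗ G := by
      ext a b
      simp [hG, hP, IsRep.mul (f := Q.conv v₃ w₃)]
    exact LinearMap.congr_fun this m⟩
  have i2 : Intw G l2 (rgt _ (Lm k H)) := ⟨fun x m => by
    have : G ∘ₗ l2 x = rgt _ (Lm k H) x ∘ₗ G := by ext a b; simp [hG]
    exact LinearMap.congr_fun this m⟩
  have i3 : Intw G Q.r2 (rgt _ Q.RS) := ⟨fun x m => by
    have : G ∘ₗ Q.r2 x = rgt _ Q.RS x ∘ₗ G := by ext a b; simp [hG]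
    exact LinearMap.congr_fun this m⟩
  have h2 : n ⊗ₜ[k] Q.β = G (1 ⊗ₜ Q.β) := by
    simp [hG, IsRep.one (f := Q.conv v₃ w₃)]
  have h3 : Q.conv P (rgt _ (Lm k H)) D.ℓ (Q.phb P (rgt _ (Lm k H)) (rgt _ Q.RS) (n ⊗ₜ[k] Q.β)) =
      G (Q.Δ D.ℓ * Q.pR) := by
    rw [h2, ← phb_intw G (f := l1) (g := l2) (l := Q.r2), ← pR_eq,
      ← (Intw.conv G : Intw G (Q.conv l1 l2) _).eq, conv_l1_l2]
  rw [h3, h1]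
  -- evaluation of `x ⊗ y` in the place of `c`
  set Ψ : HH →ₗ[k] HH := LinearMap.mulLeft k (s * Q.f) ∘ₗ LinearMap.mulRight k t ∘ₗ Q.Δ.toLinearMap ∘ₗ
    evalR D.form with hΨ
  have h4 : ∀ (w : HH) (T : H ⊗[k] HH), Q.contr22 (Q.aWord (evalLast _ D.form
      (ev3 O P (rgt _ (Lm k H)) T (G w)))) =
      Ψ (Q.mulSα.rTensor H ((TensorProduct.assoc k H H H).symm T) * w) := fun w T => by
    induction w with
    | zero => simp
    | add a b ha hb => simp only [map_add, mul_add, ha, hb]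
    | tmul x y =>
      refine vec_ev3 (κ := Q.contr22 ∘ₗ Q.aWord ∘ₗ evalLast _ D.form) (G := Ψ ∘ₗ
        LinearMap.mulRight k (x ⊗ₜ[k] y) ∘ₗ Q.mulSα.rTensor H ∘ₗ
        (TensorProduct.assoc k H H H).symm.toLinearMap) (fun p q r => ?_) T
      have e1 : O p (P q (rgt _ (Lm k H) r (G (x ⊗ₜ y)))) =
          Q.conv Q.w₂ Q.v₂ p (Q.conv v₃ w₃ (q * x) (s ⊗ₜ t)) ⊗ₜ (r * y) := by
        simp [hG, hO, hP, hn, IsRep.mul (f := Q.conv v₃ w₃)]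
      rw [e1]
      simp only [LinearMap.comp_apply, evalLast_tmul, map_smul]
      rw [contr22_aWord_conv]
      simp [hΨ, mulSα, mul_assoc]
  have h5 := h4 (Q.Δ D.ℓ * Q.pR) Q.phiInv
  have h6 : Q.mulSα.rTensor H ((TensorProduct.assoc k H H H).symm Q.phiInv) * (Q.Δ D.ℓ * Q.pR) =
      Q.cElt D.ℓ := by
    rw [cElt, mul_assoc]; rfl
  rw [h6] at h5
  refine h5.trans ?_
  refine Eq.trans ?_ (Q.aWord_apply s t).symm
  rw [hΨ, ← f_Δ_α]
  simp only [LinearMap.comp_apply, D.evalR_form]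
  simp [mul_assoc]

/-- `x ⊗ y ⊗ z ↦ S(y) α z ⊗ c S(x)` -/
def swapMulSα (Q : QuasiHopfAlgebra k H) (c : H) : H ⊗[k] HH →ₗ[k] HH :=
  (TensorProduct.comm k H H).toLinearMap ∘ₗ
    TensorProduct.map (LinearMap.mulLeft k c ∘ₗ Q.S) Q.mulSα

@[simp] lemma swapMulSα_tmul (c x : H) (y : HH) :
    Q.swapMulSα c (x ⊗ₜ y) = Q.mulSα y ⊗ₜ (c * Q.S x) := rfl

lemma contr22_straighten (c : H) : Q.contr22 (Q.aWord (Q.phb (Q.conv Q.w₂ Q.v₂) (Q.conv v₃ w₃)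
    (rgt HH Q.r2) (Q.phb v₃ w₃ (rgt HH Q.r2) ((1 ⊗ₜ c) ⊗ₜ (1 ⊗ₜ Q.β))))) = Q.swapMulSα c Q.phi := by
  set v : HH ⊗[k] HH := (1 ⊗ₜ c) ⊗ₜ (1 ⊗ₜ Q.β) with hv
  have hcup : REq (vecK Q.contr22 v) (Q.conv w₃ (rgt HH Q.r2)) (Q.triv _) :=
    REq.of_cup (TensorProduct.mk k HH HH (1 ⊗ₜ c) ∘ₗ TensorProduct.mk k H H 1)
      (fun x y => by simp [hv, mul_assoc])
  have h1 := straighten_word (Q := Q) (K := vecK Q.contr22 v) Q.w₂ Q.v₂ v₃ w₃ (rgt HH Q.r2)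
    (Q.cap_v v) hcup
  refine h1.trans ?_
  -- the cap and the cup of the strand that was straightened
  have h2 : ∀ x y z : H, Q.contr22 (Q.phb Q.w₂ w₃ (rgt HH Q.r2) ((x ⊗ₜ y) ⊗ₜ (z ⊗ₜ Q.β))) =
      (x * (Q.α * z)) ⊗ₜ y := fun x y z => by
    refine (vec_ev3 (κ := Q.contr22) (v := (x ⊗ₜ y) ⊗ₜ (z ⊗ₜ Q.β))
      (G := TensorProduct.mk k H H (x * (Q.α * z)) ∘ₗ LinearMap.mulLeft k y ∘ₗ
      LinearMap.mul' k H ∘ₗ (TensorProduct.map Q.S (LinearMap.mul' k H ∘ₗ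
          TensorProduct.map (LinearMap.mulLeft k Q.α) (LinearMap.mulLeft k Q.β ∘ₗ Q.S))))
          (fun x y z => ?_) Q.phiInv).trans ?_
    · simp [mul_assoc]
    · have := Q.antipode_φ_inv
      simp only [LinearMap.comp_apply, phiInv, this]
      simp
  rw [vecK_apply, Module.End.mul_apply]
  refine vec_ev3 (κ := Q.contr22 ∘ₗ Q.phb Q.w₂ w₃ (rgt HH Q.r2)) (fun x y z => ?_) Q.phi
  simp [hv, h2, mulSα]

end Existence
end
end QuasiHopfAlgebra

namespace QuasiHopfAlgebra

noncomputable section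

section Existence

variable {k H : Type*} [Field k] [Ring H] [Algebra k H] {Q : QuasiHopfAlgebra k H}

/-! ### Existence of a categorical cointegral -/

local notation "HH" => H ⊗[k] H

set_option maxSynthPendingDepth 4

lemma bElt_eq : Q.bElt = (Q.ph (Q.conv l1 l2) Q.r2 Q.r1 * Q.phb l1 l2 Q.r2) (Q.β ⊗ₜ Q.β) := by
  have h0 : Q.ph (Q.conv l1 l2) Q.r2 Q.r1 * Q.phb l1 l2 Q.r2 =
      ev4 l1 l2 Q.r2 Q.r1 (Q.Δ₁ Q.phi * tensorOne Q.phiInv) := by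
    rw [ev4_mul, ev4_tensorOne, ev4_Δ₁]; rfl
  rw [h0]
  refine (vec_ev4 (κ := LinearMap.id) (G := TensorProduct.map Q.mulβS Q.mulβS ∘ₗ perm1423)
    (fun a b c d => ?_) _).symm
  simp [perm1423, mulβS, mul_assoc]

/-- The left regular representation on the first factor of `H ⊗ (H ⊗ H)`. -/
abbrev eX : Rep k H (Module.End k (H ⊗[k] HH)) := lft HH (Lm k H)

instance : Intw Q.gaugedΔ l1 eX := ⟨fun x m => by
  have : Q.gaugedΔ ∘ₗ l1 x = eX x ∘ₗ Q.gaugedΔ := by ext; simp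
  exact LinearMap.congr_fun this m⟩

/-- The image of `Δ(x) pᴿ` under `id ⊗ Δ( ) f⁻¹`, as a word. -/
lemma gaugedΔ_pR [FiniteDimensional k H] (x : H) : Q.gaugedΔ (Q.Δ x * Q.pR) =
    Q.conv eX (Q.conv eL₁ eL₂) x (Q.phb eX (Q.conv eL₁ eL₂) (Q.conv Q.eR₂ Q.eR₁)
      (Q.ph (Q.conv eL₁ eL₂) Q.eR₂ Q.eR₁ (Q.phb eL₁ eL₂ Q.eR₂ (1 ⊗ₜ (Q.β ⊗ₜ Q.β))))) := by
  have h1 : Q.ph (Q.conv eL₁ eL₂) Q.eR₂ Q.eR₁ (Q.phb eL₁ eL₂ Q.eR₂ ((1 : H) ⊗ₜ (Q.β ⊗ₜ Q.β))) =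
      Q.gaugedΔ (1 ⊗ₜ Q.β) := by
    have e1 := phb_intw (Q := Q) (TensorProduct.mk k H HH 1) (f := l1) (g := l2) (l := Q.r2) (f' := eL₁)
      (g' := eL₂) (l' := Q.eR₂) (Q.β ⊗ₜ Q.β)
    have e2 := ph_intw (Q := Q) (TensorProduct.mk k H HH 1) (f := Q.conv l1 l2) (g := Q.r2) (l := Q.r1)
      (f' := Q.conv eL₁ eL₂) (g' := Q.eR₂) (l' := Q.eR₁) (Q.phb l1 l2 Q.r2 (Q.β ⊗ₜ Q.β))
    simp only [TensorProduct.mk_apply] at e1 e2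
    rw [← e1, ← e2, gaugedΔ_tmul, Δ_β_fInv, bElt_eq]
    rfl
  rw [h1, ← phb_intw Q.gaugedΔ (f := l1) (g := l2) (l := Q.r2), ← pR_eq,
    ← (Intw.conv Q.gaugedΔ : Intw Q.gaugedΔ (Q.conv l1 l2) _).eq, conv_l1_l2]

lemma gaugedΔ_mul (s t : HH) :
    Q.gaugedΔ (s * t) = act2 (Q.conv l1 l2) s (Q.gaugedΔ t) := by
  induction s with
  | zero => simp
  | add a b ha hb => simp only [add_mul, map_add, LinearMap.add_apply, ha, hb]
  | tmul x y =>
    induction t with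
    | zero => simp
    | add a b ha hb => simp only [mul_add, map_add, ha, hb]
    | tmul a b => simp [conv_l1_l2, mul_assoc]

/-- `(x ⊗ c) ⊗ X ⊗ w₁ ⊗ w₂ ↦ ((x ⊗ c) ⊗ X ⊗ w₁) ⊗ w₂` -/
def arrange (k H : Type*) [Field k] [Ring H] [Algebra k H] :
    (H ⊗[k] H) ⊗[k] (H ⊗[k] (H ⊗[k] H)) →ₗ[k] ((H ⊗[k] H) ⊗[k] (H ⊗[k] H)) ⊗[k] H :=
  (TensorProduct.assoc k (H ⊗[k] H) (H ⊗[k] H) H).symm.toLinearMap ∘ₗ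
    (TensorProduct.assoc k H H H).symm.toLinearMap.lTensor (H ⊗[k] H)

@[simp] lemma arrange_tmul (s : HH) (x y z : H) :
    arrange k H (s ⊗ₜ (x ⊗ₜ (y ⊗ₜ z))) = (s ⊗ₜ (x ⊗ₜ y)) ⊗ₜ z := rfl

variable {μ : H →ₐ[k] k} (D : Q.IntegralPair μ)

/-- The word by which `D.form` is evaluated on the coaction. -/
def coactWord (Q : QuasiHopfAlgebra k H) (μ : H →ₐ[k] k) : Module.End k (H ⊗[k] HH) :=
  Q.phb eL₂ (Q.conv (chr _ μ) Q.eR₂) Q.eR₁ * Q.phb (chr _ μ) Q.eR₂ Q.eR₁ * Q.phb Q.eC eL₁ eL₂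

lemma contr22_coactWord (c : H) (t : H ⊗[k] (H ⊗[k] HH)) :
    Q.contr22 (evalLast _ D.form ((Q.phb (rgt _ (Lm k H)) (Q.conv (chr _ μ) (rgt _ Q.RS))
        (lft H (rgt HH Q.r2)) * Q.phb (chr _ μ) (rgt _ Q.RS) (lft H (rgt HH Q.r2)) *
        Q.phb (lft H Q.w₂) (lft H w₃) (rgt _ (Lm k H)))
        (arrange k H (((TensorProduct.mk k H H).flip c).rTensor _ t)))) =
    ((Q.mulα ∘ₗ slice D.form) ∘ₗ Q.coactWord μ ∘ₗ TensorProduct.mk k H HH c).lTensor H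
      (Q.contrα HH t) := by
  induction t with
  | zero => simp
  | add a b ha hb => simp only [map_add, ha, hb]
  | tmul x' t =>
  induction t with
  | zero => simp
  | add a b ha hb => simp only [map_add, TensorProduct.tmul_add, ha, hb]
  | tmul X w =>
  set j : H ⊗[k] HH →ₗ[k] (HH ⊗[k] HH) ⊗[k] H := arrange k H ∘ₗ
    TensorProduct.map (TensorProduct.mk k H H x') (TensorProduct.mk k H HH X) with hj
  have i1 : Intw j Q.eC (lft H Q.w₂) := ⟨fun x m => by
    have : j ∘ₗ Q.eC x = lft H Q.w₂ x ∘ₗ j := by ext; simp [hj]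
    exact LinearMap.congr_fun this m⟩
  have i2 : Intw j eL₁ (lft H w₃) := ⟨fun x m => by
    have : j ∘ₗ eL₁ x = lft H w₃ x ∘ₗ j := by ext; simp [hj]
    exact LinearMap.congr_fun this m⟩
  have i3 : Intw j eL₂ (rgt _ (Lm k H)) := ⟨fun x m => by
    have : j ∘ₗ eL₂ x = rgt _ (Lm k H) x ∘ₗ j := by ext; simp [hj]
    exact LinearMap.congr_fun this m⟩
  have i4 : Intw j Q.eR₂ (rgt _ Q.RS) := ⟨fun x m => by
    have : j ∘ₗ Q.eR₂ x = rgt _ Q.RS x ∘ₗ j := by ext; simp [hj]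
    exact LinearMap.congr_fun this m⟩
  have i5 : Intw j Q.eR₁ (lft H (rgt HH Q.r2)) := ⟨fun x m => by
    have : j ∘ₗ Q.eR₁ x = lft H (rgt HH Q.r2) x ∘ₗ j := by ext; simp [hj]
    exact LinearMap.congr_fun this m⟩
  have h1 : arrange k H (((TensorProduct.mk k H H).flip c).rTensor _ (x' ⊗ₜ[k] (X ⊗ₜ[k] w))) =
      j (c ⊗ₜ w) := by simp [hj]
  rw [h1, Module.End.mul_apply, Module.End.mul_apply,
    ← phb_intw j (f := Q.eC) (g := eL₁) (l := eL₂),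
    ← phb_intw j (f := chr _ μ) (g := Q.eR₂) (l := Q.eR₁),
    ← phb_intw j (f := eL₂) (g := Q.conv (chr _ μ) Q.eR₂) (l := Q.eR₁)]
  have h2 : Q.contr22 ∘ₗ evalLast _ D.form ∘ₗ j = TensorProduct.mk k H H (x' * (Q.α * X)) ∘ₗ
      Q.mulα ∘ₗ slice D.form := by
    ext a b d
    simp [hj]
  exact LinearMap.congr_fun h2 _

lemma lTensor_coactWord [FiniteDimensional k H] (c : H) :
    ((Q.mulα ∘ₗ slice D.form) ∘ₗ Q.coactWord μ ∘ₗ TensorProduct.mk k H HH c ∘ₗ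
      LinearMap.mulRight k Q.fInv ∘ₗ Q.Δ.toLinearMap).lTensor H (Q.cElt D.ℓ) =
      Q.swapMulSα c Q.phi := by
  set o : Rep k H (Module.End k ((HH ⊗[k] HH) ⊗[k] H)) := lft H Q.w₂ with ho
  set d : Rep k H (Module.End k ((HH ⊗[k] HH) ⊗[k] H)) := lft H Q.v₂ with hd
  set x : Rep k H (Module.End k ((HH ⊗[k] HH) ⊗[k] H)) := lft H v₃ with hx
  set a : Rep k H (Module.End k ((HH ⊗[k] HH) ⊗[k] H)) := lft H w₃ with ha
  set z : Rep k H (Module.End k ((HH ⊗[k] HH) ⊗[k] H)) := lft H (rgt HH Q.r2) with hz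
  set b : Rep k H (Module.End k ((HH ⊗[k] HH) ⊗[k] H)) := rgt _ (Lm k H) with hb
  set y : Rep k H (Module.End k ((HH ⊗[k] HH) ⊗[k] H)) := rgt _ Q.RS with hy
  set m : Rep k H (Module.End k ((HH ⊗[k] HH) ⊗[k] H)) := chr _ μ with hm
  set n : HH ⊗[k] HH := (1 ⊗ₜ c) ⊗ₜ (1 ⊗ₜ Q.β) with hn
  set v : (HH ⊗[k] HH) ⊗[k] H := n ⊗ₜ Q.β with hv
  set e : H ⊗[k] (H ⊗[k] HH) →ₗ[k] (HH ⊗[k] HH) ⊗[k] H := arrange k H ∘ₗ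
    ((TensorProduct.mk k H H).flip c).rTensor _ with he
  set e₁ : H ⊗[k] HH →ₗ[k] (HH ⊗[k] HH) ⊗[k] H := e ∘ₗ TensorProduct.mk k H _ 1 with he₁
  have i1 : Intw e₁ eX x := ⟨fun h m => by
    have : e₁ ∘ₗ eX h = x h ∘ₗ e₁ := by ext; simp [he, he₁, hx]
    exact LinearMap.congr_fun this m⟩
  have i2 : Intw e₁ eL₁ a := ⟨fun h m => by
    have : e₁ ∘ₗ eL₁ h = a h ∘ₗ e₁ := by ext; simp [he, he₁, ha]
    exact LinearMap.congr_fun this m⟩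
  have i3 : Intw e₁ eL₂ b := ⟨fun h m => by
    have : e₁ ∘ₗ eL₂ h = b h ∘ₗ e₁ := by ext; simp [he, he₁, hb]
    exact LinearMap.congr_fun this m⟩
  have i4 : Intw e₁ Q.eR₂ y := ⟨fun h m => by
    have : e₁ ∘ₗ Q.eR₂ h = y h ∘ₗ e₁ := by ext; simp [he, he₁, hy]
    exact LinearMap.congr_fun this m⟩
  have i5 : Intw e₁ Q.eR₁ z := ⟨fun h m => by
    have : e₁ ∘ₗ Q.eR₁ h = z h ∘ₗ e₁ := by ext; simp [he, he₁, hz]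
    exact LinearMap.congr_fun this m⟩
  have i6 : Intw e (lft (H ⊗[k] HH) Q.RS) d := ⟨fun h m => by
    have : e ∘ₗ lft (H ⊗[k] HH) Q.RS h = d h ∘ₗ e := by ext; simp [he, hd]
    exact LinearMap.congr_fun this m⟩
  have i7 : Intw e (rgt H eX) x := ⟨fun h m => by
    have : e ∘ₗ rgt H eX h = x h ∘ₗ e := by ext; simp [he, hx]
    exact LinearMap.congr_fun this m⟩
  have i8 : Intw e (rgt H (rgt H l1)) a := ⟨fun h m => by
    have : e ∘ₗ rgt H (rgt H l1) h = a h ∘ₗ e := by ext; simp [he, ha]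
    exact LinearMap.congr_fun this m⟩
  have i9 : Intw e (rgt H (rgt H l2)) b := ⟨fun h m => by
    have : e ∘ₗ rgt H (rgt H l2) h = b h ∘ₗ e := by ext; simp [he, hb]
    exact LinearMap.congr_fun this m⟩
  have i10 : Intw e (rgt H (rgt H (Q.conv l1 l2))) (Q.conv a b) := by
    rw [rgt_conv, rgt_conv]; infer_instance
  set κ := Q.contr22 ∘ₗ evalLast _ D.form with hκ
  have hdx : LEq (vecK κ v) (Q.conv d x) (Q.triv _) := fun h X => by
    have h1 := Q.cap_v (evalLast _ D.form (X v)) h 1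
    have i : Intw (evalLast (HH ⊗[k] HH) D.form) (Q.conv d x) (Q.conv Q.v₂ v₃) := inferInstance
    simp only [vecK_apply, Module.End.mul_apply, hκ, LinearMap.comp_apply, i.eq] at h1 ⊢
    simpa using h1
  have hoa : LEq (vecK κ v) (Q.conv o a) (Q.triv _) := fun h X => by
    have h1 := Q.cap_w (evalLast _ D.form (X v)) h 1
    have i : Intw (evalLast (HH ⊗[k] HH) D.form) (Q.conv o a) (Q.conv Q.w₂ w₃) := inferInstance
    simp only [vecK_apply, Module.End.mul_apply, hκ, LinearMap.comp_apply, i.eq] at h1 ⊢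
    simpa using h1
  have hby : REq (vecK κ v) (Q.conv b y) (Q.triv _) :=
    REq.of_cup (TensorProduct.mk k _ H n) (fun x y => by simp [hv, hb, hy, mul_assoc])
  have h1 := integral_word (Q := Q) (K := vecK κ v) (ℓ := D.ℓ) (μ := μ) o d x a b m y z
    (fun h => by ext; rfl) D.mul_ℓ D.ℓ_mul hdx hoa hby
  -- the right-hand side of the word
  have h2 : Q.phb (Q.conv o d) (Q.conv x a) z (Q.phb x a z v) =
      Q.phb (Q.conv Q.w₂ Q.v₂) (Q.conv v₃ w₃) (rgt HH Q.r2) (Q.phb v₃ w₃ (rgt HH Q.r2) n) ⊗ₜ Q.β := by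
    have e1 := phb_intw (Q := Q) ((TensorProduct.mk k (HH ⊗[k] HH) H).flip Q.β) (f := v₃) (g := w₃)
      (l := rgt HH Q.r2) (f' := x) (g' := a) (l' := z) n
    have e2 := phb_intw (Q := Q) ((TensorProduct.mk k (HH ⊗[k] HH) H).flip Q.β)
      (f := Q.conv Q.w₂ Q.v₂) (g := Q.conv v₃ w₃) (l := rgt HH Q.r2) (f' := Q.conv o d)
      (g' := Q.conv x a) (l' := z) (Q.phb v₃ w₃ (rgt HH Q.r2) n)
    rw [e1] at e2
    exact e2.symm
  have h3 : vecK κ v (Q.phb d x a * Q.ph o d (Q.conv x a) * Q.phb (Q.conv o d) (Q.conv x a) b *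
      Q.conv (Q.conv x a) b D.ℓ *
      Q.phb (Q.conv x a) b y * Q.phb (Q.conv o d) (Q.conv x a) z * Q.phb x a z) =
      Q.swapMulSα c Q.phi := by
    rw [vecK_apply, Module.End.mul_apply _ (Q.phb x a z), Module.End.mul_apply _ (Q.phb _ _ z), h2]
    exact (contr22_integral D _).trans (contr22_straighten c)
  -- the left-hand side of the word
  have h4 : v = e₁ (1 ⊗ₜ (Q.β ⊗ₜ Q.β)) := by simp [hv, hn, he₁, he]
  have h5 : Q.conv x (Q.conv a b) D.ℓ (Q.phb x (Q.conv a b) (Q.conv y z) (Q.ph (Q.conv a b) y z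
      (Q.phb a b y v))) = e (1 ⊗ₜ Q.gaugedΔ (Q.Δ D.ℓ * Q.pR)) := by
    rw [gaugedΔ_pR, h4, ← phb_intw e₁ (f := eL₁) (g := eL₂) (l := Q.eR₂),
      ← ph_intw e₁ (f := Q.conv eL₁ eL₂) (g := Q.eR₂) (l := Q.eR₁),
      ← phb_intw e₁ (f := eX) (g := Q.conv eL₁ eL₂) (l := Q.conv Q.eR₂ Q.eR₁),
      ← (Intw.conv e₁ : Intw e₁ (Q.conv eX (Q.conv eL₁ eL₂)) _).eq]
    rfl
  have h6 : Q.contrα HH (Q.phb (lft (H ⊗[k] HH) Q.RS) (rgt H eX) (rgt H (rgt H (Q.conv l1 l2)))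
      (1 ⊗ₜ Q.gaugedΔ (Q.Δ D.ℓ * Q.pR))) = Q.gaugedΔ (Q.cElt D.ℓ) := by
    refine (Q.contrα_phb (Q.conv l1 l2) (Q.gaugedΔ (Q.Δ D.ℓ * Q.pR)) 1 Q.phiInv).trans ?_
    rw [IsRep.one, cElt, mul_assoc, gaugedΔ_mul Q.qL]
    rfl
  have h7 := contr22_coactWord D c (Q.phb (lft (H ⊗[k] HH) Q.RS) (rgt H eX)
    (rgt H (rgt H (Q.conv l1 l2))) (1 ⊗ₜ Q.gaugedΔ (Q.Δ D.ℓ * Q.pR)))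
  rw [h6] at h7
  have h8 : e (Q.phb (lft (H ⊗[k] HH) Q.RS) (rgt H eX) (rgt H (rgt H (Q.conv l1 l2)))
      (1 ⊗ₜ Q.gaugedΔ (Q.Δ D.ℓ * Q.pR))) = Q.phb d x (Q.conv a b)
        (e (1 ⊗ₜ Q.gaugedΔ (Q.Δ D.ℓ * Q.pR))) := phb_intw e _
  rw [← h3, ← h1]
  simp only [vecK_apply, Module.End.mul_apply, h5, ← h8]
  simp only [Module.End.mul_apply] at h7
  refine Eq.trans ?_ h7.symm
  rw [gaugedΔ, ← LinearMap.comp_apply, ← LinearMap.lTensor_comp]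
  rfl

end Existence
end
end QuasiHopfAlgebra

namespace QuasiHopfAlgebra

noncomputable section

section Existence

variable {k H : Type*} [Field k] [Ring H] [Algebra k H] [FiniteDimensional k H]
  {Q : QuasiHopfAlgebra k H} {μ : H →ₐ[k] k} (D : Q.IntegralPair μ)

local notation "HH" => H ⊗[k] H

omit [FiniteDimensional k H] in
/-- Reconstruction of an element `s` of `H ⊗ H` from the functions `u ↦ η(S(u) s₁) s₂`. -/
lemma IntegralPair.lTensor_cElt_of_eval {F : H →ₗ[k] H} {s : HH}
    (h : ∀ u, F u = evalR (Q.ldualActL u D.η) (TensorProduct.comm k H H s)) :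
    F.lTensor H (Q.cElt D.ℓ) = s := by
  -- `x ⊗ y ↦ (a ↦ η(S(y) a) x)`
  set E : HH →ₗ[k] H →ₗ[k] H := TensorProduct.lift
    (LinearMap.smulRightₗ.flip.compl₂ (Q.ldualActL.flip D.η)) with hE
  have h1 : ∀ t, F.lTensor H t = (E t).rTensor H s := fun t => by
    induction t with
    | zero => simp
    | add a b ha hb => simp only [map_add, LinearMap.rTensor_add, LinearMap.add_apply, ha, hb]
    | tmul x y =>
      rw [LinearMap.lTensor_tmul, h]
      clear h
      induction s with
      | zero => simp
      | add a b ha hb => simp only [map_add, TensorProduct.tmul_add, ha, hb]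
      | tmul a b => simp [hE, TensorProduct.smul_tmul]
  have h2 : E (Q.cElt D.ℓ) = LinearMap.id := by
    ext z
    have h3 : ∀ t, E t z = Q.expand D.η z t := fun t => by
      induction t with
      | zero => simp
      | add a b ha hb => simp only [map_add, LinearMap.add_apply, ha, hb]
      | tmul a b => simp [hE]
    rw [h3, D.expand_eq]
    rfl
  rw [h1, h2, LinearMap.rTensor_id]
  rfl

/-- Evaluation of `D.form` on the coaction word. -/
lemma form_coactWord (t : HH) : Q.mulα (slice D.form (Q.coactWord μ (Q.gaugedΔ t))) =
    evalR D.form (Q.ph Q.r1 l2 (Q.conv (chr _ μ) Q.r2) t) := by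
  induction t with
  | zero => simp
  | add a b ha hb => simp only [map_add, ha, hb]
  | tmul c u =>
  have h0 : (Q.mulα ∘ₗ slice D.form) ∘ₗ Q.coactWord μ ∘ₗ TensorProduct.mk k H HH c ∘ₗ
      LinearMap.mulRight k Q.fInv ∘ₗ Q.Δ.toLinearMap =
      evalR D.form ∘ₗ Q.ph Q.r1 l2 (Q.conv (chr _ μ) Q.r2) ∘ₗ TensorProduct.mk k H H c := by
    refine D.hom_ext ((lTensor_coactWord D c).trans ?_)
    set F := evalR D.form ∘ₗ
      Q.ph Q.r1 l2 (Q.conv (chr _ μ) Q.r2) ∘ₗ TensorProduct.mk k H H c with hF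
    have h1 : ∀ u, F u = evalR (Q.ldualActL u D.η) (TensorProduct.comm k H H (Q.swapMulSα c Q.phi)) :=
      fun u => by
      refine vec_ev3 (κ := evalR D.form) (v := c ⊗ₜ u) (G := evalR (Q.ldualActL u D.η) ∘ₗ
        (TensorProduct.comm k H H).toLinearMap ∘ₗ Q.swapMulSα c) (fun x y z => ?_) Q.phi
      have e : Q.conv (chr _ μ) Q.r2 z (c ⊗ₜ[k] u) = c ⊗ₜ Q.conv (chr _ μ) Q.RS z u := by
        rw [← rgt_chr, ← rgt_conv, rgt_tmul]
      rw [e]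
      have := D.form_mul_conv y z u
      simp only [IntegralPair.form_apply] at this
      simp [this]
    exact (D.lTensor_cElt_of_eval h1).symm
  exact LinearMap.congr_fun h0 u

/-- The functional attached to an integral is compatible with the coactions. -/
lemma coactCompat_cointegral : Q.CoactCompat D.cointegral μ := fun t => by
  set m : Rep k H (Module.End k (H ⊗[k] HH)) := chr _ μ with hm
  set m' : Rep k H (Module.End k HH) := chr _ μ with hm'
  set κ := Q.mulα ∘ₗ slice D.form with hκ
  have h1 : ∀ w : HH, evalR D.cointegral w = evalR D.form (Q.ph l2 m' Q.r2 w) := fun w => by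
    induction w with
    | zero => simp
    | add a b ha hb => simp only [map_add, ha, hb]
    | tmul a b =>
      have e := ph_intw (Q := Q) (TensorProduct.mk k H H a) (f := Lm k H) (g := chr _ μ) (l := Q.RS)
        (f' := l2) (g' := m') (l' := Q.r2) b
      simp only [TensorProduct.mk_apply] at e
      rw [← e, evalR_tmul, evalR_tmul]
      rfl
  have h2 : ∀ w : H ⊗[k] HH, slice D.cointegral w = slice D.form (Q.ph eL₂ m Q.eR₂ w) := fun w => by
    induction w with
    | zero => simp
    | add a b ha hb => simp only [map_add, ha, hb]
    | tmul a b =>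
      have e := ph_intw (Q := Q) (TensorProduct.mk k H HH a) (f := l2) (g := m') (l := Q.r2)
        (f' := eL₂) (g' := m) (l' := Q.eR₂) b
      simp only [TensorProduct.mk_apply] at e
      rw [← e, slice_tmul, slice_tmul, h1]
  set v := Q.gaugedΔ t with hv
  have ho : LEq (vecK κ v) (Q.conv Q.eC eL₁) (Q.triv _) := by
    refine LEq.of_vec fun x => ?_
    ext c a b
    have h3 : Intw (slice D.form) (Q.conv Q.eC eL₁) (Q.conv Q.r1 l2) := inferInstance
    have := h3.eq x (c ⊗ₜ (a ⊗ₜ b))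
    simp only [hκ, LinearMap.comp_apply, TensorProduct.AlgebraTensorModule.curry_apply,
      TensorProduct.curry_apply, LinearMap.coe_restrictScalars]
    rw [this, (Q.mulα_isCap _).apply]
    simp
  have e1 := pentagon₁ (Q := Q) eL₂ m Q.eR₂ Q.eR₁
  set Z := Q.phb eL₂ (Q.conv m Q.eR₂) Q.eR₁ * Q.phb m Q.eR₂ Q.eR₁ with hZ
  have e2 := LEq.ph (Q := Q) ((ho.comp Z).conv_triv_left eL₂).symm (LEq.refl _ m)
    (LEq.refl _ (Q.conv Q.eR₂ Q.eR₁)) (Q.phb Q.eC eL₁ eL₂)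
  have e3 := ph_nat (Q := Q) (Q.phb Q.eC eL₁ eL₂) (f := Q.conv Q.eC (Q.conv eL₁ eL₂))
    (f' := Q.conv (Q.conv Q.eC eL₁) eL₂) (g := m) (g' := m) (h := Q.conv Q.eR₂ Q.eR₁)
    (h' := Q.conv Q.eR₂ Q.eR₁)
  have e4 := ph_intw (Q := Q) Q.gaugedΔ (f := Q.conv Q.r1 l2) (g := m') (l := Q.r2)
    (f' := Q.conv Q.eC (Q.conv eL₁ eL₂)) (g' := m) (l' := Q.conv Q.eR₂ Q.eR₁) t
  have e5 := LinearMap.congr_fun (pentagon' (Q := Q) Q.r1 l2 m' Q.r2) t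
  have e6 := form_coactWord D (Q.ph (Q.conv Q.r1 l2) m' Q.r2 t)
  simp only [vecK_apply, LinearMap.comp_apply, LinearMap.mulLeft_apply] at e2
  rw [h1, h2]
  simp only [Module.End.mul_apply] at e5
  rw [← e5, ← e6, e4, ← hv]
  calc _ = κ ((Q.ph eL₂ m Q.eR₂ * Q.phb (Q.conv eL₂ m) Q.eR₂ Q.eR₁ * Q.phb Q.eC eL₁ eL₂) v) := rfl
    _ = _ := by
      rw [e1, mul_assoc, e2, ← e3]
      rfl

lemma cointegral_mem : D.cointegral ∈ Q.catCointegrals μ :=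
  Q.mem_catCointegrals_iff.2 ⟨D.cointegral_adjAct, coactCompat_cointegral D⟩

end Existence
end
end QuasiHopfAlgebra

theorem mainTheorem1 {k H : Type*} [Field k] [Ring H] [Algebra k H] [FiniteDimensional k H]
    (Q : QuasiHopfAlgebra k H) :
    Function.Bijective Q.S ∧
    (∃! μ : H →ₐ[k] k, Q.IsModularFunction μ) ∧
    ∀ μ : H →ₐ[k] k, Q.IsModularFunction μ →
      ∀ lam ∈ Q.rightCointegrals, lam ≠ 0 →
        Module.finrank k (Q.catCointegrals μ) = 1 ∧
        Q.catCointegrals μ = Submodule.span k {Q.lamCat lam} := by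
  refine ⟨Q.S_bijective, Q.existsUnique_modularFunction, fun μ hμ lam hlam hlam0 => ?_⟩
  obtain ⟨Λ, lam₀, hΛ⟩ := Q.exists_rightCointegral
  obtain ⟨ℓ, η, hℓ, -, h1, h2⟩ := Q.exists_leftIntegral
  let D : Q.IntegralPair μ := ⟨ℓ, η, hℓ, Q.leftIntegral_mul hμ hℓ, h1, h2⟩
  obtain ⟨ξ, rfl⟩ := hlam
  rw [hΛ] at hlam0 ⊢
  have hξ : ξ Λ ≠ 0 := fun h => hlam0 (by rw [h, zero_smul])
  have hmul : ∀ (r : k) (l : Module.Dual k H), Q.lamCat (r • l) = r • Q.lamCat l := fun _ _ => rfl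
  -- every categorical cointegral is a multiple of `lamCat lam₀`
  have hspan : ∀ θ ∈ Q.catCointegrals μ, θ = Q.preCointegral θ μ Λ • Q.lamCat lam₀ := fun θ hθ => by
    obtain ⟨hθ1, hθ2⟩ := Q.mem_catCointegrals_iff.1 hθ
    conv_lhs => rw [← Q.lamCat_rightCoinv_preCointegral hθ1 hθ2, hΛ, hmul]
  obtain ⟨r, hD⟩ : ∃ r : k, D.cointegral = r • Q.lamCat lam₀ :=
    ⟨_, hspan _ (QuasiHopfAlgebra.cointegral_mem D)⟩
  have hr : r ≠ 0 := fun h => D.cointegral_ne_zero (by rw [hD, h, zero_smul])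
  have hne : Q.lamCat lam₀ ≠ 0 := fun h => D.cointegral_ne_zero (by rw [hD, h, smul_zero])
  have hmem : Q.lamCat lam₀ ∈ Q.catCointegrals μ := by
    have := QuasiHopfAlgebra.cointegral_mem D
    rw [hD] at this
    exact ((Q.catCointegrals μ).smul_mem_iff hr).1 this
  have heq : Q.catCointegrals μ = Submodule.span k {Q.lamCat (ξ Λ • lam₀)} := by
    rw [hmul, Submodule.span_singleton_smul_eq hξ.isUnit]
    refine le_antisymm (fun θ hθ => ?_) ((Submodule.span_singleton_le_iff_mem _ _).2 hmem)
    rw [hspan θ hθ]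
    exact Submodule.smul_mem _ _ (Submodule.mem_span_singleton_self _)
  refine ⟨?_, heq⟩
  rw [heq]
  exact finrank_span_singleton (smul_ne_zero hξ hne)
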